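/- Let $d\ge 2$, $s\in(0,1)$, and write $L^2_{x,\theta}=L^2(\mathbb R^d\times\mathbb S^{d-1})$ for the space of real-valued square integrable functions with respect to $dx\,d\theta$, where $d\theta$ is the surface measure of the unit sphere. Let $$K(\theta',\theta)=\frac{c\,2^{s-\frac{d-1}{2}}}{(1-\theta\cdot\theta')^{\frac{d-1}{2}+s}},\qquad \mathcal B(g,h)=\frac12\int_{\mathbb S^{d-1}}\int_{\mathbb S^{d-1}}K(\theta',\theta)\,(g(\theta')-g(\theta))(h(\theta')-h(\theta))\,d\theta'd\theta,$$ where $c>0$ is a constant (in the application, $c=c_{d-1,s}$ is the normalization constant of the fractional Laplacian on $\mathbb R^{d-1}$). Let $H^s_{\mathcal B}=\{g\in L^2(\mathbb S^{d-1}):\mathcal B(g,g)<\infty\}$ with $\|g\|_{H^s_{\mathcal B}}^2=\mathcal B(g,g)+\|g\|_{L^2(\mathbb S^{d-1})}^2$. For $\varepsilon>0$ let $\mathcal H^s_\varepsilon=L^2_x(\mathbb R^d;H^s_{\mathcal B})$ with the norm $$\|u\|_{\mathcal H^s_\varepsilon}^2=\|u\|_{L^2_{x,\theta}}^2+\varepsilon^{2s}\int_{\mathbb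 R^d}\|u(x,\cdot)\|_{H^s_{\mathcal B}}^2\,dx,$$ let $(\mathcal H^s_\varepsilon)'$ be its dual, let $Tu=\theta\cdot\nabla_xu$ in the sense of distributions, that is, $\langle Tu,\varphi\rangle=-\int u\,(\theta\cdot\nabla_x\varphi)\,dx\,d\theta$ for $\varphi\in C_c^\infty(\mathbb R^d\times\mathbb S^{d-1})$, and let $$\mathcal Y^s_\varepsilon=\{u\in\mathcal H^s_\varepsilon: Tu\in(\mathcal H^s_\varepsilon)'\},\qquad \|u\|_{\mathcal Y^s_\varepsilon}=\|u\|_{\mathcal H^s_\varepsilon}+\|Tu\|_{(\mathcal H^s_\varepsilon)'}.$$ Let $\sigma,\lambda:\mathbb R^d\to\mathbb R$ be Lipschitz continuous and assume that $\sigma_0\le\sigma\le\sigma_0^{-1}$ and $\lambda_0\le\lambda\le\lambda_0^{-1}$ for some constants $\sigma_0,\lambda_0>0$. A function $u\in\mathcal Y^s_\varepsilon$ is a weak solution of the fractional Fokker–Planck equation $$\theta\cdot\nabla_xu+\lambda(x)u=\varepsilon^{2s}\sigma(x)\int_{\mathbb S^{d-1}}K(\theta',\theta)\,(u(x,\theta')-u(x,\theta))\,d\theta'+f\quad\text{in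 }\mathbb R^d\times\mathbb S^{d-1}$$ if for all $\varphi\in C_c^\infty(\mathbb R^d\times\mathbb S^{d-1})$ $$\int\big(-u\,(\theta\cdot\nabla_x\varphi)+\lambda u\varphi\big)\,dx\,d\theta+\varepsilon^{2s}\int_{\mathbb R^d}\sigma(x)\,\mathcal B(u(x,\cdot),\varphi(x,\cdot))\,dx=\int f\varphi\,dx\,d\theta .$$ **Theorem.** For every $\varepsilon>0$ and every $f\in L^2_{x,\theta}$ there is a unique weak solution $u\in\mathcal Y^s_\varepsilon$. Moreover, for every $\varepsilon_0>0$ there is a constant $C>0$, depending only on $d,s,c,\sigma,\lambda$ and $\varepsilon_0$, such that $\|u\|_{\mathcal Y^s_\varepsilon}\le C\|f\|_{L^2_{x,\theta}}$ for all $\varepsilon\in(0,\varepsilon_0]$ and all $f\in L^2_{x,\theta}$. -/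

import Mathlib

open MeasureTheory
open scoped ContDiff Manifold NNReal ENNReal

noncomputable section

namespace FokkerPlanck

/-- The position space `ℝ^d`, where `d = n + 1`. -/
abbrev Pos (n : ℕ) : Type := EuclideanSpace ℝ (Fin (n + 1))

/-- The unit sphere `𝕊^{d-1}` of directions, `d - 1 = n`. -/
abbrev Dir (n : ℕ) : Type := Metric.sphere (0 : EuclideanSpace ℝ (Fin (n + 1))) 1

/-- The surface measure `dθ` on `𝕊^{d-1}`. -/
abbrev surf (n : ℕ) : Measure (Dir n) := (volume : Measure (Pos n)).toSphere

/-- The measure `dx dθ` on the phase space `ℝ^d × 𝕊^{d-1}`. -/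
abbrev phase (n : ℕ) : Measure (Pos n × Dir n) := (volume : Measure (Pos n)).prod (surf n)

/-- The space `L²_{x,θ}` of real-valued functions. -/
abbrev L2 (n : ℕ) : Type := Lp ℝ 2 (phase n)

/-- The angular kernel
`K(θ', θ) = c 2^{s - (d-1)/2} / (1 - θ·θ')^{(d-1)/2 + s}`, with `d - 1 = n`; here `c > 0` is the
normalization constant of the fractional Laplacian on `ℝ^{d-1}`.  (On the diagonal the convention
`1 / 0 = 0` is harmless: in the form below the kernel is multiplied by increments.) -/
def kernel (n : ℕ) (s : ℝ) (c : ℝ≥0) (θ' θ : Dir n) : ℝ :=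
  (c : ℝ) * (2 : ℝ) ^ (s - (n : ℝ) / 2) /
    (1 - inner ℝ (θ : Pos n) (θ' : Pos n)) ^ ((n : ℝ) / 2 + s)

/-- The bilinear form
`𝓑(g, h) = ½ ∬ K(θ', θ) (g(θ') - g(θ)) (h(θ') - h(θ)) dθ' dθ`. -/
def formB (n : ℕ) (s : ℝ) (c : ℝ≥0) (g h : Dir n → ℝ) : ℝ :=
  1 / 2 * ∫ p : Dir n × Dir n,
    kernel n s c p.1 p.2 * (g p.1 - g p.2) * (h p.1 - h p.2) ∂((surf n).prod (surf n))

/-- The quadratic form `𝓑(g, g)` as an element of `[0, ∞]`. -/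
def energyB (n : ℕ) (s : ℝ) (c : ℝ≥0) (g : Dir n → ℝ) : ℝ≥0∞ :=
  1 / 2 * ∫⁻ p : Dir n × Dir n,
    ENNReal.ofReal (kernel n s c p.1 p.2 * (g p.1 - g p.2) ^ 2) ∂((surf n).prod (surf n))

/-- The inner product `⟨g, h⟩ = 𝓑(g, h) + ∫ g h dθ` of `H^s_𝓑`. -/
def innerHB (n : ℕ) (s : ℝ) (c : ℝ≥0) (g h : Dir n → ℝ) : ℝ :=
  formB n s c g h + ∫ θ, g θ * h θ ∂(surf n)

/-! ### Auxiliary facts for the construction of the Hilbert space -/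

lemma kernel_nonneg (n : ℕ) (s : ℝ) (c : ℝ≥0) (a b : Dir n) : 0 ≤ kernel n s c a b := by
  unfold kernel
  have h : inner ℝ (b : Pos n) (a : Pos n) ≤ 1 := by
    have h1 := real_inner_le_norm (b : Pos n) (a : Pos n)
    have ha : ‖(a : Pos n)‖ = 1 := norm_eq_of_mem_sphere a
    have hb : ‖(b : Pos n)‖ = 1 := norm_eq_of_mem_sphere b
    rw [ha, hb] at h1
    linarith
  have h2 : 0 ≤ 1 - inner ℝ (b : Pos n) (a : Pos n) := by linarith
  positivity

lemma measurable_kernel (n : ℕ) (s : ℝ) (c : ℝ≥0) :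
    Measurable (fun p : Dir n × Dir n => kernel n s c p.1 p.2) := by
  unfold kernel
  have h : Measurable (fun p : Dir n × Dir n => inner ℝ (p.2 : Pos n) (p.1 : Pos n)) := by
    apply Continuous.measurable
    fun_prop
  exact ((measurable_const.sub h).pow_const _).const_div _

lemma slice_ae {n : ℕ} {f g : Pos n × Dir n → ℝ} (h : f =ᵐ[phase n] g) :
    ∀ᵐ x : Pos n, (∀ᵐ θ ∂(surf n), f (x, θ) = g (x, θ)) ∧
      ∀ᵐ p ∂((surf n).prod (surf n)), f (x, p.1) = g (x, p.1) ∧ f (x, p.2) = g (x, p.2) := by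
  filter_upwards [Measure.ae_ae_of_ae_prod h] with x hx
  refine ⟨hx, ?_⟩
  filter_upwards [Measure.quasiMeasurePreserving_fst.ae hx,
    Measure.quasiMeasurePreserving_snd.ae hx] with p h1 h2 using ⟨h1, h2⟩

lemma measurable_incr {n : ℕ} (s : ℝ) (c : ℝ≥0) (u v : L2 n) :
    Measurable (fun q : Pos n × (Dir n × Dir n) =>
      kernel n s c q.2.1 q.2.2 * (u (q.1, q.2.1) - u (q.1, q.2.2)) *
        (v (q.1, q.2.1) - v (q.1, q.2.2))) := by
  have hu : Measurable (u : Pos n × Dir n → ℝ) := (Lp.stronglyMeasurable u).measurable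
  have hv : Measurable (v : Pos n × Dir n → ℝ) := (Lp.stronglyMeasurable v).measurable
  have hk : Measurable (fun q : Pos n × (Dir n × Dir n) => kernel n s c q.2.1 q.2.2) :=
    (measurable_kernel n s c).comp measurable_snd
  fun_prop

lemma measurable_energy {n : ℕ} (s : ℝ) (c : ℝ≥0) (u : L2 n) :
    Measurable (fun q : Pos n × (Dir n × Dir n) =>
      ENNReal.ofReal (kernel n s c q.2.1 q.2.2 * (u (q.1, q.2.1) - u (q.1, q.2.2)) ^ 2)) := by
  have h := (measurable_incr s c u u).ennreal_ofReal
  simpa only [pow_two, mul_assoc] using h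

lemma measurable_energyB {n : ℕ} (s : ℝ) (c : ℝ≥0) (u : L2 n) :
    Measurable (fun x : Pos n => energyB n s c (fun θ => u (x, θ))) := by
  unfold energyB
  exact (measurable_energy s c u).lintegral_prod_right'.const_mul _

lemma measurable_sliceEnergy {n : ℕ} (s : ℝ) (c : ℝ≥0) {g : Dir n → ℝ} (hg : Measurable g) :
    Measurable (fun p : Dir n × Dir n =>
      ENNReal.ofReal (kernel n s c p.1 p.2 * (g p.1 - g p.2) ^ 2)) := by
  have hk := measurable_kernel n s c
  fun_prop

lemma energyB_le {n : ℕ} (s : ℝ) (c : ℝ≥0) {f g h : Dir n → ℝ} (hg : Measurable g)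
    (hh : Measurable h) (hf : ∀ᵐ p ∂((surf n).prod (surf n)),
      f p.1 = g p.1 + h p.1 ∧ f p.2 = g p.2 + h p.2) :
    energyB n s c f ≤ 2 * energyB n s c g + 2 * energyB n s c h := by
  unfold energyB
  rw [mul_left_comm 2, mul_left_comm 2, ← mul_add]
  gcongr
  rw [← lintegral_const_mul _ (measurable_sliceEnergy s c hg),
    ← lintegral_const_mul _ (measurable_sliceEnergy s c hh),
    ← lintegral_add_left ((measurable_sliceEnergy s c hg).const_mul _)]
  apply lintegral_mono_ae
  filter_upwards [hf] with p hp
  have hK := kernel_nonneg n s c p.1 p.2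
  rw [hp.1, hp.2]
  have h2 : (2 : ℝ≥0∞) = ENNReal.ofReal 2 := by simp
  rw [h2, ← ENNReal.ofReal_mul (by norm_num), ← ENNReal.ofReal_mul (by norm_num),
    ← ENNReal.ofReal_add (by positivity) (by positivity)]
  apply ENNReal.ofReal_le_ofReal
  nlinarith [mul_nonneg hK (sq_nonneg ((g p.1 - g p.2) - (h p.1 - h p.2)))]

lemma energyB_eq {n : ℕ} (s : ℝ) (c : ℝ≥0) (a : ℝ) {f g : Dir n → ℝ} (hg : Measurable g)
    (hf : ∀ᵐ p ∂((surf n).prod (surf n)), f p.1 = a * g p.1 ∧ f p.2 = a * g p.2) :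
    energyB n s c f = ENNReal.ofReal (a ^ 2) * energyB n s c g := by
  unfold energyB
  rw [mul_left_comm, ← lintegral_const_mul _ (measurable_sliceEnergy s c hg)]
  congr 1
  apply lintegral_congr_ae
  filter_upwards [hf] with p hp
  rw [hp.1, hp.2, ← ENNReal.ofReal_mul (sq_nonneg a)]
  congr 1
  ring

lemma measurable_slice {n : ℕ} (u : L2 n) (x : Pos n) : Measurable (fun θ => u (x, θ)) :=
  (Lp.stronglyMeasurable u).measurable.comp measurable_prodMk_left

lemma energyB_add_le {n : ℕ} (s : ℝ) (c : ℝ≥0) (u v : L2 n) :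
    ∀ᵐ x : Pos n, energyB n s c (fun θ => (u + v) (x, θ)) ≤
      2 * energyB n s c (fun θ => u (x, θ)) + 2 * energyB n s c (fun θ => v (x, θ)) := by
  filter_upwards [slice_ae (Lp.coeFn_add u v)] with x hx
  exact energyB_le s c (measurable_slice u x) (measurable_slice v x) hx.2

lemma energyB_smul {n : ℕ} (s : ℝ) (c : ℝ≥0) (a : ℝ) (u : L2 n) :
    ∀ᵐ x : Pos n, energyB n s c (fun θ => (a • u) (x, θ)) =
      ENNReal.ofReal (a ^ 2) * energyB n s c (fun θ => u (x, θ)) := by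
  filter_upwards [slice_ae (Lp.coeFn_smul a u)] with x hx
  exact energyB_eq s c a (measurable_slice u x) hx.2

/-- The functions of `L²_x(ℝ^d; H^s_𝓑)`: those `u ∈ L²_{x,θ}` with `∫ 𝓑(u(x,·), u(x,·)) dx < ∞`. -/
def energySpace (n : ℕ) (s : ℝ) (c : ℝ≥0) : Submodule ℝ (L2 n) where
  carrier := {u | ∫⁻ x : Pos n, energyB n s c (fun θ => u (x, θ)) < ⊤}
  zero_mem' := by
    have h : ∀ᵐ x : Pos n, energyB n s c (fun θ => (0 : L2 n) (x, θ)) = 0 := by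
      filter_upwards [slice_ae (Lp.coeFn_zero ℝ 2 (phase n))] with x hx
      unfold energyB
      rw [lintegral_eq_zero_of_ae_eq_zero, mul_zero]
      filter_upwards [hx.2] with p hp
      simp only [hp.1, hp.2]
      simp
    change ∫⁻ x : Pos n, energyB n s c (fun θ => (0 : L2 n) (x, θ)) < ⊤
    rw [lintegral_congr_ae h]
    simp
  add_mem' := by
    intro u v hu hv
    refine lt_of_le_of_lt (lintegral_mono_ae (energyB_add_le s c u v)) ?_
    rw [lintegral_add_left ((measurable_energyB s c u).const_mul _),
      lintegral_const_mul _ (measurable_energyB s c u),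
      lintegral_const_mul _ (measurable_energyB s c v)]
    exact ENNReal.add_lt_top.2 ⟨ENNReal.mul_lt_top (by simp) hu, ENNReal.mul_lt_top (by simp) hv⟩
  smul_mem' := by
    intro a u hu
    change ∫⁻ x : Pos n, energyB n s c (fun θ => (a • u) (x, θ)) < ⊤
    rw [lintegral_congr_ae (energyB_smul s c a u), lintegral_const_mul _ (measurable_energyB s c u)]
    exact ENNReal.mul_lt_top (by simp) hu

/-- The space `𝓗^s_ε = L²_x(ℝ^d; H^s_𝓑)`.  As a set it does not depend on `ε`; the parameter
enters its inner product, which is defined below. -/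
def HSpace (n : ℕ) (s : ℝ) (c _ε : ℝ≥0) : Type := energySpace n s c

instance (n : ℕ) (s : ℝ) (c ε : ℝ≥0) : AddCommGroup (HSpace n s c ε) :=
  inferInstanceAs (AddCommGroup (energySpace n s c))

instance (n : ℕ) (s : ℝ) (c ε : ℝ≥0) : Module ℝ (HSpace n s c ε) :=
  inferInstanceAs (Module ℝ (energySpace n s c))

/-- The inclusion `𝓗^s_ε ⊆ L²_{x,θ}`. -/
def HSpace.toL2 {n : ℕ} {s : ℝ} {c ε : ℝ≥0} (u : HSpace n s c ε) : L2 n := Subtype.val u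

/-- The inner product of `𝓗^s_ε`,
`⟨u, v⟩ = ∬ u v dx dθ + ε^{2s} ∫ ⟨u(x,·), v(x,·)⟩_{H^s_𝓑} dx`, so that
`‖u‖² = ‖u‖²_{L²_{x,θ}} + ε^{2s} ∫ ‖u(x,·)‖²_{H^s_𝓑} dx`. -/
def innerH {n : ℕ} {s : ℝ} {c ε : ℝ≥0} (u v : HSpace n s c ε) : ℝ :=
  (∫ p, u.toL2 p * v.toL2 p ∂(phase n)) +
    (ε : ℝ) ^ (2 * s) * ∫ x, innerHB n s c (fun θ => u.toL2 (x, θ)) (fun θ => v.toL2 (x, θ))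

lemma integrable_sq_incr {n : ℕ} {s : ℝ} {c ε : ℝ≥0} (u : HSpace n s c ε) :
    Integrable (fun q : Pos n × (Dir n × Dir n) =>
      kernel n s c q.2.1 q.2.2 * (u.toL2 (q.1, q.2.1) - u.toL2 (q.1, q.2.2)) ^ 2)
      ((volume : Measure (Pos n)).prod ((surf n).prod (surf n))) := by
  have hm : Measurable (fun q : Pos n × (Dir n × Dir n) =>
      kernel n s c q.2.1 q.2.2 * (u.toL2 (q.1, q.2.1) - u.toL2 (q.1, q.2.2)) ^ 2) := by
    simpa only [pow_two, mul_assoc] using measurable_incr s c u.toL2 u.toL2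
  refine ⟨hm.aestronglyMeasurable, ?_⟩
  rw [hasFiniteIntegral_iff_ofReal (Filter.Eventually.of_forall
    fun q => mul_nonneg (kernel_nonneg n s c _ _) (sq_nonneg _)),
    lintegral_prod _ (measurable_energy s c u.toL2).aemeasurable]
  have hu : ∫⁻ x : Pos n, energyB n s c (fun θ => u.toL2 (x, θ)) < ⊤ := u.2
  unfold energyB at hu
  rw [lintegral_const_mul _ (measurable_energy s c u.toL2).lintegral_prod_right'] at hu
  by_contra htop
  rw [not_lt_top_iff] at htop
  rw [htop, ENNReal.mul_top (by simp)] at hu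
  exact lt_irrefl _ hu

lemma integrable_incr {n : ℕ} {s : ℝ} {c ε : ℝ≥0} (u v : HSpace n s c ε) :
    Integrable (fun q : Pos n × (Dir n × Dir n) =>
      kernel n s c q.2.1 q.2.2 * (u.toL2 (q.1, q.2.1) - u.toL2 (q.1, q.2.2)) *
        (v.toL2 (q.1, q.2.1) - v.toL2 (q.1, q.2.2)))
      ((volume : Measure (Pos n)).prod ((surf n).prod (surf n))) := by
  refine ((integrable_sq_incr u).add (integrable_sq_incr v)).mono'
    (measurable_incr s c u.toL2 v.toL2).aestronglyMeasurable (Filter.Eventually.of_forall ?_)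
  intro q
  have hK := kernel_nonneg n s c q.2.1 q.2.2
  simp only [Pi.add_apply, Real.norm_eq_abs]
  rw [← mul_add, mul_assoc, abs_mul, abs_of_nonneg hK]
  apply mul_le_mul_of_nonneg_left _ hK
  rw [abs_le]
  constructor <;>
  nlinarith [sq_nonneg ((u.toL2 (q.1, q.2.1) - u.toL2 (q.1, q.2.2)) +
      (v.toL2 (q.1, q.2.1) - v.toL2 (q.1, q.2.2))),
    sq_nonneg ((u.toL2 (q.1, q.2.1) - u.toL2 (q.1, q.2.2)) -
      (v.toL2 (q.1, q.2.1) - v.toL2 (q.1, q.2.2))),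
    sq_nonneg (u.toL2 (q.1, q.2.1) - u.toL2 (q.1, q.2.2)),
    sq_nonneg (v.toL2 (q.1, q.2.1) - v.toL2 (q.1, q.2.2))]

lemma integrable_mul {n : ℕ} (u v : L2 n) : Integrable (fun p => u p * v p) (phase n) :=
  MemLp.integrable_mul (Lp.memLp u) (Lp.memLp v)

lemma integrable_innerHB {n : ℕ} {s : ℝ} {c ε : ℝ≥0} (u v : HSpace n s c ε) :
    Integrable (fun x : Pos n =>
      innerHB n s c (fun θ => u.toL2 (x, θ)) (fun θ => v.toL2 (x, θ))) :=
  ((integrable_incr u v).integral_prod_left.const_mul _).add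
    (integrable_mul u.toL2 v.toL2).integral_prod_left

lemma innerHB_add {n : ℕ} {s : ℝ} {c ε : ℝ≥0} (u v w : HSpace n s c ε) :
    ∀ᵐ x : Pos n,
      innerHB n s c (fun θ => (u + v).toL2 (x, θ)) (fun θ => w.toL2 (x, θ)) =
      innerHB n s c (fun θ => u.toL2 (x, θ)) (fun θ => w.toL2 (x, θ)) +
      innerHB n s c (fun θ => v.toL2 (x, θ)) (fun θ => w.toL2 (x, θ)) := by
  filter_upwards [slice_ae (Lp.coeFn_add u.toL2 v.toL2), (integrable_incr u w).prod_right_ae,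
    (integrable_incr v w).prod_right_ae, (integrable_mul u.toL2 w.toL2).prod_right_ae,
    (integrable_mul v.toL2 w.toL2).prod_right_ae] with x hx h1 h2 h3 h4
  have hsum : (u + v).toL2 = u.toL2 + v.toL2 := rfl
  unfold innerHB formB
  have e1 : ∫ p : Dir n × Dir n, kernel n s c p.1 p.2 *
      ((u + v).toL2 (x, p.1) - (u + v).toL2 (x, p.2)) * (w.toL2 (x, p.1) - w.toL2 (x, p.2))
        ∂((surf n).prod (surf n)) =
      (∫ p : Dir n × Dir n, kernel n s c p.1 p.2 *
      (u.toL2 (x, p.1) - u.toL2 (x, p.2)) * (w.toL2 (x, p.1) - w.toL2 (x, p.2))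
        ∂((surf n).prod (surf n))) +
      ∫ p : Dir n × Dir n, kernel n s c p.1 p.2 *
      (v.toL2 (x, p.1) - v.toL2 (x, p.2)) * (w.toL2 (x, p.1) - w.toL2 (x, p.2))
        ∂((surf n).prod (surf n)) := by
    rw [← integral_add h1 h2]
    apply integral_congr_ae
    filter_upwards [hx.2] with p hp
    rw [hsum, hp.1, hp.2, Pi.add_apply, Pi.add_apply]
    ring
  have e2 : ∫ θ, (u + v).toL2 (x, θ) * w.toL2 (x, θ) ∂(surf n) =
      (∫ θ, u.toL2 (x, θ) * w.toL2 (x, θ) ∂(surf n)) +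
      ∫ θ, v.toL2 (x, θ) * w.toL2 (x, θ) ∂(surf n) := by
    rw [← integral_add h3 h4]
    apply integral_congr_ae
    filter_upwards [hx.1] with θ hp
    rw [hsum, hp, Pi.add_apply]
    ring
  rw [e1, e2]
  ring

lemma innerHB_smul {n : ℕ} {s : ℝ} {c ε : ℝ≥0} (a : ℝ) (u w : HSpace n s c ε) :
    ∀ᵐ x : Pos n,
      innerHB n s c (fun θ => (a • u).toL2 (x, θ)) (fun θ => w.toL2 (x, θ)) =
      a * innerHB n s c (fun θ => u.toL2 (x, θ)) (fun θ => w.toL2 (x, θ)) := by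
  filter_upwards [slice_ae (Lp.coeFn_smul a u.toL2)] with x hx
  have hsmul : (a • u).toL2 = a • u.toL2 := rfl
  unfold innerHB formB
  rw [mul_add, mul_left_comm]
  congr 1
  · congr 1
    rw [← integral_const_mul]
    apply integral_congr_ae
    filter_upwards [hx.2] with p hp
    rw [hsmul, hp.1, hp.2, Pi.smul_apply, Pi.smul_apply, smul_eq_mul, smul_eq_mul]
    ring
  · rw [← integral_const_mul]
    apply integral_congr_ae
    filter_upwards [hx.1] with θ hp
    rw [hsmul, hp, Pi.smul_apply, smul_eq_mul]
    ring

lemma innerHB_self_nonneg (n : ℕ) (s : ℝ) (c : ℝ≥0) (g : Dir n → ℝ) : 0 ≤ innerHB n s c g g := by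
  unfold innerHB formB
  refine add_nonneg (mul_nonneg (by norm_num) (integral_nonneg fun p => ?_))
    (integral_nonneg fun θ => mul_self_nonneg _)
  change 0 ≤ kernel n s c p.1 p.2 * (g p.1 - g p.2) * (g p.1 - g p.2)
  rw [mul_assoc]
  exact mul_nonneg (kernel_nonneg n s c _ _) (mul_self_nonneg _)

lemma innerHB_comm (n : ℕ) (s : ℝ) (c : ℝ≥0) (g h : Dir n → ℝ) :
    innerHB n s c g h = innerHB n s c h g := by
  unfold innerHB formB
  congr 1
  · congr 1
    exact integral_congr_ae (Filter.Eventually.of_forall fun p => by ring)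
  · exact integral_congr_ae (Filter.Eventually.of_forall fun θ => mul_comm _ _)

lemma innerH_comm {n : ℕ} {s : ℝ} {c ε : ℝ≥0} (u v : HSpace n s c ε) :
    innerH u v = innerH v u := by
  unfold innerH
  congr 1
  · exact integral_congr_ae (Filter.Eventually.of_forall fun p => mul_comm _ _)
  · congr 1
    exact integral_congr_ae (Filter.Eventually.of_forall fun x => innerHB_comm n s c _ _)

/-- `innerH` is an inner product on `𝓗^s_ε`. -/
@[reducible]
def coreH (n : ℕ) (s : ℝ) (c ε : ℝ≥0) : InnerProductSpace.Core ℝ (HSpace n s c ε) where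
  inner := innerH
  conj_inner_symm u v := by
    exact innerH_comm v u
  re_inner_nonneg u := by
    change 0 ≤ innerH u u
    exact add_nonneg (integral_nonneg fun p => mul_self_nonneg _)
      (mul_nonneg (Real.rpow_nonneg ε.2 _) (integral_nonneg fun x => innerHB_self_nonneg n s c _))
  add_left u v w := by
    change innerH (u + v) w = innerH u w + innerH v w
    unfold innerH
    rw [integral_congr_ae (innerHB_add u v w),
      integral_add (integrable_innerHB u w) (integrable_innerHB v w)]
    have e : ∫ p, (u + v).toL2 p * w.toL2 p ∂(phase n) =
        (∫ p, u.toL2 p * w.toL2 p ∂(phase n)) + ∫ p, v.toL2 p * w.toL2 p ∂(phase n) := by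
      rw [← integral_add (integrable_mul _ _) (integrable_mul _ _)]
      apply integral_congr_ae
      filter_upwards [Lp.coeFn_add u.toL2 v.toL2] with p hp
      have hsum : (u + v).toL2 = u.toL2 + v.toL2 := rfl
      rw [hsum, hp, Pi.add_apply]
      ring
    rw [e]
    ring
  smul_left u w a := by
    change innerH (a • u) w = a * innerH u w
    unfold innerH
    rw [integral_congr_ae (innerHB_smul a u w), integral_const_mul]
    have e : ∫ p, (a • u).toL2 p * w.toL2 p ∂(phase n) =
        a * ∫ p, u.toL2 p * w.toL2 p ∂(phase n) := by
      rw [← integral_const_mul]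
      apply integral_congr_ae
      filter_upwards [Lp.coeFn_smul a u.toL2] with p hp
      have hsmul : (a • u).toL2 = a • u.toL2 := rfl
      rw [hsmul, hp, Pi.smul_apply, smul_eq_mul]
      ring
    rw [e]
    ring
  definite u hu := by
    change innerH u u = 0 at hu
    have h1 : 0 ≤ ∫ p, u.toL2 p * u.toL2 p ∂(phase n) :=
      integral_nonneg fun p => mul_self_nonneg _
    have h2 : 0 ≤ (ε : ℝ) ^ (2 * s) *
        ∫ x, innerHB n s c (fun θ => u.toL2 (x, θ)) (fun θ => u.toL2 (x, θ)) :=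
      mul_nonneg (Real.rpow_nonneg ε.2 _) (integral_nonneg fun x => innerHB_self_nonneg n s c _)
    unfold innerH at hu
    have h3 : ∫ p, u.toL2 p * u.toL2 p ∂(phase n) = 0 := by linarith
    rw [integral_eq_zero_iff_of_nonneg (fun p => mul_self_nonneg _) (integrable_mul _ _)] at h3
    have h4 : u.toL2 = 0 := by
      apply Lp.ext
      filter_upwards [h3, Lp.coeFn_zero ℝ 2 (phase n)] with p hp h0
      rw [h0]
      exact mul_self_eq_zero.1 hp
    exact Subtype.ext h4

instance (n : ℕ) (s : ℝ) (c ε : ℝ≥0) : NormedAddCommGroup (HSpace n s c ε) :=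
  (coreH n s c ε).toNormedAddCommGroup

instance (n : ℕ) (s : ℝ) (c ε : ℝ≥0) : InnerProductSpace ℝ (HSpace n s c ε) :=
  InnerProductSpace.ofCore (coreH n s c ε).toCore

lemma HSpace.inner_eq {n : ℕ} {s : ℝ} {c ε : ℝ≥0} (u v : HSpace n s c ε) :
    inner ℝ u v = innerH u v := rfl

/-- The norm of `𝓗^s_ε`. -/
lemma HSpace.norm_sq_eq {n : ℕ} {s : ℝ} {c ε : ℝ≥0} (u : HSpace n s c ε) :
    ‖u‖ ^ 2 = ‖u.toL2‖ ^ 2 + (ε : ℝ) ^ (2 * s) *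
      ∫ x, innerHB n s c (fun θ => u.toL2 (x, θ)) (fun θ => u.toL2 (x, θ)) := by
  rw [← real_inner_self_eq_norm_sq, HSpace.inner_eq, ← real_inner_self_eq_norm_sq, L2.inner_def]
  simp only [innerH, RCLike.inner_apply, conj_trivial]

/-! ### The fractional Fokker--Planck equation -/

/-- The test functions `C_c^∞(ℝ^d × 𝕊^{d-1})`. -/
structure IsTest {n : ℕ} (φ : Pos n × Dir n → ℝ) : Prop where
  smooth : ContMDiff (𝓘(ℝ, Pos n).prod (𝓡 n)) 𝓘(ℝ, ℝ) ∞ φ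
  compact : HasCompactSupport φ

/-- The classical transport derivative `(θ · ∇_x φ)(x, θ)`. -/
def transport {n : ℕ} (φ : Pos n × Dir n → ℝ) (p : Pos n × Dir n) : ℝ :=
  fderiv ℝ (fun y : Pos n => φ (y, p.2)) p.1 (p.2 : Pos n)

/-- `ℓ ∈ (𝓗^s_ε)'` is the distribution `T u = θ · ∇_x u`: every test function `φ` lies in
`𝓗^s_ε`, and `⟨ℓ, φ⟩ = -∬ u (θ · ∇_x φ) dx dθ`. -/
def IsWeakTransport {n : ℕ} {s : ℝ} {c ε : ℝ≥0} (u : HSpace n s c ε)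
    (ℓ : StrongDual ℝ (HSpace n s c ε)) : Prop :=
  ∀ φ : Pos n × Dir n → ℝ, IsTest φ → ∃ h : HSpace n s c ε, h.toL2 =ᵐ[phase n] φ ∧
    ℓ h = -∫ p, u.toL2 p * transport φ p ∂(phase n)

/-- The space `𝓨^s_ε = {u ∈ 𝓗^s_ε : T u ∈ (𝓗^s_ε)'}`; an element is recorded together with
its transport derivative `T u`. -/
structure YSpace (n : ℕ) (s : ℝ) (c ε : ℝ≥0) where
  toH : HSpace n s c ε
  T : StrongDual ℝ (HSpace n s c ε)
  isWeakTransport : IsWeakTransport toH T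

/-- `‖u‖_{𝓨^s_ε} = ‖u‖_{𝓗^s_ε} + ‖T u‖_{(𝓗^s_ε)'}`. -/
instance (n : ℕ) (s : ℝ) (c ε : ℝ≥0) : Norm (YSpace n s c ε) where
  norm u := ‖u.toH‖ + ‖u.T‖

/-- `u ∈ 𝓨^s_ε` is a weak solution of
`θ · ∇_x u + λ(x) u = ε^{2s} σ(x) ∫ K(θ', θ) (u(x, θ') - u(x, θ)) dθ' + f`. -/
def IsWeakSolution {n : ℕ} {s : ℝ} {c ε : ℝ≥0} (σ lam : Pos n → ℝ) (f : L2 n)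
    (u : YSpace n s c ε) : Prop :=
  ∀ φ : Pos n × Dir n → ℝ, IsTest φ →
    (∫ p, (-(u.toH.toL2 p * transport φ p) + lam p.1 * u.toH.toL2 p * φ p) ∂(phase n)) +
      (ε : ℝ) ^ (2 * s) *
        ∫ x, σ x * formB n s c (fun θ => u.toH.toL2 (x, θ)) (fun θ => φ (x, θ)) =
      ∫ p, f p * φ p ∂(phase n)

/-- The assumption on a coefficient: it is Lipschitz continuous and, for some constant `a₀ > 0`,
`a₀ ≤ a(x) ≤ a₀⁻¹` for all `x`. -/
def IsAdmissibleCoeff {n : ℕ} (a : Pos n → ℝ) : Prop :=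
  (∃ L : ℝ≥0, LipschitzWith L a) ∧ ∃ a₀ : ℝ, 0 < a₀ ∧ ∀ x, a₀ ≤ a x ∧ a x ≤ a₀⁻¹

end FokkerPlanck

end

noncomputable section

namespace FokkerPlanck

section

open Filter Topology

/-! ### The increment operator and the Hilbert space structure -/

/-! Let `A` be the bounded self-adjoint operator on the Hilbert space `𝓗 = 𝓗^s_ε` that represents `∬
λ u v + ε^{2s} ∫ σ 𝓑(u, v)` (`collisionOp`). The bounds on `σ` and `λ` make it coercive. Once test
functions are known to be dense in `𝓗`, the weak equation is the identity `Tu + ⟨Au, ·⟩ = ⟨f,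
·⟩_{L²}` in `𝓗'` (`isWeakSolution_iff`).

Existence is Lions' theorem (`exists_inner_eq_of_coercive`): transport is skew on test functions, so
`φ ↦ Aφ - Tφ` keeps the coercivity of `A`. Uniqueness and the bound both come from testing the
equation with `u` itself, which requires `⟨Tu, u⟩ = 0` for every `u ∈ 𝓨^s_ε`
(`IsWeakTransport.apply_self`). The energy estimate controls `‖u‖`, and then `Tu = f - Au` controls
`‖Tu‖`. No constant in this estimate degenerates as `ε → 0`.

Density (`HSpace.eq_zero_of_inner_test`, `HSpace.dual_ext`): let `w` be orthogonal to all test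
functions. Testing with `χ(x) (θ·η)^k` shows that almost every slice `g` of `w` annihilates all
powers of `θ·η` in the form `(1 + ε^{2s})⟨·,·⟩ + ε^{2s} 𝓑`. A zonal integral operator maps
polynomials in `θ·η` of degree at most `k` to such polynomials (a Funk–Hecke statement,
`exists_zonal_eq_eval`). Hence `𝓑` decouples these polynomials from their `L²` complement, and the
form restricts to a definite form on them. So all moments of `g` vanish, and `g = 0` by injectivity
of the characteristic function.

The identity `⟨Tu, u⟩ = 0`: for an even bump `ρ`, average `⟨Tu, τ_y u⟩` against `ρ(y)`, with `τ_y`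
the translation in `x`. On test functions the derivative can be moved onto `ρ`; by density this
remains true on all of `𝓗`, in particular at `u` (`average_eq`). There the integrand is the odd
function `∂_i ρ` times the even function `y ↦ ⟨θ_i u, τ_y u⟩`, so the average is zero. Letting `ρ`
concentrate at the origin gives the claim. -/

/-- The measure `dx dθ' dθ` on `ℝ^d × (𝕊^{d-1} × 𝕊^{d-1})`. -/
abbrev pairs (n : ℕ) : Measure (Pos n × (Dir n × Dir n)) :=
  (volume : Measure (Pos n)).prod ((surf n).prod (surf n))

lemma quasiMeasurePreserving_left (n : ℕ) :
    Measure.QuasiMeasurePreserving (fun q : Pos n × (Dir n × Dir n) => (q.1, q.2.1))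
      (pairs n) (phase n) :=
  QuasiMeasurePreserving.prodMap (.id _) Measure.quasiMeasurePreserving_fst

lemma quasiMeasurePreserving_right (n : ℕ) :
    Measure.QuasiMeasurePreserving (fun q : Pos n × (Dir n × Dir n) => (q.1, q.2.2))
      (pairs n) (phase n) :=
  QuasiMeasurePreserving.prodMap (.id _) Measure.quasiMeasurePreserving_snd

lemma pairs_ae {n : ℕ} {P : Pos n × Dir n → Prop} (h : ∀ᵐ p ∂(phase n), P p) :
    ∀ᵐ q ∂(pairs n), P (q.1, q.2.1) ∧ P (q.1, q.2.2) :=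
  ((quasiMeasurePreserving_left n).ae h).and ((quasiMeasurePreserving_right n).ae h)

/-- The weighted increment `√K(θ', θ) (u(x, θ') - u(x, θ))`. -/
def wincr {n : ℕ} (s : ℝ) (c : ℝ≥0) (u : Pos n × Dir n → ℝ) (q : Pos n × (Dir n × Dir n)) : ℝ :=
  √(kernel n s c q.2.1 q.2.2) * (u (q.1, q.2.1) - u (q.1, q.2.2))

lemma wincr_mul {n : ℕ} (s : ℝ) (c : ℝ≥0) (u v : Pos n × Dir n → ℝ)
    (q : Pos n × (Dir n × Dir n)) :
    wincr s c u q * wincr s c v q = kernel n s c q.2.1 q.2.2 * (u (q.1, q.2.1) - u (q.1, q.2.2)) *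
      (v (q.1, q.2.1) - v (q.1, q.2.2)) := by
  unfold wincr
  have h := Real.mul_self_sqrt (kernel_nonneg n s c q.2.1 q.2.2)
  linear_combination (u (q.1, q.2.1) - u (q.1, q.2.2)) * (v (q.1, q.2.1) - v (q.1, q.2.2)) * h

lemma wincr_sq {n : ℕ} (s : ℝ) (c : ℝ≥0) (u : Pos n × Dir n → ℝ) (q : Pos n × (Dir n × Dir n)) :
    wincr s c u q ^ 2 = kernel n s c q.2.1 q.2.2 * (u (q.1, q.2.1) - u (q.1, q.2.2)) ^ 2 := by
  rw [pow_two, wincr_mul]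
  ring

lemma wincr_congr {n : ℕ} (s : ℝ) (c : ℝ≥0) {u v : Pos n × Dir n → ℝ} (h : u =ᵐ[phase n] v) :
    wincr s c u =ᵐ[pairs n] wincr s c v := by
  filter_upwards [pairs_ae h] with q hq
  simp only [wincr, hq.1, hq.2]

lemma measurable_wincr {n : ℕ} (s : ℝ) (c : ℝ≥0) {u : Pos n × Dir n → ℝ} (hu : Measurable u) :
    Measurable (wincr s c u) := by
  have hk : Measurable (fun q : Pos n × (Dir n × Dir n) => kernel n s c q.2.1 q.2.2) :=
    (measurable_kernel n s c).comp measurable_snd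
  unfold wincr
  fun_prop

/-- By Tonelli the energy is half the squared `L²` norm of the weighted increment. So `𝓗^s_ε` is the
domain of an operator between two `L²` spaces, and Hilbert space arguments apply to it. -/
lemma mem_energySpace_iff {n : ℕ} {s : ℝ} {c : ℝ≥0} {u : L2 n} :
    u ∈ energySpace n s c ↔ MemLp (wincr s c u) 2 (pairs n) := by
  have hm : Measurable (wincr s c u) := measurable_wincr s c (Lp.stronglyMeasurable u).measurable
  rw [memLp_two_iff_integrable_sq hm.aestronglyMeasurable]
  have e : Integrable (fun q => wincr s c u q ^ 2) (pairs n) ↔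
      ∫⁻ q, ENNReal.ofReal (wincr s c u q ^ 2) ∂(pairs n) < ⊤ := by
    rw [← hasFiniteIntegral_iff_ofReal (Eventually.of_forall fun q => sq_nonneg _)]
    exact ⟨fun h => h.2, fun h => ⟨(hm.pow_const 2).aestronglyMeasurable, h⟩⟩
  rw [e]
  simp only [wincr_sq]
  change ∫⁻ x : Pos n, energyB n s c (fun θ => u (x, θ)) < ⊤ ↔ _
  unfold energyB
  rw [lintegral_const_mul _ (measurable_energy s c u).lintegral_prod_right',
    lintegral_prod _ (measurable_energy s c u).aemeasurable]
  constructor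
  · intro h
    by_contra htop
    rw [not_lt_top_iff] at htop
    rw [htop, ENNReal.mul_top (by simp)] at h
    exact lt_irrefl _ h
  · exact fun h => ENNReal.mul_lt_top (by simp) h

namespace HSpace

variable {n : ℕ} {s : ℝ} {c ε : ℝ≥0}

lemma memLp_wincr (u : HSpace n s c ε) : MemLp (wincr s c u.toL2) 2 (pairs n) :=
  mem_energySpace_iff.1 u.2

lemma toL2_injective : Function.Injective (toL2 : HSpace n s c ε → L2 n) :=
  Subtype.val_injective

lemma ext_ae {u v : HSpace n s c ε} (h : u.toL2 =ᵐ[phase n] v.toL2) : u = v :=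
  toL2_injective (Lp.ext h)

/-- An `L²` function with square integrable weighted increments, as an element of `𝓗^s_ε`. -/
def ofMemLp (φ : Pos n × Dir n → ℝ) (h : MemLp φ 2 (phase n))
    (h' : MemLp (wincr s c φ) 2 (pairs n)) : HSpace n s c ε :=
  (⟨h.toLp φ, mem_energySpace_iff.2 ((memLp_congr_ae (wincr_congr s c h.coeFn_toLp)).2 h')⟩ :
    energySpace n s c)

/-- The linear map `u ↦ √K(θ', θ) (u(x, θ') - u(x, θ))`. -/
def gradₗ (n : ℕ) (s : ℝ) (c ε : ℝ≥0) : HSpace n s c ε →ₗ[ℝ] Lp ℝ 2 (pairs n) where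
  toFun u := u.memLp_wincr.toLp _
  map_add' u v := by
    apply Lp.ext
    filter_upwards [(u + v).memLp_wincr.coeFn_toLp, u.memLp_wincr.coeFn_toLp,
      v.memLp_wincr.coeFn_toLp, Lp.coeFn_add (u.memLp_wincr.toLp _) (v.memLp_wincr.toLp _),
      pairs_ae (Lp.coeFn_add u.toL2 v.toL2)] with q h1 h2 h3 h4 h5
    rw [h1, h4, Pi.add_apply, h2, h3]
    have hsum : (u + v).toL2 = u.toL2 + v.toL2 := rfl
    simp only [wincr, hsum, h5.1, h5.2, Pi.add_apply]
    ring
  map_smul' a u := by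
    apply Lp.ext
    filter_upwards [(a • u).memLp_wincr.coeFn_toLp, u.memLp_wincr.coeFn_toLp,
      Lp.coeFn_smul a (u.memLp_wincr.toLp _), pairs_ae (Lp.coeFn_smul a u.toL2)] with q h1 h2 h4 h5
    rw [h1, RingHom.id_apply, h4, Pi.smul_apply, h2]
    have hsum : (a • u).toL2 = a • u.toL2 := rfl
    simp only [wincr, hsum, h5.1, h5.2, Pi.smul_apply, smul_eq_mul]
    ring

lemma coeFn_gradₗ (u : HSpace n s c ε) :
    gradₗ n s c ε u =ᵐ[pairs n] wincr s c u.toL2 := u.memLp_wincr.coeFn_toLp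

lemma integral_innerHB (u v : HSpace n s c ε) :
    ∫ x, innerHB n s c (fun θ => u.toL2 (x, θ)) (fun θ => v.toL2 (x, θ)) =
      1 / 2 * inner ℝ (gradₗ n s c ε u) (gradₗ n s c ε v) + inner ℝ u.toL2 v.toL2 := by
  have h1 := integrable_incr u v
  have h2 := integrable_mul u.toL2 v.toL2
  unfold innerHB formB
  rw [integral_add (h1.integral_prod_left.const_mul _) h2.integral_prod_left, integral_const_mul,
    ← integral_prod _ h1, ← integral_prod _ h2, L2.inner_def, L2.inner_def]
  congr 1
  · congr 1
    apply integral_congr_ae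
    filter_upwards [coeFn_gradₗ u, coeFn_gradₗ v] with q hu hv
    simp only [RCLike.inner_apply, conj_trivial]
    rw [hu, hv, mul_comm (wincr s c v.toL2 q), wincr_mul]
  · simp only [RCLike.inner_apply, conj_trivial, mul_comm]

/-- The `L²` product occurs twice, alone and inside the `H^s_𝓑` product, whence the weight `1 +
ε^{2s}`; the `1/2` is the one in `𝓑`. -/
lemma inner_eq' (u v : HSpace n s c ε) :
    inner ℝ u v = (1 + (ε : ℝ) ^ (2 * s)) * inner ℝ u.toL2 v.toL2 +
      (ε : ℝ) ^ (2 * s) / 2 * inner ℝ (gradₗ n s c ε u) (gradₗ n s c ε v) := by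
  have e : ∫ p, u.toL2 p * v.toL2 p ∂(phase n) = inner ℝ u.toL2 v.toL2 := by
    rw [L2.inner_def]
    simp only [RCLike.inner_apply, conj_trivial, mul_comm]
  rw [HSpace.inner_eq, innerH, integral_innerHB, e]
  ring

lemma norm_sq_eq' (u : HSpace n s c ε) :
    ‖u‖ ^ 2 = (1 + (ε : ℝ) ^ (2 * s)) * ‖u.toL2‖ ^ 2 +
      (ε : ℝ) ^ (2 * s) / 2 * ‖gradₗ n s c ε u‖ ^ 2 := by
  rw [← real_inner_self_eq_norm_sq, inner_eq', real_inner_self_eq_norm_sq,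
    real_inner_self_eq_norm_sq]

lemma weight_nonneg (ε : ℝ≥0) (s : ℝ) : 0 ≤ (ε : ℝ) ^ (2 * s) := Real.rpow_nonneg ε.2 _

lemma norm_toL2_le (u : HSpace n s c ε) : ‖u.toL2‖ ≤ ‖u‖ := by
  refine (sq_le_sq₀ (norm_nonneg _) (norm_nonneg _)).1 ?_
  rw [norm_sq_eq']
  have h := weight_nonneg ε s
  have := mul_nonneg h (sq_nonneg ‖u.toL2‖)
  have := mul_nonneg h (sq_nonneg ‖gradₗ n s c ε u‖)
  linarith

/-- The continuous inclusion `𝓗^s_ε ⊆ L²_{x,θ}`. -/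
def incl (n : ℕ) (s : ℝ) (c ε : ℝ≥0) : HSpace n s c ε →L[ℝ] L2 n :=
  LinearMap.mkContinuous
    { toFun := toL2, map_add' := fun _ _ => rfl, map_smul' := fun _ _ => rfl } 1
    fun u => by rw [one_mul]; exact norm_toL2_le u

@[simp] lemma incl_apply (u : HSpace n s c ε) : incl n s c ε u = u.toL2 := rfl

variable [hε : Fact (0 < ε)]

lemma weight_pos : 0 < (ε : ℝ) ^ (2 * s) := Real.rpow_pos_of_pos (NNReal.coe_pos.2 hε.out) _

/-- This constant blows up as `ε → 0`. It serves only to make `grad` continuous; the uniform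
estimates use `half_weight_mul_norm_grad_le`. -/
lemma norm_grad_le (u : HSpace n s c ε) :
    ‖gradₗ n s c ε u‖ ≤ √(2 / (ε : ℝ) ^ (2 * s)) * ‖u‖ := by
  have h : 0 < (ε : ℝ) ^ (2 * s) := weight_pos
  refine (sq_le_sq₀ (norm_nonneg _) (by positivity)).1 ?_
  rw [mul_pow, Real.sq_sqrt (by positivity), norm_sq_eq', mul_add]
  have e : 2 / (ε : ℝ) ^ (2 * s) * ((ε : ℝ) ^ (2 * s) / 2 * ‖gradₗ n s c ε u‖ ^ 2) =
    ‖gradₗ n s c ε u‖ ^ 2 := by field_simp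
  rw [e]
  have : 0 ≤ 2 / (ε : ℝ) ^ (2 * s) * ((1 + (ε : ℝ) ^ (2 * s)) * ‖u.toL2‖ ^ 2) := by positivity
  linarith

/-- The weighted increment as a continuous linear map. -/
def grad (n : ℕ) (s : ℝ) (c ε : ℝ≥0) [Fact (0 < ε)] :
    HSpace n s c ε →L[ℝ] Lp ℝ 2 (pairs n) :=
  (gradₗ n s c ε).mkContinuous _ norm_grad_le

lemma coeFn_grad (u : HSpace n s c ε) :
    grad n s c ε u =ᵐ[pairs n] wincr s c u.toL2 := coeFn_gradₗ u

lemma norm_sq_eq_grad (u : HSpace n s c ε) :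
    ‖u‖ ^ 2 = (1 + (ε : ℝ) ^ (2 * s)) * ‖u.toL2‖ ^ 2 +
      (ε : ℝ) ^ (2 * s) / 2 * ‖grad n s c ε u‖ ^ 2 := norm_sq_eq' u

lemma tendsto_of_tendsto_incl_grad {ι : Type*} {l : Filter ι} {u : ι → HSpace n s c ε}
    {v : HSpace n s c ε} (h1 : Tendsto (fun i => (u i).toL2) l (𝓝 v.toL2))
    (h2 : Tendsto (fun i => grad n s c ε (u i)) l (𝓝 (grad n s c ε v))) :
    Tendsto u l (𝓝 v) := by
  rw [tendsto_iff_norm_sub_tendsto_zero] at h1 h2 ⊢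
  have h : Tendsto (fun i => ‖u i - v‖ ^ 2) l (𝓝 0) := by
    have := ((h1.pow 2).const_mul (1 + (ε : ℝ) ^ (2 * s))).add
      ((h2.pow 2).const_mul ((ε : ℝ) ^ (2 * s) / 2))
    simp only [ne_eq, OfNat.ofNat_ne_zero, not_false_eq_true, zero_pow, mul_zero, add_zero] at this
    refine this.congr fun i => ?_
    rw [norm_sq_eq_grad (u i - v), map_sub]
    rfl
  have h' := h.sqrt
  simpa [Real.sqrt_sq (norm_nonneg _)] using h'

/-- The increment operator is closed: along a subsequence of a subsequence both `u k` and its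
increments converge almost everywhere, and the increment is a pointwise expression in `u`. -/
lemma wincr_ae_of_tendsto {u : ℕ → HSpace n s c ε} {a : L2 n} {b : Lp ℝ 2 (pairs n)}
    (ha : Tendsto (fun k => (u k).toL2) atTop (𝓝 a))
    (hb : Tendsto (fun k => grad n s c ε (u k)) atTop (𝓝 b)) :
    b =ᵐ[pairs n] wincr s c a := by
  obtain ⟨k, hk, hka⟩ := (tendstoInMeasure_of_tendsto_Lp ha).exists_seq_tendsto_ae
  have hb' := hb.comp hk.tendsto_atTop
  obtain ⟨j, hj, hjb⟩ := (tendstoInMeasure_of_tendsto_Lp hb').exists_seq_tendsto_ae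
  filter_upwards [hjb, pairs_ae hka, ae_all_iff.2 fun i => coeFn_grad (u (k (j i)))]
    with q h1 h2 h3
  refine tendsto_nhds_unique h1 ?_
  have h4 : Tendsto (fun i => wincr s c (u (k (j i))).toL2 q) atTop (𝓝 (wincr s c a q)) :=
    ((h2.1.comp hj.tendsto_atTop).sub (h2.2.comp hj.tendsto_atTop)).const_mul _
  exact h4.congr fun i => (h3 i).symm

/-- The norm is equivalent to the graph norm of a closed operator. -/
instance : CompleteSpace (HSpace n s c ε) := by
  refine UniformSpace.complete_of_cauchySeq_tendsto fun u hu => ?_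
  obtain ⟨a, ha⟩ := cauchySeq_tendsto_of_complete
    ((incl n s c ε).uniformContinuous.comp_cauchySeq hu)
  obtain ⟨b, hb⟩ := cauchySeq_tendsto_of_complete
    ((grad n s c ε).uniformContinuous.comp_cauchySeq hu)
  have hab := wincr_ae_of_tendsto ha hb
  let v : HSpace n s c ε :=
    (⟨a, mem_energySpace_iff.2 ((memLp_congr_ae hab).1 (Lp.memLp b))⟩ : energySpace n s c)
  have hv : grad n s c ε v = b := Lp.ext ((coeFn_grad v).trans hab.symm)
  exact ⟨v, tendsto_of_tendsto_incl_grad ha (by rw [hv]; exact hb)⟩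

end HSpace

/-! ### Multiplication by bounded functions -/

/-- Multiplication by an essentially bounded function on `L²`. -/
def bddMul {α : Type*} [MeasurableSpace α] {μ : Measure α} {m : α → ℝ} (hm : MemLp m ∞ μ) :
    Lp ℝ 2 μ →L[ℝ] Lp ℝ 2 μ :=
  (ContinuousLinearMap.mul ℝ ℝ).holderL μ ∞ 2 2 (hm.toLp m)

lemma coeFn_bddMul {α : Type*} [MeasurableSpace α] {μ : Measure α} {m : α → ℝ}
    (hm : MemLp m ∞ μ) (u : Lp ℝ 2 μ) : bddMul hm u =ᵐ[μ] fun x => m x * u x := by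
  have h := (ContinuousLinearMap.mul ℝ ℝ).coeFn_holder (r := 2) (hm.toLp m) u
  filter_upwards [h, hm.coeFn_toLp] with x hx hx'
  rw [← hx']
  exact hx

lemma inner_bddMul {α : Type*} [MeasurableSpace α] {μ : Measure α} {m : α → ℝ}
    (hm : MemLp m ∞ μ) (u v : Lp ℝ 2 μ) :
    inner ℝ (bddMul hm u) v = ∫ x, m x * u x * v x ∂μ := by
  rw [L2.inner_def]
  apply integral_congr_ae
  filter_upwards [coeFn_bddMul hm u] with x hx
  simp only [RCLike.inner_apply, conj_trivial, hx]
  ring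

lemma inner_bddMul_comm {α : Type*} [MeasurableSpace α] {μ : Measure α} {m : α → ℝ}
    (hm : MemLp m ∞ μ) (u v : Lp ℝ 2 μ) :
    inner ℝ (bddMul hm u) v = inner ℝ u (bddMul hm v) := by
  rw [inner_bddMul, real_inner_comm, inner_bddMul]
  exact integral_congr_ae (Eventually.of_forall fun x => by ring)

lemma norm_bddMul_le {α : Type*} [MeasurableSpace α] {μ : Measure α} {m : α → ℝ}
    (hm : MemLp m ∞ μ) {C : ℝ} (hC : ∀ x, |m x| ≤ C) (u : Lp ℝ 2 μ) :
    ‖bddMul hm u‖ ≤ C * ‖u‖ := by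
  apply Lp.norm_le_mul_norm_of_ae_le_mul
  filter_upwards [coeFn_bddMul hm u] with x hx
  rw [hx, norm_mul]
  exact mul_le_mul_of_nonneg_right (hC x) (norm_nonneg _)

lemma le_inner_bddMul {α : Type*} [MeasurableSpace α] {μ : Measure α} {m : α → ℝ}
    (hm : MemLp m ∞ μ) {a : ℝ} (ha : ∀ x, a ≤ m x) (u : Lp ℝ 2 μ) :
    a * ‖u‖ ^ 2 ≤ inner ℝ (bddMul hm u) u := by
  rw [← real_inner_self_eq_norm_sq, L2.inner_def, L2.inner_def, ← integral_const_mul]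
  have h1 := L2.integrable_inner (𝕜 := ℝ) u u
  have h2 := L2.integrable_inner (𝕜 := ℝ) (bddMul hm u) u
  refine integral_mono_ae (h1.const_mul a) h2 ?_
  filter_upwards [coeFn_bddMul hm u] with x hx
  simp only [RCLike.inner_apply, conj_trivial, hx]
  nlinarith [mul_self_nonneg (u x), ha x]

/-! ### An abstract existence theorem -/

/-- Lions' theorem: a form which is continuous in its first argument and coercive on a space of
test vectors represents every functional. -/
theorem exists_inner_eq_of_coercive {V H : Type*} [AddCommGroup V] [Module ℝ V]
    [NormedAddCommGroup H] [InnerProductSpace ℝ H] [CompleteSpace H] (j A : V →ₗ[ℝ] H)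
    (ℓ : StrongDual ℝ H) {α : ℝ} (hα : 0 < α) (h : ∀ φ, α * ‖j φ‖ ^ 2 ≤ inner ℝ (A φ) (j φ)) :
    ∃ u : H, ∀ φ, inner ℝ u (A φ) = ℓ (j φ) := by
  -- Coercivity and Cauchy–Schwarz. This makes `A φ ↦ ℓ (j φ)` both well defined and bounded on the
  -- range of `A`; Hahn–Banach and Riesz then give `u`.
  have hj : ∀ φ, ‖j φ‖ ≤ α⁻¹ * ‖A φ‖ := fun φ => by
    rcases (norm_nonneg (j φ)).eq_or_lt with h0 | h0
    · rw [← h0]; positivity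
    · have h1 := (h φ).trans (real_inner_le_norm _ _)
      rw [inv_mul_eq_div, le_div_iff₀ hα]
      nlinarith
  -- `g` is an arbitrary linear choice of preimages. By `hj` the choice is invisible after applying
  -- `j`.
  obtain ⟨g, hg⟩ := A.rangeRestrict.exists_rightInverse_of_surjective A.range_rangeRestrict
  have hA : ∀ y : LinearMap.range A, A (g y) = y := fun y =>
    congrArg Subtype.val (LinearMap.congr_fun hg y)
  have hjg : ∀ φ, j (g (A.rangeRestrict φ)) = j φ := fun φ => by
    have h1 := hj (g (A.rangeRestrict φ) - φ)
    rw [map_sub, map_sub, hA] at h1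
    simp only [LinearMap.codRestrict_apply, LinearMap.rangeRestrict, sub_self, norm_zero,
      mul_zero] at h1
    exact sub_eq_zero.1 (norm_le_zero_iff.1 h1)
  let L : StrongDual ℝ (LinearMap.range A) :=
    ((ℓ : H →ₗ[ℝ] ℝ).comp (j.comp g)).mkContinuous (‖ℓ‖ * α⁻¹) fun y => by
      refine (ℓ.le_opNorm _).trans ?_
      rw [mul_assoc]
      refine mul_le_mul_of_nonneg_left ((hj (g y)).trans ?_) (norm_nonneg _)
      rw [hA]
      rfl
  obtain ⟨L', hL', -⟩ := exists_extension_norm_eq _ L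
  refine ⟨(InnerProductSpace.toDual ℝ H).symm L', fun φ => ?_⟩
  rw [InnerProductSpace.toDual_symm_apply]
  refine (hL' (A.rangeRestrict φ)).trans ?_
  exact congrArg ℓ (hjg φ)

end

section

open Filter Topology Set
open scoped Pointwise

/-! ### The surface measure of the sphere -/

/-- The action of a linear isometry on the unit sphere. -/
def sphereMap {n : ℕ} (R : Pos n ≃ₗᵢ[ℝ] Pos n) (θ : Dir n) : Dir n :=
  ⟨R θ, by simp⟩

@[simp] lemma coe_sphereMap {n : ℕ} (R : Pos n ≃ₗᵢ[ℝ] Pos n) (θ : Dir n) :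
    (sphereMap R θ : Pos n) = R θ := rfl

lemma continuous_sphereMap {n : ℕ} (R : Pos n ≃ₗᵢ[ℝ] Pos n) : Continuous (sphereMap R) :=
  (R.continuous.comp continuous_subtype_val).subtype_mk _

/-- The surface measure of a set is, up to the factor `d`, the volume of the cone over it. Linear
isometries preserve volume and commute with forming cones. -/
lemma measurePreserving_sphereMap {n : ℕ} (R : Pos n ≃ₗᵢ[ℝ] Pos n) :
    MeasurePreserving (sphereMap R) (surf n) (surf n) := by
  have hm := (continuous_sphereMap R).measurable
  refine ⟨hm, Measure.ext fun A hA => ?_⟩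
  rw [Measure.map_apply hm hA, Measure.toSphere_apply' _ (hm hA), Measure.toSphere_apply' _ hA]
  congr 1
  have e : Ioo (0 : ℝ) 1 • ((↑) '' (sphereMap R ⁻¹' A) : Set (Pos n)) =
      R ⁻¹' (Ioo (0 : ℝ) 1 • ((↑) '' A : Set (Pos n))) := by
    ext x
    simp only [Set.mem_smul, mem_image, mem_preimage]
    constructor
    · rintro ⟨r, hr, _, ⟨θ, hθ, rfl⟩, rfl⟩
      exact ⟨r, hr, _, ⟨_, hθ, rfl⟩, by simp⟩
    · rintro ⟨r, hr, _, ⟨θ, hθ, rfl⟩, hx⟩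
      refine ⟨r, hr, _, ⟨sphereMap R.symm θ, ?_, rfl⟩, ?_⟩
      · convert! hθ
        ext1
        simp
      · apply R.injective
        rw [← hx]
        simp
  rw [e]
  exact R.measurePreserving.measure_preimage_emb R.toHomeomorph.measurableEmbedding _

/-- No polar coordinates on the sphere are needed. For `δ < 1` the cone `S` over the cap is covered
by `(1 - δ) S` and the ball of radius `2δ` about `θ`. Comparing volumes gives `(1 - (1 - δ)^d) |S| ≤
(2δ)^d V`, and `1 - (1 - δ)^d ≥ δ` leaves the power `δ^{d-1} = δ^n`. -/
lemma exists_surf_closedBall_le (n : ℕ) : ∃ C : ℝ, 0 ≤ C ∧ ∀ (θ : Dir n) (δ : ℝ), 0 < δ →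
    surf n (Metric.closedBall θ δ) ≤ ENNReal.ofReal (C * δ ^ n) := by
  set d := n + 1 with hd
  set V := (volume : Measure (Pos n)).real (Metric.ball 0 1) with hV
  have hV0 : 0 ≤ V := measureReal_nonneg
  refine ⟨d * 2 ^ d * V, by positivity, fun θ δ hδ => ?_⟩
  have hfin : ∀ A : Set (Dir n), surf n A ≠ ⊤ := fun A => measure_ne_top _ _
  rw [← ENNReal.ofReal_toReal (hfin _)]
  apply ENNReal.ofReal_le_ofReal
  change (surf n).real _ ≤ _
  rcases le_or_gt 1 δ with h1 | h1
  · have h2 : (surf n).real (Metric.closedBall θ δ) ≤ d * V := by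
      refine (measureReal_mono (subset_univ _)).trans (le_of_eq ?_)
      rw [Measure.toSphere_real_apply_univ]
      simp [hd, hV]
    have h3 : (1 : ℝ) ≤ 2 ^ d * δ ^ n := one_le_mul_of_one_le_of_one_le
      (one_le_pow₀ (by norm_num)) (one_le_pow₀ h1)
    have h4 : (0 : ℝ) ≤ d * V := by positivity
    nlinarith
  set A := Metric.closedBall θ δ
  set S : Set (Pos n) := Ioo (0 : ℝ) 1 • ((↑) '' A : Set (Pos n)) with hS
  have hA : (surf n).real A = d * (volume : Measure (Pos n)).real S := by
    rw [measureReal_def, Measure.toSphere_apply' _ Metric.isClosed_closedBall.measurableSet,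
      ENNReal.toReal_mul, measureReal_def,
      finrank_euclideanSpace_fin, ENNReal.toReal_natCast]
  have hSb : S ⊆ Metric.ball 0 1 := by
    rintro _ ⟨r, hr, _, ⟨η, -, rfl⟩, rfl⟩
    simp [norm_smul, abs_of_pos hr.1, hr.2]
  have hSf : (volume : Measure (Pos n)) S ≠ ⊤ :=
    ((measure_mono hSb).trans_lt measure_ball_lt_top).ne
  have hsub : S ⊆ (1 - δ) • S ∪ Metric.closedBall (θ : Pos n) (2 * δ) := by
    rintro _ ⟨r, hr, _, ⟨η, hη, rfl⟩, rfl⟩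
    rcases lt_or_ge r (1 - δ) with h | h
    · left
      refine ⟨(r / (1 - δ)) • (η : Pos n), smul_mem_smul ⟨?_, ?_⟩ ⟨η, hη, rfl⟩, ?_⟩
      · exact div_pos hr.1 (by linarith)
      · rwa [div_lt_one (by linarith)]
      · simp only [smul_smul]
        rw [mul_div_cancel₀ _ (by linarith)]
    · right
      rw [Metric.mem_closedBall, dist_eq_norm]
      have e : r • (η : Pos n) - θ = (r - 1) • (η : Pos n) + ((η : Pos n) - θ) := by
        rw [sub_smul, one_smul]; abel
      have h2 : ‖(η : Pos n) - θ‖ ≤ δ := by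
        rw [← dist_eq_norm]; exact hη
      simp only
      rw [e]
      refine (norm_add_le _ _).trans ?_
      rw [norm_smul, norm_eq_of_mem_sphere, Real.norm_eq_abs, abs_of_neg (by linarith [hr.2])]
      linarith
  have h2 : (volume : Measure (Pos n)).real S ≤
      (1 - δ) ^ d * (volume : Measure (Pos n)).real S + (2 * δ) ^ d * V := by
    refine (measureReal_mono hsub ?_).trans ((measureReal_union_le _ _).trans (le_of_eq ?_))
    · refine ((measure_union_le _ _).trans_lt (ENNReal.add_lt_top.2 ⟨?_, ?_⟩)).ne
      · rw [Measure.addHaar_smul]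
        exact ENNReal.mul_lt_top ENNReal.ofReal_lt_top hSf.lt_top
      · exact measure_closedBall_lt_top
    · congr 1
      · rw [measureReal_def, Measure.addHaar_smul, ENNReal.toReal_mul, measureReal_def,
          ENNReal.toReal_ofReal (abs_nonneg _), finrank_euclideanSpace_fin,
          abs_of_nonneg (pow_nonneg (by linarith) _)]
      · rw [Measure.addHaar_real_closedBall _ _ (by linarith), finrank_euclideanSpace_fin]
  have h3 : (1 - δ) ^ d ≤ 1 - δ := pow_le_of_le_one (by linarith) (by linarith) (by omega)
  have h4 : (0 : ℝ) ≤ (volume : Measure (Pos n)).real S := measureReal_nonneg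
  have h5 : δ * (volume : Measure (Pos n)).real S ≤ δ * (2 ^ d * δ ^ n * V) := by
    have : (2 * δ) ^ d * V = δ * (2 ^ d * δ ^ n * V) := by rw [hd]; ring
    nlinarith
  have h6 := le_of_mul_le_mul_left h5 hδ
  rw [hA]
  calc (d : ℝ) * (volume : Measure (Pos n)).real S ≤ d * (2 ^ d * δ ^ n * V) := by gcongr
    _ = _ := by ring

/-- Layer cake formula: the set where `dist^(-a) ≥ t` lies in the ball of radius `t^(-1/a)`, of
measure at most `C t^(-n/a)`, and this is integrable at infinity because `a < n`. For `t ≤ 1` the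
total mass suffices. -/
lemma exists_lintegral_dist_rpow_le (n : ℕ) {a : ℝ} (ha : 0 < a) (han : a < n) :
    ∃ C : ℝ≥0, ∀ θ : Dir n, ∫⁻ θ', ENNReal.ofReal (dist θ' θ ^ (-a)) ∂(surf n) ≤ C := by
  obtain ⟨C, hC0, hC⟩ := exists_surf_closedBall_le n
  set I := ∫⁻ t in Ioi (1 : ℝ), ENNReal.ofReal (C * t ^ (-(n / a))) with hI
  have hIf : I < ⊤ := by
    have h1 : IntegrableOn (fun t : ℝ => C * t ^ (-(n / a))) (Ioi 1) :=
      (integrableOn_Ioi_rpow_of_lt (by rw [neg_lt_neg_iff, one_lt_div ha]; exact han)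
        one_pos).const_mul C
    exact h1.lintegral_lt_top
  have hf : surf n univ + I ≠ ⊤ := (ENNReal.add_lt_top.2 ⟨measure_lt_top _ _, hIf⟩).ne
  refine ⟨(surf n univ + I).toNNReal, fun θ => ?_⟩
  rw [ENNReal.coe_toNNReal hf, lintegral_eq_lintegral_meas_le _
    (Eventually.of_forall fun _ => Real.rpow_nonneg dist_nonneg _) (by fun_prop),
    ← Ioc_union_Ioi_eq_Ioi (zero_le_one (α := ℝ)),
    lintegral_union measurableSet_Ioi (Ioc_disjoint_Ioi le_rfl)]
  refine add_le_add ?_ (setLIntegral_mono' measurableSet_Ioi fun t ht => ?_)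
  · calc ∫⁻ t in Ioc (0 : ℝ) 1, surf n {θ' | t ≤ dist θ' θ ^ (-a)}
        ≤ ∫⁻ _ in Ioc (0 : ℝ) 1, surf n univ := by
          exact lintegral_mono fun t => measure_mono (subset_univ _)
      _ = surf n univ := by simp
  · have ht0 : (0 : ℝ) < t := one_pos.trans ht
    have hpos : 0 < t ^ (-a⁻¹) := Real.rpow_pos_of_pos ht0 _
    refine (measure_mono fun θ' hθ' => ?_).trans ((hC θ _ hpos).trans (le_of_eq ?_))
    · rw [Metric.mem_closedBall]
      rcases (dist_nonneg (x := θ') (y := θ)).eq_or_lt with h | h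
      · rw [← h]; exact hpos.le
      · have h1 : t ≤ dist θ' θ ^ (-a) := hθ'
        have h2 := Real.rpow_le_rpow_of_nonpos ht0 h1 (neg_nonpos.2 (inv_nonneg.2 ha.le))
        rwa [← Real.rpow_mul h.le, neg_mul_neg, mul_inv_cancel₀ ha.ne', Real.rpow_one] at h2
    · rw [← Real.rpow_natCast (t ^ (-a⁻¹)) n, ← Real.rpow_mul ht0.le]
      congr 3
      field_simp

lemma one_sub_inner_eq {n : ℕ} (θ θ' : Dir n) :
    1 - inner ℝ (θ : Pos n) (θ' : Pos n) = dist θ' θ ^ 2 / 2 := by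
  have h := norm_sub_sq_real (θ' : Pos n) (θ : Pos n)
  rw [norm_eq_of_mem_sphere, norm_eq_of_mem_sphere, real_inner_comm] at h
  rw [Subtype.dist_eq, dist_eq_norm, h]
  ring

/-- Since `1 - θ·θ' = |θ - θ'|² / 2`, off the diagonal the kernel is an exact multiple of the power
`-(n + 2s)` of the chordal distance. -/
lemma kernel_mul_dist_sq (n : ℕ) (s : ℝ) (c : ℝ≥0) {θ' θ : Dir n} (h : θ' ≠ θ) :
    kernel n s c θ' θ * dist θ' θ ^ 2 =
      c * (2 : ℝ) ^ (2 * s) * dist θ' θ ^ (-(n + 2 * s - 2)) := by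
  have hd : 0 < dist θ' θ := dist_pos.2 h
  have hd2 : dist θ' θ ^ 2 = dist θ' θ ^ (2 : ℝ) := (Real.rpow_ofNat _ 2).symm
  unfold kernel
  rw [one_sub_inner_eq, Real.div_rpow (by positivity) (by norm_num), hd2, ← Real.rpow_mul hd.le]
  have e1 : dist θ' θ ^ (-(n + 2 * s - 2)) =
      dist θ' θ ^ (2 : ℝ) / dist θ' θ ^ (2 * (n / 2 + s)) := by
    rw [← Real.rpow_sub hd]; congr 1; ring
  have e2 : (2 : ℝ) ^ (2 * s) = 2 ^ (s - n / 2) * 2 ^ (n / 2 + s) := by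
    rw [← Real.rpow_add two_pos]; congr 1; ring
  rw [e1, e2]
  have h1 : dist θ' θ ^ (2 * (n / 2 + s)) ≠ 0 := (Real.rpow_pos_of_pos hd _).ne'
  have h2 : (2 : ℝ) ^ (n / 2 + s) ≠ 0 := (Real.rpow_pos_of_pos two_pos _).ne'
  field_simp

lemma dist_le_two {n : ℕ} (θ θ' : Dir n) : dist θ' θ ≤ 2 := by
  rw [Subtype.dist_eq, dist_eq_norm]
  refine (norm_sub_le _ _).trans ?_
  rw [norm_eq_of_mem_sphere, norm_eq_of_mem_sphere]
  norm_num

lemma exists_lintegral_kernel_le {n : ℕ} (hn : 1 ≤ n) {s : ℝ} (hs1 : s < 1) (c : ℝ≥0) :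
    ∃ C : ℝ≥0, ∀ θ : Dir n,
      ∫⁻ θ', ENNReal.ofReal (kernel n s c θ' θ * dist θ' θ ^ 2) ∂(surf n) ≤ C := by
  have hn' : (1 : ℝ) ≤ n := by exact_mod_cast hn
  set b : ℝ := n + 2 * s - 2 with hb
  -- The true exponent `b < n` may be zero or negative, while the layer cake bound wants a positive
  -- one. Raising it to `a` costs a factor `2^(a - b)`, because distances on the sphere are at most
  -- `2`.
  set a : ℝ := max b (1 / 2) with ha
  have ha0 : 0 < a := lt_of_lt_of_le (by norm_num) (le_max_right _ _)
  have han : a < n := max_lt (by linarith) (by linarith)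
  obtain ⟨C, hC⟩ := exists_lintegral_dist_rpow_le n ha0 han
  set M : ℝ≥0 := c * ((2 : ℝ) ^ (2 * s) * (2 : ℝ) ^ (a - b)).toNNReal with hM
  refine ⟨M * C, fun θ => ?_⟩
  have h : ∀ θ' : Dir n, ENNReal.ofReal (kernel n s c θ' θ * dist θ' θ ^ 2) ≤
      M * ENNReal.ofReal (dist θ' θ ^ (-a)) := fun θ' => by
    rcases eq_or_ne θ' θ with rfl | hne
    · simp
    · have hd : 0 < dist θ' θ := dist_pos.2 hne
      rw [kernel_mul_dist_sq n s c hne, ← ENNReal.ofReal_coe_nnreal,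
        ← ENNReal.ofReal_mul M.coe_nonneg]
      apply ENNReal.ofReal_le_ofReal
      have hM' : (M : ℝ) = c * ((2 : ℝ) ^ (2 * s) * (2 : ℝ) ^ (a - b)) := by
        rw [hM, NNReal.coe_mul, Real.coe_toNNReal _ (by positivity)]
      have h1 : dist θ' θ ^ (-b) ≤ (2 : ℝ) ^ (a - b) * dist θ' θ ^ (-a) := by
        have : dist θ' θ ^ (-b) = dist θ' θ ^ (a - b) * dist θ' θ ^ (-a) := by
          rw [← Real.rpow_add hd]; congr 1; ring
        rw [this]
        have := Real.rpow_le_rpow hd.le (dist_le_two θ θ') (sub_nonneg.2 (le_max_left b (1 / 2)))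
        gcongr
      rw [hM', mul_assoc, mul_assoc, mul_assoc]
      gcongr
  refine (lintegral_mono h).trans ?_
  rw [lintegral_const_mul' _ _ ENNReal.coe_ne_top, ENNReal.coe_mul]
  exact mul_le_mul_right (hC θ) _

lemma integrable_kernel_mul_dist_sq {n : ℕ} (hn : 1 ≤ n) {s : ℝ} (hs1 : s < 1) (c : ℝ≥0) :
    Integrable (fun p : Dir n × Dir n => kernel n s c p.1 p.2 * dist p.1 p.2 ^ 2)
      ((surf n).prod (surf n)) := by
  have hm : Measurable (fun p : Dir n × Dir n => kernel n s c p.1 p.2 * dist p.1 p.2 ^ 2) :=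
    (measurable_kernel n s c).mul ((continuous_dist.measurable).pow_const 2)
  refine ⟨hm.aestronglyMeasurable, ?_⟩
  rw [hasFiniteIntegral_iff_ofReal (Eventually.of_forall
    fun q => mul_nonneg (kernel_nonneg n s c _ _) (sq_nonneg _)),
    lintegral_prod_symm _ hm.ennreal_ofReal.aemeasurable]
  obtain ⟨C, hC⟩ := exists_lintegral_kernel_le hn hs1 c
  refine (lintegral_mono hC).trans_lt ?_
  rw [lintegral_const]
  exact ENNReal.mul_lt_top ENNReal.coe_lt_top (measure_lt_top _ _)

end

section

open Filter Topology Set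

/-! ### Test functions -/

/-- The radial projection onto the sphere, with an arbitrary value at the origin. -/
def radialProj {n : ℕ} (z : Pos n) : Dir n :=
  if h : z = 0 then ⟨EuclideanSpace.single 0 1, by simp⟩
  else ⟨‖z‖⁻¹ • z, by simp [norm_smul, h]⟩

lemma radialProj_coe {n : ℕ} (θ : Dir n) : radialProj (θ : Pos n) = θ := by
  have h : (θ : Pos n) ≠ 0 := ne_zero_of_mem_unit_sphere θ
  rw [radialProj, dif_neg h]
  ext1
  simp

/-- The extension of a function on `ℝ^d × 𝕊^{d-1}` which is homogeneous of degree zero. -/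
def homExt {n : ℕ} (φ : Pos n × Dir n → ℝ) (q : Pos n × Pos n) : ℝ := φ (q.1, radialProj q.2)

lemma homExt_coe {n : ℕ} (φ : Pos n × Dir n → ℝ) (x : Pos n) (θ : Dir n) :
    homExt φ (x, (θ : Pos n)) = φ (x, θ) := by
  rw [homExt, radialProj_coe]

/-- Converts smoothness on the manifold into smoothness on an open subset of `ℝ^d × ℝ^d`, where
`fderiv` and the mean value inequality are available. -/
lemma IsTest.contDiffAt_homExt {n : ℕ} {φ : Pos n × Dir n → ℝ} (hφ : IsTest φ)
    {q : Pos n × Pos n} (hq : q.2 ≠ 0) : ContDiffAt ℝ ∞ (homExt φ) q := by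
  let U : TopologicalSpace.Opens (Pos n × Pos n) :=
    ⟨{q | q.2 ≠ 0}, isOpen_ne.preimage continuous_snd⟩
  have hval : ContMDiff 𝓘(ℝ, Pos n × Pos n) 𝓘(ℝ, Pos n × Pos n) ∞
    (Subtype.val : U → Pos n × Pos n) := contMDiff_subtype_val
  have h1 : ContMDiff 𝓘(ℝ, Pos n × Pos n) 𝓘(ℝ, Pos n) ∞ (fun p : U => p.1.1) :=
    contDiff_fst.contMDiff.comp hval
  have h2 : ContMDiff 𝓘(ℝ, Pos n × Pos n) 𝓘(ℝ, Pos n) ∞ (fun p : U => ‖p.1.2‖⁻¹ • p.1.2) := by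
    intro p
    have hp : (p : Pos n × Pos n).2 ≠ 0 := p.2
    have h3 : ContDiffAt ℝ ∞ (fun q : Pos n × Pos n => ‖q.2‖⁻¹ • q.2) p := by
      have h4 : ContDiffAt ℝ ∞ (fun q : Pos n × Pos n => ‖q.2‖) p :=
        contDiffAt_snd.norm ℝ hp
      exact (h4.inv (norm_ne_zero_iff.2 hp)).smul contDiffAt_snd
    exact ContMDiffAt.comp (g := fun q : Pos n × Pos n => ‖q.2‖⁻¹ • q.2) p h3.contMDiffAt (hval p)
  have h5 : ∀ p : U, ‖p.1.2‖⁻¹ • p.1.2 ∈ Metric.sphere (0 : Pos n) 1 := fun p => by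
    have hp : (p : Pos n × Pos n).2 ≠ 0 := p.2
    simp [norm_smul, hp]
  have : Fact (Module.finrank ℝ (Pos n) = n + 1) := ⟨finrank_euclideanSpace_fin⟩
  have h6 := ContMDiff.codRestrict_sphere (n := n) h2 h5
  have h7 := hφ.smooth.comp (h1.prodMk h6)
  have h8 : (fun p : U => homExt φ p) =
      φ ∘ fun p : U => (p.1.1, Set.codRestrict (fun p : U => ‖p.1.2‖⁻¹ • p.1.2) _ h5 p) := by
    funext p
    have hp : (p : Pos n × Pos n).2 ≠ 0 := p.2
    simp only [homExt, Function.comp_apply, radialProj, dif_neg hp]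
    rfl
  rw [← h8] at h7
  exact (contMDiffAt_subtype_iff.1 (h7 ⟨q, hq⟩)).contDiffAt

variable {n : ℕ} {φ ψ : Pos n × Dir n → ℝ}

lemma dir_ne_zero (θ : Dir n) : (θ : Pos n) ≠ 0 := ne_zero_of_mem_unit_sphere θ

namespace IsTest

lemma continuous (hφ : IsTest φ) : Continuous φ := hφ.smooth.continuous

lemma contDiff_slice (hφ : IsTest φ) (θ : Dir n) : ContDiff ℝ ∞ (fun x => φ (x, θ)) := by
  rw [contDiff_iff_contDiffAt]
  intro x
  have h := (hφ.contDiffAt_homExt (q := (x, (θ : Pos n))) (dir_ne_zero θ)).comp x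
    (contDiffAt_id.prodMk contDiffAt_const)
  refine h.congr_of_eventuallyEq (Eventually.of_forall fun y => ?_)
  exact (homExt_coe φ y θ).symm

lemma transport_eq (hφ : IsTest φ) (p : Pos n × Dir n) :
    transport φ p = fderiv ℝ (homExt φ) (p.1, (p.2 : Pos n)) ((p.2 : Pos n), 0) := by
  have h := (hφ.contDiffAt_homExt (q := (p.1, (p.2 : Pos n)))
    (dir_ne_zero p.2)).differentiableAt (by simp)
  have h1 : HasFDerivAt (fun y : Pos n => (y, (p.2 : Pos n)))
      (ContinuousLinearMap.inl ℝ (Pos n) (Pos n)) p.1 := hasFDerivAt_prodMk_left _ _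
  have h2 := h.hasFDerivAt.comp p.1 h1
  have h3 : (fun y : Pos n => φ (y, p.2)) = homExt φ ∘ fun y : Pos n => (y, (p.2 : Pos n)) := by
    funext y
    exact (homExt_coe φ y p.2).symm
  rw [transport, h3, h2.fderiv]
  simp

lemma continuous_transport (hφ : IsTest φ) : Continuous (transport φ) := by
  have h : transport φ = fun p : Pos n × Dir n =>
      fderiv ℝ (homExt φ) (p.1, (p.2 : Pos n)) ((p.2 : Pos n), 0) := funext hφ.transport_eq
  rw [h, continuous_iff_continuousAt]
  intro p
  have h1 : ContinuousAt (fderiv ℝ (homExt φ)) (p.1, (p.2 : Pos n)) :=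
    ((hφ.contDiffAt_homExt (q := (p.1, (p.2 : Pos n)))
      (dir_ne_zero p.2)).fderiv_right (m := 0) (by norm_num)).continuousAt
  have h2 : ContinuousAt (fun p : Pos n × Dir n => (p.1, (p.2 : Pos n))) p := by fun_prop
  have h3 : ContinuousAt (fun p : Pos n × Dir n => ((p.2 : Pos n), (0 : Pos n))) p := by fun_prop
  exact (ContinuousAt.comp (f := fun p : Pos n × Dir n => (p.1, (p.2 : Pos n))) h1 h2).clm_apply h3

lemma hasCompactSupport_transport (hφ : IsTest φ) : HasCompactSupport (transport φ) := by
  refine HasCompactSupport.intro hφ.compact fun p hp => ?_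
  have h1 := notMem_tsupport_iff_eventuallyEq.1 hp
  have h2 : Tendsto (fun y : Pos n => (y, p.2)) (𝓝 p.1) (𝓝 p) := by
    have : Continuous (fun y : Pos n => (y, p.2)) := by fun_prop
    exact this.tendsto p.1
  have h3 : (fun y : Pos n => φ (y, p.2)) =ᶠ[𝓝 p.1] fun _ => (0 : ℝ) := h2.eventually h1
  rw [transport, h3.fderiv_eq]
  simp

lemma memLp (hφ : IsTest φ) (p : ℝ≥0∞) : MemLp φ p (phase n) :=
  hφ.continuous.memLp_of_hasCompactSupport hφ.compact

lemma memLp_transport (hφ : IsTest φ) (p : ℝ≥0∞) : MemLp (transport φ) p (phase n) :=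
  hφ.continuous_transport.memLp_of_hasCompactSupport hφ.hasCompactSupport_transport

lemma isCompact_image_fst (hφ : IsTest φ) : IsCompact (Prod.fst '' tsupport φ) :=
  hφ.compact.isCompact.image continuous_fst

lemma eq_zero_of_notMem (_hφ : IsTest φ) {x : Pos n} (hx : x ∉ Prod.fst '' tsupport φ)
    (θ : Dir n) : φ (x, θ) = 0 := by
  by_contra h
  exact hx ⟨(x, θ), subset_tsupport _ h, rfl⟩

lemma hasCompactSupport_slice (hφ : IsTest φ) (θ : Dir n) :
    HasCompactSupport (fun x => φ (x, θ)) :=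
  HasCompactSupport.intro hφ.isCompact_image_fst fun _ hx => hφ.eq_zero_of_notMem hx θ

/-- For directions at distance less than `1`, apply the mean value inequality to the homogeneous
extension along the chord, which stays in the shell `1/2 ≤ |z| ≤ 1`, where the derivative is bounded
by compactness. For distance at least `1`, the bound `2B` on the increment is enough. -/
lemma exists_lipschitz (hφ : IsTest φ) :
    ∃ L : ℝ, 0 ≤ L ∧ ∀ x θ θ', |φ (x, θ') - φ (x, θ)| ≤ L * dist θ' θ := by
  obtain ⟨B, hB⟩ := hφ.continuous.bounded_above_of_compact_support hφ.compact
  set A : Set (Pos n × Pos n) :=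
    (Prod.fst '' tsupport φ) ×ˢ (Metric.closedBall 0 1 \ Metric.ball 0 (1 / 2)) with hA
  have hAc : IsCompact A :=
    hφ.isCompact_image_fst.prod ((isCompact_closedBall _ _).diff Metric.isOpen_ball)
  have hne : ∀ z : Pos n, z ∈ Metric.closedBall (0 : Pos n) 1 \ Metric.ball 0 (1 / 2) →
      z ≠ 0 := by
    rintro z hz rfl
    exact hz.2 (by simp)
  have hcont : ContinuousOn (fderiv ℝ (homExt φ)) A := fun q hq =>
    ((hφ.contDiffAt_homExt (hne _ hq.2)).fderiv_right
      (m := 0) (by norm_num)).continuousAt.continuousWithinAt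
  obtain ⟨M, hM⟩ := hAc.exists_bound_of_continuousOn hcont
  have hB0 : 0 ≤ B := (norm_nonneg _).trans (hB (0, radialProj 0))
  refine ⟨max M 0 + 2 * B, by positivity, fun x θ θ' => ?_⟩
  by_cases hx : x ∈ Prod.fst '' tsupport φ
  swap
  · rw [hφ.eq_zero_of_notMem hx, hφ.eq_zero_of_notMem hx, sub_zero, abs_zero]
    positivity
  rcases lt_or_ge (dist θ' θ) 1 with h | h
  · have hd : dist (θ' : Pos n) (θ : Pos n) < 1 := h
    have hseg : ∀ z ∈ segment ℝ (θ : Pos n) (θ' : Pos n),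
        z ∈ Metric.closedBall (0 : Pos n) 1 \ Metric.ball 0 (1 / 2) := by
      intro z hz
      refine ⟨(convex_closedBall (0 : Pos n) 1).segment_subset (by simp) (by simp) hz, ?_⟩
      intro hz'
      rw [mem_ball_zero_iff] at hz'
      obtain ⟨a, b, ha, hb, hab, rfl⟩ := hz
      -- With `ab ≤ 1/4` and distance at most `1` this is at least `3/4`, so the chord avoids the
      -- ball of radius `1/2`.
      have hsq : ‖a • (θ : Pos n) + b • (θ' : Pos n)‖ ^ 2 =
          1 - a * b * dist θ' θ ^ 2 := by
        have h1 := one_sub_inner_eq θ θ'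
        rw [norm_add_sq_real, norm_smul, norm_smul, real_inner_smul_left, real_inner_smul_right,
          norm_eq_of_mem_sphere, norm_eq_of_mem_sphere, Real.norm_eq_abs, Real.norm_eq_abs,
          mul_one, mul_one, sq_abs, sq_abs]
        have h2 : b = 1 - a := by linarith
        subst h2
        linear_combination (-2 * a * (1 - a)) * h1
      have h3 : dist θ' θ ^ 2 ≤ 1 := pow_le_one₀ dist_nonneg h.le
      have h4 : a * b ≤ 1 / 4 := by
        have : b = 1 - a := by linarith
        subst this
        nlinarith [sq_nonneg (a - 1 / 2)]
      have h5 : a * b * dist θ' θ ^ 2 ≤ 1 / 4 := by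
        nlinarith [mul_nonneg ha hb, sq_nonneg (dist θ' θ)]
      nlinarith [norm_nonneg (a • (θ : Pos n) + b • (θ' : Pos n))]
    have hmv := (convex_segment (𝕜 := ℝ) (x, (θ : Pos n))
      (x, (θ' : Pos n))).norm_image_sub_le_of_norm_fderiv_le (f := homExt φ) (C := M) (𝕜 := ℝ) (x := (x, (θ : Pos n))) (y := (x, (θ' : Pos n)))
      ?_ ?_ (left_mem_segment _ _ _) (right_mem_segment _ _ _)
    · rw [homExt_coe, homExt_coe, Real.norm_eq_abs] at hmv
      refine hmv.trans ?_
      have e : ‖(x, (θ' : Pos n)) - (x, (θ : Pos n))‖ = dist θ' θ := by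
        rw [Prod.mk_sub_mk, sub_self, Prod.norm_mk, norm_zero, ← dist_eq_norm]
        exact max_eq_right dist_nonneg
      rw [e]
      have : M ≤ max M 0 + 2 * B := by linarith [le_max_left M 0]
      gcongr
    all_goals
      rintro q hq
      have hq' : q.1 = x ∧ q.2 ∈ segment ℝ (θ : Pos n) (θ' : Pos n) := by
        obtain ⟨a, b, ha, hb, hab, rfl⟩ := hq
        refine ⟨?_, a, b, ha, hb, hab, rfl⟩
        change a • x + b • x = x
        rw [← add_smul, hab, one_smul]
    · exact (hφ.contDiffAt_homExt (hne _ (hseg _ hq'.2))).differentiableAt (by simp)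
    · exact hM q ⟨by rw [hq'.1]; exact hx, hseg _ hq'.2⟩
  · have h1 : |φ (x, θ') - φ (x, θ)| ≤ 2 * B := by
      refine (abs_sub _ _).trans ?_
      have := hB (x, θ')
      have := hB (x, θ)
      simp only [Real.norm_eq_abs] at *
      linarith
    have : 0 ≤ max M 0 := le_max_right _ _
    nlinarith

end IsTest

end

/-! ### Test functions inside `𝓗^s_ε`, integration by parts and the weak transport derivative -/

section

open Filter Topology Set

variable {n : ℕ} {φ ψ : Pos n × Dir n → ℝ}

namespace IsTest

lemma zero : IsTest (0 : Pos n × Dir n → ℝ) := ⟨contMDiff_const, HasCompactSupport.zero⟩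

lemma add (hφ : IsTest φ) (hψ : IsTest ψ) : IsTest (φ + ψ) :=
  ⟨hφ.smooth.add hψ.smooth, hφ.compact.add hψ.compact⟩

lemma smul (a : ℝ) (hφ : IsTest φ) : IsTest (a • φ) :=
  ⟨(contMDiff_const (I' := 𝓘(ℝ, ℝ)) (c := a)).mul hφ.smooth, hφ.compact.smul_left (f := fun _ => a)⟩

lemma differentiableAt_slice (hφ : IsTest φ) (p : Pos n × Dir n) :
    DifferentiableAt ℝ (fun x => φ (x, p.2)) p.1 :=
  (hφ.contDiff_slice p.2).contDiffAt.differentiableAt (by simp)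

lemma transport_add (hφ : IsTest φ) (hψ : IsTest ψ) :
    transport (φ + ψ) = transport φ + transport ψ := by
  funext p
  have h := fderiv_add (hφ.differentiableAt_slice p) (hψ.differentiableAt_slice p)
  simp only [transport, Pi.add_apply]
  exact congrArg (fun L : Pos n →L[ℝ] ℝ => L (p.2 : Pos n)) h

lemma transport_smul (a : ℝ) (hφ : IsTest φ) : transport (a • φ) = a • transport φ := by
  funext p
  have h := fderiv_const_smul (hφ.differentiableAt_slice p) a
  simp only [transport, Pi.smul_apply]
  exact congrArg (fun L : Pos n →L[ℝ] ℝ => L (p.2 : Pos n)) h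

/-- Test functions have finite energy: a Lipschitz increment squared supplies the factor `dist²`
that makes the kernel integrable, and compact support handles the integral in `x`. -/
lemma memLp_wincr (hφ : IsTest φ) (hn : 1 ≤ n) {s : ℝ} (hs : s < 1) (c : ℝ≥0) :
    MemLp (wincr s c φ) 2 (pairs n) := by
  have hm := measurable_wincr s c hφ.continuous.measurable
  rw [memLp_two_iff_integrable_sq hm.aestronglyMeasurable]
  obtain ⟨L, hL0, hL⟩ := hφ.exists_lipschitz
  set K := Prod.fst '' tsupport φ with hK
  have hKm : MeasurableSet K := hφ.isCompact_image_fst.isClosed.measurableSet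
  have h1 : Integrable (K.indicator fun _ : Pos n => L ^ 2) :=
    (integrable_indicator_iff hKm).2 (integrableOn_const hφ.isCompact_image_fst.measure_lt_top.ne)
  refine (h1.mul_prod (integrable_kernel_mul_dist_sq hn hs c)).mono'
    (hm.pow_const 2).aestronglyMeasurable (Eventually.of_forall fun q => ?_)
  rw [Real.norm_eq_abs, abs_of_nonneg (sq_nonneg _), wincr_sq]
  have hk := kernel_nonneg n s c q.2.1 q.2.2
  by_cases hx : q.1 ∈ K
  · rw [indicator_of_mem hx]
    have h2 : (φ (q.1, q.2.1) - φ (q.1, q.2.2)) ^ 2 ≤ L ^ 2 * dist q.2.1 q.2.2 ^ 2 := by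
      rw [← mul_pow, ← sq_abs]
      exact pow_le_pow_left₀ (abs_nonneg _) (hL _ _ _) 2
    nlinarith
  · rw [hφ.eq_zero_of_notMem hx, hφ.eq_zero_of_notMem hx, indicator_of_notMem hx]
    simp

/-- Translation of a test function in the position variable. -/
lemma translate (hφ : IsTest φ) (y : Pos n) : IsTest (fun p => φ (p.1 - y, p.2)) := by
  constructor
  · refine hφ.smooth.comp (ContMDiff.prodMk ?_ contMDiff_snd)
    exact (contDiff_id.sub contDiff_const).contMDiff.comp contMDiff_fst
  · exact hφ.compact.comp_homeomorph ((Homeomorph.subRight y).prodCongr (Homeomorph.refl _))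

lemma transport_translate (φ : Pos n × Dir n → ℝ) (y : Pos n) (p : Pos n × Dir n) :
    transport (fun p => φ (p.1 - y, p.2)) p = transport φ (p.1 - y, p.2) := by
  simp only [transport]
  rw [fderiv_comp_sub (f := fun x => φ (x, p.2)) y]

end IsTest

/-- Integration by parts against a compactly supported function. -/
lemma integral_mul_fderiv_eq_neg {f g : Pos n → ℝ} (hf : ContDiff ℝ ∞ f) (hg : ContDiff ℝ ∞ g)
    (hfc : HasCompactSupport f) (v : Pos n) :
    ∫ x, f x * fderiv ℝ g x v = -∫ x, fderiv ℝ f x v * g x := by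
  have hf' : Continuous (fun x => fderiv ℝ f x v) :=
    (hf.continuous_fderiv (by simp)).clm_apply continuous_const
  have hg' : Continuous (fun x => fderiv ℝ g x v) :=
    (hg.continuous_fderiv (by simp)).clm_apply continuous_const
  have hfc' : HasCompactSupport (fun x => fderiv ℝ f x v) := hfc.fderiv_apply (𝕜 := ℝ) v
  apply integral_mul_fderiv_eq_neg_fderiv_mul_of_integrable
  · exact (hf'.mul hg.continuous).integrable_of_hasCompactSupport hfc'.mul_right
  · exact (hf.continuous.mul hg').integrable_of_hasCompactSupport hfc.mul_right
  · exact (hf.continuous.mul hg.continuous).integrable_of_hasCompactSupport hfc.mul_right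
  · exact fun x _ => hf.contDiffAt.differentiableAt (by simp)
  · exact fun x _ => hg.contDiffAt.differentiableAt (by simp)

/-- For fixed `θ` the field is constant in `x`, so integration by parts equates the integral over a
slice with its negative. This skewness leaves the coercivity in Lions' theorem intact. -/
lemma IsTest.integral_mul_transport (hφ : IsTest φ) :
    ∫ p, φ p * transport φ p ∂(phase n) = 0 := by
  have hi : Integrable (fun p => φ p * transport φ p) (phase n) :=
    (hφ.memLp 2).integrable_mul (hφ.memLp_transport 2)
  rw [integral_prod_symm _ hi]
  refine integral_eq_zero_of_ae (Eventually.of_forall fun θ => ?_)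
  have h := integral_mul_fderiv_eq_neg (hφ.contDiff_slice θ) (hφ.contDiff_slice θ)
    (hφ.hasCompactSupport_slice θ) (θ : Pos n)
  simp only [mul_comm (fderiv ℝ _ _ _)] at h
  have h' : ∫ x, φ (x, θ) * transport φ (x, θ) = -∫ x, φ (x, θ) * transport φ (x, θ) := h
  simp only [Pi.zero_apply]
  linarith

/-- The space of test functions. -/
def testSpace (n : ℕ) : Submodule ℝ (Pos n × Dir n → ℝ) where
  carrier := {φ | IsTest φ}
  zero_mem' := IsTest.zero
  add_mem' := IsTest.add
  smul_mem' a _ h := IsTest.smul a h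

/-- The transport derivative of test functions as a linear map into `L²`. -/
def testTransport (n : ℕ) : testSpace n →ₗ[ℝ] L2 n where
  toFun φ := (φ.2.memLp_transport 2).toLp _
  map_add' φ ψ := by
    rw [← MemLp.toLp_add]
    exact MemLp.toLp_congr _ _ (Eventually.of_forall fun p => congrFun (φ.2.transport_add ψ.2) p)
  map_smul' a φ := by
    rw [RingHom.id_apply, ← MemLp.toLp_const_smul]
    exact MemLp.toLp_congr _ _ (Eventually.of_forall fun p => congrFun (φ.2.transport_smul a) p)

lemma coeFn_testTransport (φ : testSpace n) :
    testTransport n φ =ᵐ[phase n] transport (φ : Pos n × Dir n → ℝ) :=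
  (φ.2.memLp_transport 2).coeFn_toLp

section

variable [hn : Fact (1 ≤ n)] {s : ℝ} [hs : Fact (s < 1)] {c ε : ℝ≥0}

/-- A test function as an element of `𝓗^s_ε`. -/
def IsTest.toH (hφ : IsTest φ) : HSpace n s c ε :=
  HSpace.ofMemLp φ (hφ.memLp 2) (hφ.memLp_wincr hn.out hs.out c)

lemma IsTest.coeFn_toH (hφ : IsTest φ) : (hφ.toH : HSpace n s c ε).toL2 =ᵐ[phase n] φ :=
  (hφ.memLp 2).coeFn_toLp

/-- The inclusion of the test functions into `𝓗^s_ε`. -/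
def testToH (n : ℕ) (s : ℝ) (c ε : ℝ≥0) [Fact (1 ≤ n)] [Fact (s < 1)] :
    testSpace n →ₗ[ℝ] HSpace n s c ε where
  toFun φ := IsTest.toH φ.2
  map_add' φ ψ := HSpace.toL2_injective (MemLp.toLp_add (φ.2.memLp 2) (ψ.2.memLp 2))
  map_smul' a φ := HSpace.toL2_injective (MemLp.toLp_const_smul a (φ.2.memLp 2))

lemma coeFn_testToH (φ : testSpace n) :
    (testToH n s c ε φ).toL2 =ᵐ[phase n] (φ : Pos n × Dir n → ℝ) := φ.2.coeFn_toH

lemma IsTest.eq_toH (hφ : IsTest φ) {h : HSpace n s c ε} (hh : h.toL2 =ᵐ[phase n] φ) :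
    h = hφ.toH := HSpace.ext_ae (hh.trans hφ.coeFn_toH.symm)

/-- The representative of `φ` quantified existentially in `IsWeakTransport` is unique, so it may be
replaced by `testToH`. -/
lemma isWeakTransport_iff {u : HSpace n s c ε} {ℓ : StrongDual ℝ (HSpace n s c ε)} :
    IsWeakTransport u ℓ ↔
      ∀ φ : testSpace n, ℓ (testToH n s c ε φ) = -inner ℝ u.toL2 (testTransport n φ) := by
  have e : ∀ φ : testSpace n, inner ℝ u.toL2 (testTransport n φ) =
      ∫ p, u.toL2 p * transport (φ : Pos n × Dir n → ℝ) p ∂(phase n) := fun φ => by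
    rw [L2.inner_def]
    apply integral_congr_ae
    filter_upwards [coeFn_testTransport φ] with p hp
    simp only [RCLike.inner_apply, conj_trivial, hp, mul_comm]
  constructor
  · intro h φ
    obtain ⟨v, hv, hv'⟩ := h φ φ.2
    rw [e, ← hv']
    exact congrArg ℓ (φ.2.eq_toH hv).symm
  · intro h φ hφ
    refine ⟨hφ.toH, hφ.coeFn_toH, ?_⟩
    have := h ⟨φ, hφ⟩
    rw [e] at this
    exact this

lemma inner_testToH_testTransport (φ : testSpace n) :
    inner ℝ (testToH n s c ε φ).toL2 (testTransport n φ) = 0 := by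
  rw [L2.inner_def, ← φ.2.integral_mul_transport]
  apply integral_congr_ae
  filter_upwards [coeFn_testTransport φ, coeFn_testToH (s := s) (c := c) (ε := ε) φ] with p h1 h2
  simp only [RCLike.inner_apply, conj_trivial, h1, h2, mul_comm]

end

/-- Products of a test function in the position variable and a power of a linear function. -/
lemma isTest_mul_inner_pow {χ : Pos n → ℝ} (hχ : ContDiff ℝ ∞ χ) (hχc : HasCompactSupport χ)
    (η : Pos n) (k : ℕ) :
    IsTest (fun p : Pos n × Dir n => χ p.1 * inner ℝ (p.2 : Pos n) η ^ k) := by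
  constructor
  · refine ContMDiff.mul (hχ.contMDiff.comp contMDiff_fst) ?_
    have : Fact (Module.finrank ℝ (Pos n) = n + 1) := ⟨finrank_euclideanSpace_fin⟩
    have h1 : ContDiff ℝ ∞ (fun z : Pos n => inner ℝ z η ^ k) :=
      (contDiff_id.inner ℝ contDiff_const).pow k
    exact h1.contMDiff.comp ((contMDiff_coe_sphere (n := n)).comp contMDiff_snd)
  · refine HasCompactSupport.intro (K := tsupport χ ×ˢ (univ : Set (Dir n)))
      (hχc.isCompact.prod isCompact_univ) fun p hp => ?_
    have : p.1 ∉ tsupport χ := fun h => hp ⟨h, mem_univ _⟩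
    rw [image_eq_zero_of_notMem_tsupport this, zero_mul]

end

section

open Filter Topology Set

variable {n : ℕ}

/-! ### Zonal integral operators -/

/-- The action of the zonal kernel `κ(θ·θ')` on the function `θ' ↦ (θ'·η)^k`. -/
def zonal (κ : ℝ → ℝ) (k : ℕ) (θ : Dir n) (η : Pos n) : ℝ :=
  ∫ θ', κ (inner ℝ (θ : Pos n) (θ' : Pos n)) * inner ℝ (θ' : Pos n) η ^ k ∂(surf n)

lemma integral_sphereMap (R : Pos n ≃ₗᵢ[ℝ] Pos n) {f : Dir n → ℝ} (hf : Measurable f) :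
    ∫ θ, f (sphereMap R θ) ∂(surf n) = ∫ θ, f θ ∂(surf n) := by
  have h := measurePreserving_sphereMap R
  rw [← integral_map h.measurable.aemeasurable hf.aestronglyMeasurable, h.map_eq]

lemma measurable_inner_left (θ : Pos n) : Measurable (fun θ' : Dir n => inner ℝ θ (θ' : Pos n)) :=
  Continuous.measurable (by fun_prop)

lemma measurable_inner_right (η : Pos n) : Measurable (fun θ : Dir n => inner ℝ (θ : Pos n) η) :=
  Continuous.measurable (by fun_prop)

lemma zonal_map {κ : ℝ → ℝ} (hκ : Measurable κ) (k : ℕ) (R : Pos n ≃ₗᵢ[ℝ] Pos n) (θ : Dir n)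
    (η : Pos n) : zonal κ k (sphereMap R θ) (R η) = zonal κ k θ η := by
  unfold zonal
  rw [← integral_sphereMap R]
  · simp
  · exact (hκ.comp (measurable_inner_left _)).mul ((measurable_inner_right _).pow_const k)

/-- Two reflections suffice. The first sends `θ` to `θ₀`; the second sends the image of `η` to its
target, which has the same norm. It fixes `θ₀` because the two vectors it exchanges have the same
inner product with `θ₀`. -/
lemma exists_isometry_map (θ θ₀ : Dir n) (η η₀ : Pos n) (h0 : ‖η₀‖ = 1)
    (h1 : inner ℝ (θ₀ : Pos n) η₀ = 0) :
    ∃ R : Pos n ≃ₗᵢ[ℝ] Pos n, R θ = θ₀ ∧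
      R η = inner ℝ (θ : Pos n) η • (θ₀ : Pos n) +
        √(‖η‖ ^ 2 - inner ℝ (θ : Pos n) η ^ 2) • η₀ := by
  set a := inner ℝ (θ : Pos n) η with ha
  set b := √(‖η‖ ^ 2 - a ^ 2) with hb
  have hb2 : b ^ 2 = ‖η‖ ^ 2 - a ^ 2 := by
    apply Real.sq_sqrt
    have := abs_real_inner_le_norm (θ : Pos n) η
    rw [norm_eq_of_mem_sphere, one_mul] at this
    rw [sub_nonneg, ← sq_abs a]
    exact pow_le_pow_left₀ (abs_nonneg _) this 2
  set R₁ : Pos n ≃ₗᵢ[ℝ] Pos n := (Submodule.span ℝ {(θ : Pos n) - θ₀})ᗮ.reflection with hR₁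
  have e1 : R₁ θ = θ₀ := by
    apply Submodule.reflection_sub
    rw [norm_eq_of_mem_sphere, norm_eq_of_mem_sphere]
  set v : Pos n := a • (θ₀ : Pos n) + b • η₀ with hv
  have hn : ‖R₁ η‖ = ‖v‖ := by
    rw [LinearIsometryEquiv.norm_map, ← sq_eq_sq₀ (norm_nonneg _) (norm_nonneg _), hv,
      norm_add_sq_real, norm_smul, norm_smul, real_inner_smul_left, real_inner_smul_right, h1, h0,
      norm_eq_of_mem_sphere, mul_one, mul_one, Real.norm_eq_abs, Real.norm_eq_abs, sq_abs, sq_abs,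
      hb2]
    ring
  set R₂ : Pos n ≃ₗᵢ[ℝ] Pos n := (Submodule.span ℝ {R₁ η - v})ᗮ.reflection with hR₂
  have e2 : R₂ (R₁ η) = v := Submodule.reflection_sub hn
  have e3 : R₂ θ₀ = θ₀ := by
    apply Submodule.reflection_mem_subspace_eq_self
    rw [Submodule.mem_orthogonal_singleton_iff_inner_right, inner_sub_left, sub_eq_zero, hv,
      inner_add_left, real_inner_smul_left, real_inner_smul_left, real_inner_comm _ η₀, h1,
      real_inner_self_eq_norm_sq, norm_eq_of_mem_sphere, ← e1, LinearIsometryEquiv.inner_map_map,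
      real_inner_comm]
    simp [ha]
  refine ⟨R₁.trans R₂, ?_, ?_⟩
  · simp [e1, e3]
  · simp [e2]

lemma exists_orthonormal_pair (hn : 1 ≤ n) :
    ∃ (θ₀ : Dir n) (η₀ : Pos n), ‖η₀‖ = 1 ∧ inner ℝ (θ₀ : Pos n) η₀ = 0 := by
  refine ⟨⟨EuclideanSpace.single 0 1, by simp⟩, EuclideanSpace.single (Fin.last n) 1, by simp, ?_⟩
  rw [EuclideanSpace.inner_single_left]
  have : (0 : Fin (n + 1)) ≠ Fin.last n := by
    intro h
    have := congrArg Fin.val h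
    simp at this
    omega
  simp [this]

lemma abs_inner_pow_le (θ : Dir n) (η : Pos n) (k : ℕ) :
    |inner ℝ (θ : Pos n) η ^ k| ≤ ‖η‖ ^ k := by
  rw [abs_pow]
  refine pow_le_pow_left₀ (abs_nonneg _) ?_ k
  have := abs_real_inner_le_norm (θ : Pos n) η
  rwa [norm_eq_of_mem_sphere, one_mul] at this

lemma integrable_of_bound {f : Dir n → ℝ} (hf : Measurable f) {C : ℝ} (hC : ∀ θ, |f θ| ≤ C) :
    Integrable f (surf n) :=
  Integrable.of_bound hf.aestronglyMeasurable C (Eventually.of_forall hC)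

/-- Zonal integral operators preserve the polynomials of degree at most `k` in `θ·η`. -/
lemma exists_zonal_eq_eval (hn : 1 ≤ n) {κ : ℝ → ℝ} (hκ : Measurable κ) {M : ℝ}
    (hM : ∀ t, |κ t| ≤ M) (k : ℕ) (η : Pos n) :
    ∃ Q : Polynomial ℝ, Q.natDegree ≤ k ∧
      ∀ θ : Dir n, zonal κ k θ η = Q.eval (inner ℝ (θ : Pos n) η) := by
  obtain ⟨θ₀, η₀, h0, h1⟩ := exists_orthonormal_pair hn
  set m : ℕ → ℝ := fun i => ∫ θ' : Dir n, κ (inner ℝ (θ₀ : Pos n) (θ' : Pos n)) *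
    (inner ℝ (θ' : Pos n) (θ₀ : Pos n) ^ i * inner ℝ (θ' : Pos n) η₀ ^ (k - i)) ∂(surf n) with hm
  have hmeas : ∀ i, Measurable (fun θ' : Dir n => κ (inner ℝ (θ₀ : Pos n) (θ' : Pos n)) *
      (inner ℝ (θ' : Pos n) (θ₀ : Pos n) ^ i * inner ℝ (θ' : Pos n) η₀ ^ (k - i))) := fun i =>
    (hκ.comp (measurable_inner_left _)).mul
      (((measurable_inner_right _).pow_const i).mul ((measurable_inner_right _).pow_const _))
  have hM0 : 0 ≤ M := (abs_nonneg _).trans (hM 0)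
  have hint : ∀ i, Integrable (fun θ' : Dir n => κ (inner ℝ (θ₀ : Pos n) (θ' : Pos n)) *
      (inner ℝ (θ' : Pos n) (θ₀ : Pos n) ^ i * inner ℝ (θ' : Pos n) η₀ ^ (k - i))) (surf n) := by
    intro i
    refine integrable_of_bound (hmeas i) (C := M * (‖(θ₀ : Pos n)‖ ^ i * ‖η₀‖ ^ (k - i)))
      fun θ' => ?_
    rw [abs_mul, abs_mul]
    gcongr
    · exact hM _
    · exact abs_inner_pow_le _ _ _
    · exact abs_inner_pow_le _ _ _
  -- The reflection `η₀ ↦ -η₀` fixes `θ₀`, hence the weight, and changes the sign of an odd power.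
  -- This removes the odd powers of the square root `b` below, which would not be polynomial in
  -- `θ·η`.
  have hodd : ∀ i, Odd (k - i) → m i = 0 := by
    intro i hi
    set R : Pos n ≃ₗᵢ[ℝ] Pos n := (Submodule.span ℝ {η₀})ᗮ.reflection with hR
    have e1 : R θ₀ = θ₀ := by
      apply Submodule.reflection_mem_subspace_eq_self
      rw [Submodule.mem_orthogonal_singleton_iff_inner_right, real_inner_comm, h1]
    have e2 : R η₀ = -η₀ := Submodule.reflection_orthogonalComplement_singleton_eq_neg η₀
    have h2 := integral_sphereMap R (hmeas i)
    have h3 : ∀ θ' : Dir n, inner ℝ (R θ') (θ₀ : Pos n) = inner ℝ (θ' : Pos n) (θ₀ : Pos n) := by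
      intro θ'
      conv_lhs => rw [← e1]
      rw [LinearIsometryEquiv.inner_map_map]
    have h4 : ∀ θ' : Dir n, inner ℝ (R θ') η₀ = -inner ℝ (θ' : Pos n) η₀ := by
      intro θ'
      rw [← neg_neg η₀, ← e2, inner_neg_right, LinearIsometryEquiv.inner_map_map, e2, neg_neg]
    simp only [coe_sphereMap] at h2
    simp only [h3, h4, hi.neg_pow, real_inner_comm _ (θ₀ : Pos n),
      mul_neg, integral_neg] at h2
    simp only [hm, real_inner_comm _ (θ₀ : Pos n)]
    linarith
  -- Move `θ` to `θ₀` and `η` to `a θ₀ + b η₀` with `a = θ·η`, `b² = ‖η‖² - a²`, and expand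
  -- binomially. The truncated quotient `(k - i) / 2` is exact whenever `m i ≠ 0`.
  refine ⟨∑ i ∈ Finset.range (k + 1), Polynomial.C (m i * (k.choose i)) *
    (Polynomial.X ^ i * (Polynomial.C (‖η‖ ^ 2) - Polynomial.X ^ 2) ^ ((k - i) / 2)), ?_, ?_⟩
  · refine Polynomial.natDegree_sum_le_of_forall_le _ _ fun i hi => ?_
    have hi' : i ≤ k := Nat.lt_succ_iff.1 (Finset.mem_range.1 hi)
    refine (Polynomial.natDegree_C_mul_le _ _).trans (Polynomial.natDegree_mul_le.trans ?_)
    have h5 : (Polynomial.C (‖η‖ ^ 2) - Polynomial.X ^ 2 : Polynomial ℝ).natDegree ≤ 2 :=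
      (Polynomial.natDegree_sub_le _ _).trans (by simp)
    have h6 := (Polynomial.natDegree_pow_le (p := (Polynomial.C (‖η‖ ^ 2) - Polynomial.X ^ 2 :
      Polynomial ℝ)) (n := (k - i) / 2)).trans (Nat.mul_le_mul_left _ h5)
    rw [Polynomial.natDegree_X_pow]
    omega
  · intro θ
    obtain ⟨R, hR1, hR2⟩ := exists_isometry_map θ θ₀ η η₀ h0 h1
    set a := inner ℝ (θ : Pos n) η with ha
    have hab : 0 ≤ ‖η‖ ^ 2 - a ^ 2 := by
      have := abs_inner_pow_le θ η 2
      rw [abs_of_nonneg (sq_nonneg _)] at this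
      linarith
    set b := √(‖η‖ ^ 2 - a ^ 2) with hb
    have hRθ : sphereMap R θ = θ₀ := Subtype.ext hR1
    rw [← zonal_map hκ k R, hRθ, hR2, zonal]
    have e : ∀ θ' : Dir n, κ (inner ℝ (θ₀ : Pos n) (θ' : Pos n)) *
        inner ℝ (θ' : Pos n) (a • (θ₀ : Pos n) + b • η₀) ^ k =
        ∑ i ∈ Finset.range (k + 1), (a ^ i * b ^ (k - i) * (k.choose i)) *
          (κ (inner ℝ (θ₀ : Pos n) (θ' : Pos n)) *
          (inner ℝ (θ' : Pos n) (θ₀ : Pos n) ^ i * inner ℝ (θ' : Pos n) η₀ ^ (k - i))) := by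
      intro θ'
      rw [inner_add_right, real_inner_smul_right, real_inner_smul_right, add_pow, Finset.mul_sum]
      refine Finset.sum_congr rfl fun i _ => ?_
      rw [mul_pow, mul_pow]
      ring
    simp only [e]
    rw [integral_finsetSum _ fun i _ => (hint i).const_mul _, Polynomial.eval_finsetSum]
    refine Finset.sum_congr rfl fun i _ => ?_
    rw [integral_const_mul]
    change _ * m i = _
    rcases Nat.even_or_odd (k - i) with h | h
    · obtain ⟨j, hj⟩ := h
      have hj2 : (k - i) / 2 = j := by omega
      have hbj : b ^ (k - i) = (‖η‖ ^ 2 - a ^ 2) ^ j := by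
        rw [hj, ← two_mul, pow_mul, hb, Real.sq_sqrt hab]
      rw [hj2, hbj]
      simp
      ring
    · rw [hodd i h]
      simp

end

section

open Filter Topology Set

variable {n : ℕ}

/-! ### Functions of finite energy on the sphere -/

/-- The measurable representatives of the elements of `H^s_𝓑`. -/
structure IsEnergy (n : ℕ) (s : ℝ) (c : ℝ≥0) (g : Dir n → ℝ) : Prop where
  measurable : Measurable g
  memLp : MemLp g 2 (surf n)
  integrable : Integrable (fun p : Dir n × Dir n => kernel n s c p.1 p.2 * (g p.1 - g p.2) ^ 2)
    ((surf n).prod (surf n))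

namespace IsEnergy

variable {s : ℝ} {c : ℝ≥0} {g h : Dir n → ℝ}

lemma integrable_mul (hg : IsEnergy n s c g) (hh : IsEnergy n s c h) :
    Integrable (fun θ => g θ * h θ) (surf n) := MemLp.integrable_mul hg.memLp hh.memLp

lemma integrable_cross (hg : IsEnergy n s c g) (hh : IsEnergy n s c h) :
    Integrable (fun p : Dir n × Dir n => kernel n s c p.1 p.2 * (g p.1 - g p.2) * (h p.1 - h p.2))
      ((surf n).prod (surf n)) := by
  have hk := measurable_kernel n s c
  have h1 := hg.measurable
  have h2 := hh.measurable
  refine (hg.integrable.add hh.integrable).mono' (by fun_prop) (Eventually.of_forall fun p => ?_)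
  have hK := kernel_nonneg n s c p.1 p.2
  simp only [Pi.add_apply, Real.norm_eq_abs]
  rw [← mul_add, mul_assoc, abs_mul, abs_of_nonneg hK, abs_mul]
  apply mul_le_mul_of_nonneg_left _ hK
  rw [← sq_abs (g p.1 - g p.2), ← sq_abs (h p.1 - h p.2)]
  nlinarith [sq_nonneg (|g p.1 - g p.2| - |h p.1 - h p.2|), sq_nonneg (|g p.1 - g p.2|),
    sq_nonneg (|h p.1 - h p.2|)]

lemma add (hg : IsEnergy n s c g) (hh : IsEnergy n s c h) : IsEnergy n s c (fun θ => g θ + h θ) := by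
  refine ⟨hg.measurable.add hh.measurable, hg.memLp.add hh.memLp, ?_⟩
  refine ((hg.integrable.add hh.integrable).add ((hg.integrable_cross hh).const_mul 2)).congr
    (Eventually.of_forall fun p => ?_)
  simp only [Pi.add_apply]
  ring

lemma const_mul (a : ℝ) (hg : IsEnergy n s c g) : IsEnergy n s c (fun θ => a * g θ) := by
  refine ⟨hg.measurable.const_mul a, hg.memLp.const_mul a, ?_⟩
  refine (hg.integrable.const_mul (a ^ 2)).congr (Eventually.of_forall fun p => ?_)
  simp only
  ring

lemma sub (hg : IsEnergy n s c g) (hh : IsEnergy n s c h) : IsEnergy n s c (fun θ => g θ - h θ) := by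
  have := hg.add (hh.const_mul (-1))
  simpa only [neg_mul, one_mul, ← sub_eq_add_neg] using this

lemma sum {ι : Type*} (S : Finset ι) {f : ι → Dir n → ℝ} (hf : ∀ i ∈ S, IsEnergy n s c (f i)) :
    IsEnergy n s c (fun θ => ∑ i ∈ S, f i θ) := by
  classical
  induction S using Finset.induction_on with
  | empty =>
    simp only [Finset.sum_empty]
    exact ⟨measurable_const, memLp_const 0, by simp⟩
  | insert i S hi ih =>
    simp only [Finset.sum_insert hi]
    exact (hf i (Finset.mem_insert_self i S)).add
      (ih fun j hj => hf j (Finset.mem_insert_of_mem hj))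

lemma formB_sub_left {f : Dir n → ℝ} (hg : IsEnergy n s c g) (hh : IsEnergy n s c h)
    (hf : IsEnergy n s c f) :
    formB n s c (fun θ => g θ - h θ) f = formB n s c g f - formB n s c h f := by
  unfold formB
  rw [← mul_sub, ← integral_sub (hg.integrable_cross hf) (hh.integrable_cross hf)]
  congr 2
  funext p
  ring

lemma formB_sum_right {ι : Type*} (S : Finset ι) (a : ι → ℝ) {f : ι → Dir n → ℝ}
    (hg : IsEnergy n s c g) (hf : ∀ i, IsEnergy n s c (f i)) :
    formB n s c g (fun θ => ∑ i ∈ S, a i * f i θ) = ∑ i ∈ S, a i * formB n s c g (f i) := by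
  have e : ∀ p : Dir n × Dir n, kernel n s c p.1 p.2 * (g p.1 - g p.2) *
      ((∑ i ∈ S, a i * f i p.1) - ∑ i ∈ S, a i * f i p.2) =
      ∑ i ∈ S, a i * (kernel n s c p.1 p.2 * (g p.1 - g p.2) * (f i p.1 - f i p.2)) := by
    intro p
    rw [← Finset.sum_sub_distrib, Finset.mul_sum]
    exact Finset.sum_congr rfl fun i _ => by ring
  unfold formB
  simp only [e]
  rw [integral_finsetSum _ fun i _ => (hg.integrable_cross (hf i)).const_mul _, Finset.mul_sum]
  refine Finset.sum_congr rfl fun i _ => ?_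
  rw [integral_const_mul]
  ring

end IsEnergy

lemma formB_self_nonneg (n : ℕ) (s : ℝ) (c : ℝ≥0) (g : Dir n → ℝ) : 0 ≤ formB n s c g g := by
  refine mul_nonneg (by norm_num) (integral_nonneg fun p => ?_)
  change 0 ≤ kernel n s c p.1 p.2 * (g p.1 - g p.2) * (g p.1 - g p.2)
  rw [mul_assoc]
  exact mul_nonneg (kernel_nonneg n s c _ _) (mul_self_nonneg _)

lemma IsTest.isEnergy_slice (hn : 1 ≤ n) {s : ℝ} (hs : s < 1) (c : ℝ≥0) {φ : Pos n × Dir n → ℝ}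
    (hφ : IsTest φ) (x : Pos n) : IsEnergy n s c (fun θ => φ (x, θ)) := by
  have hc : Continuous (fun θ : Dir n => φ (x, θ)) := hφ.continuous.comp (by fun_prop)
  refine ⟨hc.measurable, hc.memLp_of_hasCompactSupport (.of_compactSpace _), ?_⟩
  obtain ⟨L, hL0, hL⟩ := hφ.exists_lipschitz
  have hk := measurable_kernel n s c
  have hm := hc.measurable
  refine ((integrable_kernel_mul_dist_sq hn hs c).const_mul (L ^ 2)).mono'
    (hk.mul (((hm.comp measurable_fst).sub (hm.comp measurable_snd)).pow_const 2)).aestronglyMeasurable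
    (Eventually.of_forall fun p => ?_)
  have hk := kernel_nonneg n s c p.1 p.2
  rw [Real.norm_eq_abs, abs_of_nonneg (mul_nonneg hk (sq_nonneg _)), mul_left_comm, ← mul_pow,
    ← sq_abs (φ _ - φ _)]
  exact mul_le_mul_of_nonneg_left (pow_le_pow_left₀ (abs_nonneg _) (hL _ _ _) 2) hk

lemma isEnergy_inner_pow (hn : 1 ≤ n) {s : ℝ} (hs : s < 1) (c : ℝ≥0) (η : Pos n) (k : ℕ) :
    IsEnergy n s c (fun θ => inner ℝ (θ : Pos n) η ^ k) := by
  -- The power is realized as the slice at `x = 0` of a test function whose cutoff equals `1` there.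
  let b : ContDiffBump (0 : Pos n) := ⟨1, 2, one_pos, one_lt_two⟩
  have h := (isTest_mul_inner_pow b.contDiff b.hasCompactSupport η k).isEnergy_slice hn hs c 0
  have hb : b 0 = 1 := b.one_of_mem_closedBall (by simp [b.rIn_pos.le])
  simpa only [hb, one_mul] using h

/-- A bounded zonal form between a function orthogonal to the polynomials of degree at most `k` in
`θ·η` and a power `(θ·η)^j`, `j ≤ k`, vanishes. -/
lemma integral_zonal_form_eq_zero (hn : 1 ≤ n) {κ : ℝ → ℝ} (hκ : Measurable κ) {M : ℝ}
    (hM : ∀ t, |κ t| ≤ M) {h : Dir n → ℝ} (hh : MemLp h 2 (surf n)) (η : Pos n)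
    {k : ℕ} (hort : ∀ j ≤ k, ∫ θ, h θ * inner ℝ (θ : Pos n) η ^ j ∂(surf n) = 0) {j : ℕ}
    (hj : j ≤ k) :
    ∫ p : Dir n × Dir n, κ (inner ℝ (p.2 : Pos n) (p.1 : Pos n)) * (h p.1 - h p.2) *
      (inner ℝ (p.1 : Pos n) η ^ j - inner ℝ (p.2 : Pos n) η ^ j) ∂((surf n).prod (surf n)) = 0 := by
  have hM0 : 0 ≤ M := (abs_nonneg _).trans (hM 0)
  have hh1 : Integrable h (surf n) := hh.integrable (by norm_num)
  have hin : Measurable (fun p : Dir n × Dir n => inner ℝ (p.2 : Pos n) (p.1 : Pos n)) :=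
    Continuous.measurable (by fun_prop)
  have hp1 : Measurable (fun p : Dir n × Dir n => inner ℝ (p.1 : Pos n) η) :=
    Continuous.measurable (by fun_prop)
  have hp2 : Measurable (fun p : Dir n × Dir n => inner ℝ (p.2 : Pos n) η) :=
    Continuous.measurable (by fun_prop)
  -- Boundedness of `κ` makes the four terms of the expanded product separately integrable. After
  -- integrating out the variable not carried by `h`, each is an integral of `h` against a
  -- polynomial in `θ·η` of degree at most `k`.
  have hQ : ∀ (Q : Polynomial ℝ), Q.natDegree ≤ k →
      ∫ θ, h θ * Q.eval (inner ℝ (θ : Pos n) η) ∂(surf n) = 0 := by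
    intro Q hQd
    have e : ∀ θ : Dir n, h θ * Q.eval (inner ℝ (θ : Pos n) η) =
        ∑ i ∈ Finset.range (k + 1), Q.coeff i * (h θ * inner ℝ (θ : Pos n) η ^ i) := by
      intro θ
      rw [Polynomial.eval_eq_sum_range' (Nat.lt_succ_of_le hQd), Finset.mul_sum]
      exact Finset.sum_congr rfl fun i _ => by ring
    simp only [e]
    rw [integral_finsetSum]
    · refine Finset.sum_eq_zero fun i hi => ?_
      rw [integral_const_mul, hort i (Nat.lt_succ_iff.1 (Finset.mem_range.1 hi)), mul_zero]
    · intro i _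
      refine (hh1.mul_bdd (c := ‖η‖ ^ i) ?_ (Eventually.of_forall fun θ => ?_)).const_mul _
      · exact ((measurable_inner_right η).pow_const i).aestronglyMeasurable
      · exact abs_inner_pow_le θ η i
  have hb : ∀ p : Dir n × Dir n, ∀ q : Dir n, ‖κ (inner ℝ (p.2 : Pos n) (p.1 : Pos n)) *
      inner ℝ (q : Pos n) η ^ j‖ ≤ M * ‖η‖ ^ j := fun p q => by
    rw [norm_mul]
    exact mul_le_mul (hM _) (abs_inner_pow_le q η j) (norm_nonneg _) hM0
  have i11 : Integrable (fun p : Dir n × Dir n => h p.1 *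
      (κ (inner ℝ (p.2 : Pos n) (p.1 : Pos n)) * inner ℝ (p.1 : Pos n) η ^ j))
      ((surf n).prod (surf n)) :=
    (hh1.comp_fst (surf n)).mul_bdd ((hκ.comp hin).mul (hp1.pow_const j)).aestronglyMeasurable
      (Eventually.of_forall fun p => hb p p.1)
  have i12 : Integrable (fun p : Dir n × Dir n => h p.1 *
      (κ (inner ℝ (p.2 : Pos n) (p.1 : Pos n)) * inner ℝ (p.2 : Pos n) η ^ j))
      ((surf n).prod (surf n)) :=
    (hh1.comp_fst (surf n)).mul_bdd ((hκ.comp hin).mul (hp2.pow_const j)).aestronglyMeasurable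
      (Eventually.of_forall fun p => hb p p.2)
  have i21 : Integrable (fun p : Dir n × Dir n => h p.2 *
      (κ (inner ℝ (p.2 : Pos n) (p.1 : Pos n)) * inner ℝ (p.1 : Pos n) η ^ j))
      ((surf n).prod (surf n)) :=
    (hh1.comp_snd (surf n)).mul_bdd ((hκ.comp hin).mul (hp1.pow_const j)).aestronglyMeasurable
      (Eventually.of_forall fun p => hb p p.1)
  have i22 : Integrable (fun p : Dir n × Dir n => h p.2 *
      (κ (inner ℝ (p.2 : Pos n) (p.1 : Pos n)) * inner ℝ (p.2 : Pos n) η ^ j))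
      ((surf n).prod (surf n)) :=
    (hh1.comp_snd (surf n)).mul_bdd ((hκ.comp hin).mul (hp2.pow_const j)).aestronglyMeasurable
      (Eventually.of_forall fun p => hb p p.2)
  obtain ⟨Q, hQd, hQe⟩ := exists_zonal_eq_eval hn hκ hM j η
  -- Degree zero of the invariance says that the total mass of `κ(θ·θ')` in `θ'` does not depend on
  -- `θ`.
  obtain ⟨Q₀, hQd0, hQe0⟩ := exists_zonal_eq_eval hn hκ hM 0 η
  have hQ0 : ∀ θ : Dir n, zonal κ 0 θ η = Q₀.coeff 0 := fun θ => by
    rw [hQe0, Polynomial.eq_C_of_natDegree_le_zero hQd0]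
    simp
  have z21 : ∫ p : Dir n × Dir n, h p.2 * (κ (inner ℝ (p.2 : Pos n) (p.1 : Pos n)) *
      inner ℝ (p.1 : Pos n) η ^ j) ∂((surf n).prod (surf n)) = 0 := by
    rw [integral_prod_symm _ i21, ← hQ Q (hQd.trans hj)]
    refine integral_congr_ae (Eventually.of_forall fun θ => ?_)
    simp only
    rw [integral_const_mul, ← hQe]
    rfl
  have z22 : ∫ p : Dir n × Dir n, h p.2 * (κ (inner ℝ (p.2 : Pos n) (p.1 : Pos n)) *
      inner ℝ (p.2 : Pos n) η ^ j) ∂((surf n).prod (surf n)) = 0 := by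
    have e : ∀ θ : Dir n, ∫ θ' : Dir n, h θ * (κ (inner ℝ (θ : Pos n) (θ' : Pos n)) *
        inner ℝ (θ : Pos n) η ^ j) ∂(surf n) =
        Q₀.coeff 0 * (h θ * inner ℝ (θ : Pos n) η ^ j) := fun θ => by
      rw [integral_const_mul, integral_mul_const, ← hQ0 θ]
      unfold zonal
      simp only [pow_zero, mul_one]
      ring
    rw [integral_prod_symm _ i22]
    simp only [e]
    rw [integral_const_mul, hort j hj, mul_zero]
  have z12 : ∫ p : Dir n × Dir n, h p.1 * (κ (inner ℝ (p.2 : Pos n) (p.1 : Pos n)) *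
      inner ℝ (p.2 : Pos n) η ^ j) ∂((surf n).prod (surf n)) = 0 := by
    rw [← z21, ← integral_prod_swap]
    simp only [Prod.fst_swap, Prod.snd_swap, real_inner_comm]
  have z11 : ∫ p : Dir n × Dir n, h p.1 * (κ (inner ℝ (p.2 : Pos n) (p.1 : Pos n)) *
      inner ℝ (p.1 : Pos n) η ^ j) ∂((surf n).prod (surf n)) = 0 := by
    rw [← z22, ← integral_prod_swap]
    simp only [Prod.fst_swap, Prod.snd_swap, real_inner_comm]
  have e : ∀ p : Dir n × Dir n, κ (inner ℝ (p.2 : Pos n) (p.1 : Pos n)) * (h p.1 - h p.2) *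
      (inner ℝ (p.1 : Pos n) η ^ j - inner ℝ (p.2 : Pos n) η ^ j) =
      (h p.1 * (κ (inner ℝ (p.2 : Pos n) (p.1 : Pos n)) * inner ℝ (p.1 : Pos n) η ^ j) -
      h p.1 * (κ (inner ℝ (p.2 : Pos n) (p.1 : Pos n)) * inner ℝ (p.2 : Pos n) η ^ j)) -
      (h p.2 * (κ (inner ℝ (p.2 : Pos n) (p.1 : Pos n)) * inner ℝ (p.1 : Pos n) η ^ j) -
      h p.2 * (κ (inner ℝ (p.2 : Pos n) (p.1 : Pos n)) * inner ℝ (p.2 : Pos n) η ^ j)) := by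
    intro p
    ring
  simp only [e]
  refine (integral_sub (i11.sub i12) (i21.sub i22)).trans ?_
  rw [integral_sub' i11 i12, integral_sub' i21 i22, z11, z12, z21, z22]
  simp

/-- The expansion into four terms needs a bounded kernel, so it is applied to the truncations `min K
m`. Dominated convergence, with the integrable product of increments as majorant, passes to `K`. -/
lemma formB_inner_pow_eq_zero (hn : 1 ≤ n) {s : ℝ} (hs : s < 1) {c : ℝ≥0} {h : Dir n → ℝ}
    (hh : IsEnergy n s c h) (η : Pos n) {k : ℕ}
    (hort : ∀ j ≤ k, ∫ θ, h θ * inner ℝ (θ : Pos n) η ^ j ∂(surf n) = 0) {j : ℕ} (hj : j ≤ k) :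
    formB n s c h (fun θ => inner ℝ (θ : Pos n) η ^ j) = 0 := by
  -- The outer `max 0` makes the truncation bounded for all real `t`; for `t > 1` the real power of
  -- a negative base has no definite sign. On the sphere it changes nothing.
  set κ : ℕ → ℝ → ℝ := fun m t =>
    max 0 (min ((c : ℝ) * (2 : ℝ) ^ (s - (n : ℝ) / 2) / (1 - t) ^ ((n : ℝ) / 2 + s)) m) with hκ
  have hκm : ∀ m, Measurable (κ m) := fun m => by
    have : Measurable (fun t : ℝ => (c : ℝ) * (2 : ℝ) ^ (s - (n : ℝ) / 2) /
        (1 - t) ^ ((n : ℝ) / 2 + s)) :=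
      ((measurable_const.sub measurable_id).pow_const _).const_div _
    exact measurable_const.max (this.min measurable_const)
  have hκb : ∀ m t, |κ m t| ≤ m := fun m t => by
    rw [abs_of_nonneg (le_max_left _ _)]
    exact max_le (Nat.cast_nonneg m) (min_le_right _ _)
  have hκk : ∀ m (p : Dir n × Dir n), κ m (inner ℝ (p.2 : Pos n) (p.1 : Pos n)) =
      min (kernel n s c p.1 p.2) m := fun m p =>
    max_eq_right (le_min (kernel_nonneg n s c p.1 p.2) (Nat.cast_nonneg m))
  have hp := isEnergy_inner_pow hn hs c η j
  have hcross := hh.integrable_cross hp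
  have hmh := hh.measurable
  have hmk := measurable_kernel n s c
  have hmp := hp.measurable
  have hlim : Tendsto (fun m : ℕ => ∫ p : Dir n × Dir n, min (kernel n s c p.1 p.2) m *
      (h p.1 - h p.2) * (inner ℝ (p.1 : Pos n) η ^ j - inner ℝ (p.2 : Pos n) η ^ j)
      ∂((surf n).prod (surf n))) atTop (𝓝 (∫ p : Dir n × Dir n, kernel n s c p.1 p.2 *
      (h p.1 - h p.2) * (inner ℝ (p.1 : Pos n) η ^ j - inner ℝ (p.2 : Pos n) η ^ j)
      ∂((surf n).prod (surf n)))) := by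
    refine tendsto_integral_of_dominated_convergence _ (fun m => ?_) hcross.norm (fun m => ?_) ?_
    · have h1 : Measurable (fun p : Dir n × Dir n => (inner ℝ (p.1 : Pos n) η : ℝ) ^ j) :=
        hmp.comp measurable_fst
      have h2 : Measurable (fun p : Dir n × Dir n => (inner ℝ (p.2 : Pos n) η : ℝ) ^ j) :=
        hmp.comp measurable_snd
      exact (((hmk.min measurable_const).mul ((hmh.comp measurable_fst).sub
        (hmh.comp measurable_snd))).mul (h1.sub h2)).aestronglyMeasurable
    · refine Eventually.of_forall fun p => ?_
      have hK := kernel_nonneg n s c p.1 p.2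
      simp only [norm_mul, Real.norm_eq_abs]
      gcongr
      exact min_le_left _ _
    · refine Eventually.of_forall fun p => ?_
      obtain ⟨N, hN⟩ := exists_nat_ge (kernel n s c p.1 p.2)
      refine tendsto_const_nhds.congr' ?_
      filter_upwards [eventually_ge_atTop N] with m hm
      rw [min_eq_left (hN.trans (Nat.cast_le.2 hm))]
  have hzero : ∀ m : ℕ, ∫ p : Dir n × Dir n, min (kernel n s c p.1 p.2) m *
      (h p.1 - h p.2) * (inner ℝ (p.1 : Pos n) η ^ j - inner ℝ (p.2 : Pos n) η ^ j)
      ∂((surf n).prod (surf n)) = 0 := fun m => by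
    have := integral_zonal_form_eq_zero hn (hκm m) (hκb m) hh.memLp η hort hj
    simpa only [hκk] using this
  simp only [hzero] at hlim
  exact mul_eq_zero_of_right _ (tendsto_nhds_unique hlim tendsto_const_nhds)

/-- A function of finite energy which annihilates the powers of `θ·η` in the form
`α ⟨·,·⟩ + β 𝓑` is orthogonal to them in `L²`. -/
lemma integral_mul_inner_pow_eq_zero (hn : 1 ≤ n) {s : ℝ} (hs : s < 1) {c : ℝ≥0} {g : Dir n → ℝ}
    (hg : IsEnergy n s c g) (η : Pos n) {α β : ℝ} (hα : 0 < α) (hβ : 0 ≤ β)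
    (h : ∀ j, α * ∫ θ, g θ * inner ℝ (θ : Pos n) η ^ j ∂(surf n) +
      β * formB n s c g (fun θ => inner ℝ (θ : Pos n) η ^ j) = 0) (k : ℕ) :
    ∫ θ, g θ * inner ℝ (θ : Pos n) η ^ k ∂(surf n) = 0 := by
  have hp := isEnergy_inner_pow hn hs c η
  let e : Fin (k + 1) → Lp ℝ 2 (surf n) := fun j => (hp j).memLp.toLp _
  let W : Submodule ℝ (Lp ℝ 2 (surf n)) := Submodule.span ℝ (range e)
  have hWfin : FiniteDimensional ℝ W := FiniteDimensional.span_of_finite ℝ (finite_range e)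
  set G : Lp ℝ 2 (surf n) := hg.memLp.toLp _ with hG
  -- `P` is the `L²` projection of `g` onto the polynomials in `θ·η` of degree at most `k`, written
  -- with explicit coefficients so that it is defined pointwise and has finite energy. The powers
  -- may be linearly dependent; uniqueness of `a` is not needed.
  obtain ⟨a, ha⟩ := (Submodule.mem_span_range_iff_exists_fun ℝ).1 (W.starProjection_apply_mem G)
  set P : Dir n → ℝ := fun θ => ∑ j : Fin (k + 1), a j * inner ℝ (θ : Pos n) η ^ (j : ℕ) with hP
  have hPE : IsEnergy n s c P := IsEnergy.sum _ fun j _ => (hp j).const_mul (a j)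
  have hPae : (W.starProjection G : Lp ℝ 2 (surf n)) =ᵐ[surf n] P := by
    rw [← ha]
    have h1 : ∀ j : Fin (k + 1), (a j • e j : Lp ℝ 2 (surf n)) =ᵐ[surf n]
        fun θ => a j * inner ℝ (θ : Pos n) η ^ (j : ℕ) := fun j => by
      filter_upwards [Lp.coeFn_smul (a j) (e j), (hp j).memLp.coeFn_toLp] with θ h1 h2
      rw [h1, Pi.smul_apply, h2, smul_eq_mul]
    filter_upwards [Lp.coeFn_finsetSum Finset.univ (fun j => a j • e j), ae_all_iff.2 h1]
      with θ h2 h3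
    rw [h2, Finset.sum_apply]
    exact Finset.sum_congr rfl fun j _ => h3 j
  have hgP := hg.sub hPE
  have hort : ∀ j ≤ k, ∫ θ, (g θ - P θ) * inner ℝ (θ : Pos n) η ^ j ∂(surf n) = 0 := by
    intro j hj
    have h1 : inner ℝ (G - W.starProjection G) (e ⟨j, Nat.lt_succ_of_le hj⟩) = 0 :=
      W.starProjection_inner_eq_zero G _ (Submodule.subset_span ⟨_, rfl⟩)
    rw [L2.inner_def] at h1
    rw [← h1]
    apply integral_congr_ae
    filter_upwards [Lp.coeFn_sub G (W.starProjection G), hg.memLp.coeFn_toLp, hPae,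
      (hp j).memLp.coeFn_toLp] with θ h2 h3 h4 h5
    simp only [RCLike.inner_apply, conj_trivial]
    rw [h2, Pi.sub_apply, h3, h4]
    change _ = (hp j).memLp.toLp _ θ * _
    rw [h5, mul_comm]
  -- The decoupling: `g - P` is orthogonal to these powers in `L²`, hence also with respect to `𝓑`.
  -- So `P` inherits the hypothesis on `g`, and pairing it with `P` itself forces `P = 0`.
  have hBg : ∀ j ≤ k, formB n s c g (fun θ => inner ℝ (θ : Pos n) η ^ j) =
      formB n s c P (fun θ => inner ℝ (θ : Pos n) η ^ j) := fun j hj => by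
    have h1 := formB_inner_pow_eq_zero hn hs hgP η hort hj
    rw [hg.formB_sub_left hPE (hp j)] at h1
    linarith
  have hIg : ∀ j ≤ k, ∫ θ, g θ * inner ℝ (θ : Pos n) η ^ j ∂(surf n) =
      ∫ θ, P θ * inner ℝ (θ : Pos n) η ^ j ∂(surf n) := fun j hj => by
    have h1 := hort j hj
    simp only [sub_mul] at h1
    rw [integral_sub (hg.integrable_mul (hp j)) (hPE.integrable_mul (hp j))] at h1
    linarith
  have hPP : ∫ θ, P θ * P θ ∂(surf n) =
      ∑ j : Fin (k + 1), a j * ∫ θ, P θ * inner ℝ (θ : Pos n) η ^ (j : ℕ) ∂(surf n) := by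
    have h1 : ∀ θ : Dir n, P θ * P θ =
        ∑ j : Fin (k + 1), a j * (P θ * inner ℝ (θ : Pos n) η ^ (j : ℕ)) := fun θ => by
      conv_lhs => rw [hP]
      simp only [Finset.mul_sum]
      exact Finset.sum_congr rfl fun j _ => by ring
    simp only [h1]
    rw [integral_finsetSum _ fun (j : Fin (k + 1)) _ => (hPE.integrable_mul (hp j)).const_mul (a j)]
    exact Finset.sum_congr rfl fun j _ => integral_const_mul _ _
  have hBPP : formB n s c P P =
      ∑ j : Fin (k + 1), a j * formB n s c P (fun θ => inner ℝ (θ : Pos n) η ^ (j : ℕ)) :=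
    IsEnergy.formB_sum_right _ _ hPE fun j : Fin (k + 1) => hp j
  have hsum : α * ∫ θ, P θ * P θ ∂(surf n) + β * formB n s c P P = 0 := by
    rw [hPP, hBPP, Finset.mul_sum, Finset.mul_sum, ← Finset.sum_add_distrib]
    refine Finset.sum_eq_zero fun j _ => ?_
    have hj : (j : ℕ) ≤ k := Nat.lt_succ_iff.1 j.2
    have h1 := h j
    rw [hIg j hj, hBg j hj] at h1
    linear_combination a j * h1
  have hP0 : ∫ θ, P θ * P θ ∂(surf n) = 0 := by
    have h1 : 0 ≤ ∫ θ, P θ * P θ ∂(surf n) := integral_nonneg fun θ => mul_self_nonneg _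
    have h2 := mul_nonneg hβ (formB_self_nonneg n s c P)
    have h3 := mul_nonneg hα.le h1
    have h4 : α * ∫ θ, P θ * P θ ∂(surf n) = 0 := by linarith
    exact (mul_eq_zero.1 h4).resolve_left hα.ne'
  rw [integral_eq_zero_iff_of_nonneg (fun θ => mul_self_nonneg _) (hPE.integrable_mul hPE)] at hP0
  rw [hIg k le_rfl]
  refine integral_eq_zero_of_ae ?_
  filter_upwards [hP0] with θ hθ
  have : P θ = 0 := mul_self_eq_zero.1 hθ
  rw [this, zero_mul, Pi.zero_apply]

end

section

open Filter Topology Set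

variable {n : ℕ}

/-! ### Density of the test functions -/

/-- Expand the exponential and integrate termwise; the `L¹` norms of the terms are dominated by
`‖η‖^k / k!` times that of `g`. -/
lemma integral_mul_exp_eq_zero {g : Dir n → ℝ} (hg : Integrable g (surf n))
    (h : ∀ (η : Pos n) (k : ℕ), ∫ θ, g θ * inner ℝ (θ : Pos n) η ^ k ∂(surf n) = 0) (η : Pos n) :
    ∫ θ : Dir n, (g θ : ℂ) * Complex.exp (inner ℝ (θ : Pos n) η * Complex.I) ∂(surf n) = 0 := by
  let F : ℕ → Dir n → ℂ := fun k θ =>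
    (Complex.I ^ k / (k.factorial : ℂ)) * ((g θ * inner ℝ (θ : Pos n) η ^ k : ℝ) : ℂ)
  have hi : ∀ k, Integrable (fun θ : Dir n => g θ * inner ℝ (θ : Pos n) η ^ k) (surf n) := fun k =>
    hg.mul_bdd (c := ‖η‖ ^ k) ((measurable_inner_right η).pow_const k).aestronglyMeasurable
      (Eventually.of_forall fun θ => abs_inner_pow_le θ η k)
  have hF : ∀ k, Integrable (F k) (surf n) := fun k => (hi k).ofReal.const_mul _
  have hF0 : ∀ k, ∫ θ, F k θ ∂(surf n) = 0 := fun k => by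
    simp only [F]
    rw [integral_const_mul, integral_complex_ofReal, h η k]
    simp
  have hFn : ∀ k, ∫ θ, ‖F k θ‖ ∂(surf n) ≤ ‖η‖ ^ k / k.factorial * ∫ θ, |g θ| ∂(surf n) := by
    intro k
    rw [← integral_const_mul]
    refine integral_mono (hF k).norm (hg.abs.const_mul _) fun θ => ?_
    simp only [F, norm_mul, norm_div, norm_pow, Complex.norm_I, one_pow, Complex.norm_natCast,
      Complex.norm_real, Real.norm_eq_abs]
    have h1 := abs_inner_pow_le θ η k
    rw [abs_pow] at h1
    calc 1 / (k.factorial : ℝ) * (|g θ| * |inner ℝ (θ : Pos n) η| ^ k)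
        ≤ 1 / (k.factorial : ℝ) * (|g θ| * ‖η‖ ^ k) := by gcongr
      _ = ‖η‖ ^ k / k.factorial * |g θ| := by ring
  have hsum : Summable fun k => ∫ θ, ‖F k θ‖ ∂(surf n) :=
    Summable.of_nonneg_of_le (fun k => integral_nonneg fun θ => norm_nonneg _) hFn
      ((Real.summable_pow_div_factorial ‖η‖).mul_right _)
  have h2 := hasSum_integral_of_summable_integral_norm hF hsum
  simp only [hF0] at h2
  have h3 := h2.unique hasSum_zero
  rw [← h3]
  refine integral_congr_ae (Eventually.of_forall fun θ => ?_)
  have h4 := (NormedSpace.expSeries_div_hasSum_exp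
    ((inner ℝ (θ : Pos n) η : ℂ) * Complex.I)).mul_left (g θ : ℂ)
  rw [← Complex.exp_eq_exp_ℂ] at h4
  simp only
  rw [← h4.tsum_eq]
  refine tsum_congr fun k => ?_
  simp only [F, mul_pow]
  push_cast
  ring

/-- An integrable function on the sphere all of whose moments vanish is zero. -/
lemma ae_eq_zero_of_moments {g : Dir n → ℝ} (hgm : Measurable g) (hg : Integrable g (surf n))
    (h : ∀ (η : Pos n) (k : ℕ), ∫ θ, g θ * inner ℝ (θ : Pos n) η ^ k ∂(surf n) = 0) :
    g =ᵐ[surf n] 0 := by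
  have he : MeasurableEmbedding (Subtype.val : Dir n → Pos n) :=
    MeasurableEmbedding.subtype_coe Metric.isClosed_sphere.measurableSet
  -- `ENNReal.ofReal` keeps only the positive part, so `μ g` and `μ (-g)` are the positive and
  -- negative parts of `g dθ`, pushed forward to `ℝ^d`. Vanishing of the Fourier integrals of `g`
  -- says that their characteristic functions agree.
  set μ : (Dir n → ℝ) → Measure (Pos n) := fun f =>
    ((surf n).withDensity fun θ => ENNReal.ofReal (f θ)).map Subtype.val with hμ
  have hfin : ∀ f, Integrable f (surf n) → IsFiniteMeasure (μ f) := fun f hf => by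
    have := isFiniteMeasure_withDensity_ofReal hf.2
    exact Measure.isFiniteMeasure_map _ _
  have hE : ∀ η : Pos n, Continuous fun θ : Dir n =>
      Complex.exp (inner ℝ (θ : Pos n) η * Complex.I) := fun η => by fun_prop
  have hchar : ∀ f, Measurable f → ∀ η, charFun (μ f) η = ∫ θ : Dir n, ((max (f θ) 0 : ℝ) : ℂ) *
      Complex.exp (inner ℝ (θ : Pos n) η * Complex.I) ∂(surf n) := fun f hf η => by
    rw [charFun_apply, he.integral_map, integral_withDensity_eq_integral_toReal_smul
      hf.ennreal_ofReal (Eventually.of_forall fun _ => ENNReal.ofReal_lt_top)]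
    refine integral_congr_ae (Eventually.of_forall fun θ => ?_)
    simp only [ENNReal.toReal_ofReal', Complex.real_smul]
  have hint : ∀ f : Dir n → ℝ, Integrable f (surf n) → ∀ η : Pos n, Integrable (fun θ : Dir n =>
      (f θ : ℂ) * Complex.exp (inner ℝ (θ : Pos n) η * Complex.I)) (surf n) := fun f hf η =>
    hf.ofReal.mul_bdd (c := 1) (hE η).aestronglyMeasurable
      (Eventually.of_forall fun θ => (Complex.norm_exp_ofReal_mul_I _).le)
  have := hfin g hg
  have := hfin (fun θ => -g θ) hg.neg
  have hEq : μ g = μ fun θ => -g θ := by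
    apply Measure.ext_of_charFun
    funext η
    rw [hchar g hgm, hchar (fun θ => -g θ) hgm.neg, ← sub_eq_zero, ← integral_sub
      (hint _ hg.pos_part η) (hint _ hg.neg_part η), ← integral_mul_exp_eq_zero hg h η]
    refine integral_congr_ae (Eventually.of_forall fun θ => ?_)
    simp only
    rw [← sub_mul, ← Complex.ofReal_sub]
    congr 2
    rcases le_total (g θ) 0 with h0 | h0
    · rw [max_eq_right h0, max_eq_left (by linarith)]; ring
    · rw [max_eq_left h0, max_eq_right (by linarith)]; ring
  have h1 : (surf n).withDensity (fun θ => ENNReal.ofReal (g θ)) =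
      (surf n).withDensity fun θ => ENNReal.ofReal (-g θ) := by
    rw [← he.comap_map ((surf n).withDensity fun θ => ENNReal.ofReal (g θ)),
      ← he.comap_map ((surf n).withDensity fun θ => ENNReal.ofReal (-g θ))]
    exact congrArg (Measure.comap Subtype.val) hEq
  have hgm' : Measurable fun θ => -g θ := hgm.neg
  filter_upwards [(withDensity_eq_iff_of_sigmaFinite hgm.ennreal_ofReal.aemeasurable
    hgm'.ennreal_ofReal.aemeasurable).1 h1] with θ hθ
  change g θ = 0
  rcases le_total (g θ) 0 with h0 | h0
  · rw [ENNReal.ofReal_of_nonpos h0, eq_comm, ENNReal.ofReal_eq_zero] at hθ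
    exact le_antisymm h0 (by linarith)
  · rw [ENNReal.ofReal_of_nonpos (by linarith : -g θ ≤ 0), ENNReal.ofReal_eq_zero] at hθ
    exact le_antisymm hθ h0

variable {s : ℝ} {c ε : ℝ≥0}

lemma HSpace.isEnergy_slice (w : HSpace n s c ε) :
    ∀ᵐ x : Pos n, IsEnergy n s c (fun θ => w.toL2 (x, θ)) := by
  filter_upwards [(integrable_sq_incr w).prod_right_ae,
    (integrable_mul w.toL2 w.toL2).prod_right_ae] with x h1 h2
  refine ⟨measurable_slice _ _, ?_, h1⟩
  rw [memLp_two_iff_integrable_sq (measurable_slice _ _).aestronglyMeasurable]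
  simpa only [pow_two] using h2

section

variable [Fact (1 ≤ n)] [Fact (s < 1)]

/-- The form `(1 + ε^{2s}) ⟨·,·⟩ + ε^{2s} 𝓑` of a slice of `w` and the function `(θ·η)^k`. -/
def sliceForm (w : HSpace n s c ε) (η : Pos n) (k : ℕ) (x : Pos n) : ℝ :=
  (1 + (ε : ℝ) ^ (2 * s)) * ∫ θ, w.toL2 (x, θ) * inner ℝ (θ : Pos n) η ^ k ∂(surf n) +
    (ε : ℝ) ^ (2 * s) *
      formB n s c (fun θ => w.toL2 (x, θ)) (fun θ => inner ℝ (θ : Pos n) η ^ k)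

/-- Fubini for the inner product with `χ(x) (θ·η)^k`. The integrability clause also yields local
integrability of `sliceForm`, by taking `χ = 1` near a point. -/
lemma integral_mul_sliceForm (w : HSpace n s c ε) (η : Pos n) (k : ℕ) {χ : Pos n → ℝ}
    (hχ : ContDiff ℝ ∞ χ) (hχc : HasCompactSupport χ) :
    Integrable (fun x => χ x * sliceForm w η k x) ∧ ∫ x, χ x * sliceForm w η k x =
      inner ℝ w ((isTest_mul_inner_pow hχ hχc η k).toH : HSpace n s c ε) := by
  set h : HSpace n s c ε := (isTest_mul_inner_pow hχ hχc η k).toH with hh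
  have hae := slice_ae (f := h.toL2) (isTest_mul_inner_pow hχ hχc η k).coeFn_toH
  have e1 : (fun x => ∫ θ, w.toL2 (x, θ) * h.toL2 (x, θ) ∂(surf n)) =ᵐ[volume]
      fun x => χ x * ∫ θ, w.toL2 (x, θ) * inner ℝ (θ : Pos n) η ^ k ∂(surf n) := by
    filter_upwards [hae] with x hx
    rw [← integral_const_mul]
    refine integral_congr_ae ?_
    filter_upwards [hx.1] with θ hθ
    rw [hθ]
    ring
  have e2 : (fun x => innerHB n s c (fun θ => w.toL2 (x, θ)) (fun θ => h.toL2 (x, θ))) =ᵐ[volume]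
      fun x => χ x * (formB n s c (fun θ => w.toL2 (x, θ)) (fun θ => inner ℝ (θ : Pos n) η ^ k) +
        ∫ θ, w.toL2 (x, θ) * inner ℝ (θ : Pos n) η ^ k ∂(surf n)) := by
    filter_upwards [hae, e1] with x hx hx1
    rw [innerHB, hx1, mul_add]
    congr 1
    unfold formB
    rw [mul_left_comm, ← integral_const_mul (χ x)]
    congr 1
    refine integral_congr_ae ?_
    filter_upwards [hx.2] with p hp
    rw [hp.1, hp.2]
    ring
  have i1 := (integrable_mul w.toL2 h.toL2).integral_prod_left
  have i2 := integrable_innerHB w h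
  have hsum : ∀ᵐ x : Pos n, (∫ θ, w.toL2 (x, θ) * h.toL2 (x, θ) ∂(surf n)) + (ε : ℝ) ^ (2 * s) *
      innerHB n s c (fun θ => w.toL2 (x, θ)) (fun θ => h.toL2 (x, θ)) =
      χ x * sliceForm w η k x := by
    filter_upwards [e1, e2] with x h1 h2
    rw [h1, h2, sliceForm]
    ring
  refine ⟨(i1.add (i2.const_mul ((ε : ℝ) ^ (2 * s)))).congr hsum, ?_⟩
  rw [← integral_congr_ae hsum, integral_add i1 (i2.const_mul _), integral_const_mul,
    ← integral_prod _ (integrable_mul w.toL2 h.toL2), HSpace.inner_eq, innerH]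

lemma sliceForm_ae_eq_zero {w : HSpace n s c ε}
    (hw : ∀ (φ : Pos n × Dir n → ℝ) (hφ : IsTest φ), inner ℝ w (hφ.toH : HSpace n s c ε) = 0)
    (η : Pos n) (k : ℕ) : ∀ᵐ x, sliceForm w η k x = 0 := by
  apply ae_eq_zero_of_integral_contDiff_smul_eq_zero
  · intro x
    let b : ContDiffBump x := ⟨1, 2, one_pos, one_lt_two⟩
    have h1 := (integral_mul_sliceForm w η k b.contDiff b.hasCompactSupport).1
    refine ⟨Metric.closedBall x 1, Metric.closedBall_mem_nhds x one_pos, ?_⟩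
    refine h1.integrableOn.congr_fun (fun y hy => ?_) Metric.isClosed_closedBall.measurableSet
    simp only
    rw [b.one_of_mem_closedBall hy, one_mul]
  · intro χ hχ hχc
    simp only [smul_eq_mul]
    rw [(integral_mul_sliceForm w η k hχ hχc).2, hw]

/-- The exceptional null set of `x` depends on `η`, so only a countable dense set of `η` is used at
first. On a good slice the vanishing of the form is converted into the vanishing of the `L²`
moments, which are continuous in `η` and therefore vanish for every `η`. -/
lemma HSpace.eq_zero_of_inner_test {w : HSpace n s c ε}
    (hw : ∀ (φ : Pos n × Dir n → ℝ) (hφ : IsTest φ), inner ℝ w (hφ.toH : HSpace n s c ε) = 0) :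
    w = 0 := by
  have h1 : ∀ᵐ x : Pos n, ∀ i k, sliceForm w (TopologicalSpace.denseSeq (Pos n) i) k x = 0 :=
    ae_all_iff.2 fun i => ae_all_iff.2 fun k => sliceForm_ae_eq_zero hw _ k
  have h2 : ∀ᵐ x : Pos n, ∀ᵐ θ ∂(surf n), w.toL2 (x, θ) = 0 := by
    filter_upwards [h1, w.isEnergy_slice] with x hx hxE
    have hint : Integrable (fun θ => w.toL2 (x, θ)) (surf n) :=
      hxE.memLp.integrable (by norm_num)
    refine ae_eq_zero_of_moments hxE.measurable hint fun η k => ?_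
    have hcont : Continuous fun η : Pos n =>
        ∫ θ : Dir n, w.toL2 (x, θ) * inner ℝ (θ : Pos n) η ^ k ∂(surf n) := by
      rw [continuous_iff_continuousAt]
      intro η₀
      refine continuousAt_of_dominated
        (bound := fun θ => |w.toL2 (x, θ)| * (‖η₀‖ + 1) ^ k) ?_ ?_ (hint.abs.mul_const _) ?_
      · exact Eventually.of_forall fun η => (hxE.measurable.mul
          ((measurable_inner_right η).pow_const k)).aestronglyMeasurable
      · filter_upwards [Metric.ball_mem_nhds η₀ one_pos] with η hη
        refine Eventually.of_forall fun θ => ?_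
        rw [norm_mul, Real.norm_eq_abs]
        refine mul_le_mul_of_nonneg_left ((abs_inner_pow_le θ η k).trans ?_) (abs_nonneg _)
        refine pow_le_pow_left₀ (norm_nonneg _) ?_ k
        have := norm_le_norm_add_norm_sub' η η₀
        rw [Metric.mem_ball, dist_eq_norm] at hη
        linarith
      · refine Eventually.of_forall fun θ => ?_
        fun_prop
    have hzero : (fun η : Pos n =>
        ∫ θ : Dir n, w.toL2 (x, θ) * inner ℝ (θ : Pos n) η ^ k ∂(surf n)) = fun _ => 0 := by
      refine hcont.ext_on (TopologicalSpace.denseRange_denseSeq (Pos n)) continuous_const ?_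
      rintro _ ⟨i, rfl⟩
      exact integral_mul_inner_pow_eq_zero Fact.out Fact.out hxE _
        (by have := HSpace.weight_nonneg ε s; linarith) (HSpace.weight_nonneg ε s) (hx i) k
    exact congrFun hzero η
  apply HSpace.ext_ae
  have h3 : ∀ᵐ p ∂(phase n), w.toL2 p = 0 := by
    rw [Measure.ae_prod_iff_ae_ae]
    · exact h2
    · exact (Lp.stronglyMeasurable w.toL2).measurable (measurableSet_singleton 0)
  filter_upwards [h3, Lp.coeFn_zero ℝ 2 (phase n)] with p hp hp0
  rw [hp]
  exact hp0.symm

/-- Two functionals on `𝓗^s_ε` which agree on the test functions are equal. -/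
lemma HSpace.dual_ext [Fact (0 < ε)] {ℓ ℓ' : StrongDual ℝ (HSpace n s c ε)}
    (h : ∀ φ : testSpace n, ℓ (testToH n s c ε φ) = ℓ' (testToH n s c ε φ)) : ℓ = ℓ' := by
  rw [← sub_eq_zero]
  set w := (InnerProductSpace.toDual ℝ (HSpace n s c ε)).symm (ℓ - ℓ') with hw
  have h0 : w = 0 := by
    apply HSpace.eq_zero_of_inner_test
    intro φ hφ
    rw [hw, InnerProductSpace.toDual_symm_apply, sub_apply, sub_eq_zero]
    exact h ⟨φ, hφ⟩
  rwa [hw, LinearIsometryEquiv.map_eq_zero_iff] at h0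

end

end

section

open Filter Topology Set

variable {n : ℕ}

/-! ### Translations in the position variable -/

section

variable {α : Type*}

/-- The translation `(x, a) ↦ (x - y, a)`. -/
def shift (y : Pos n) (q : Pos n × α) : Pos n × α := (q.1 - y, q.2)

variable [MeasurableSpace α] {μ : Measure α} [SFinite μ]

lemma measurePreserving_shift (μ : Measure α) [SFinite μ] (y : Pos n) :
    MeasurePreserving (shift y) ((volume : Measure (Pos n)).prod μ)
      ((volume : Measure (Pos n)).prod μ) :=
  (measurePreserving_sub_right volume y).prod (.id μ)

/-- Translation in the position variable as an isometry of `L²`. -/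
def lpShift (y : Pos n) : Lp ℝ 2 ((volume : Measure (Pos n)).prod μ) →ₗᵢ[ℝ]
    Lp ℝ 2 ((volume : Measure (Pos n)).prod μ) :=
  Lp.compMeasurePreservingₗᵢ ℝ (shift y) (measurePreserving_shift μ y)

lemma coeFn_lpShift (y : Pos n) (u : Lp ℝ 2 ((volume : Measure (Pos n)).prod μ)) :
    lpShift y u =ᵐ[(volume : Measure (Pos n)).prod μ] fun q => u (shift y q) :=
  Lp.coeFn_compMeasurePreserving u (measurePreserving_shift μ y)

lemma lpShift_lpShift_neg (y : Pos n) (u : Lp ℝ 2 ((volume : Measure (Pos n)).prod μ)) :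
    lpShift y (lpShift (-y) u) = u := by
  apply Lp.ext
  filter_upwards [coeFn_lpShift y (lpShift (-y) u),
    (measurePreserving_shift μ y).quasiMeasurePreserving.ae (coeFn_lpShift (-y) u)] with q h1 h2
  rw [h1, h2]
  simp [shift]

lemma inner_lpShift (y : Pos n) (u v : Lp ℝ 2 ((volume : Measure (Pos n)).prod μ)) :
    inner ℝ (lpShift y u) v = inner ℝ u (lpShift (-y) v) := by
  rw [← (lpShift y).inner_map_map u, lpShift_lpShift_neg]

lemma continuous_lpShift [TopologicalSpace α] [T2Space α] [SecondCountableTopology α]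
    [LocallyCompactSpace α] [BorelSpace α] [IsFiniteMeasureOnCompacts μ]
    (u : Lp ℝ 2 ((volume : Measure (Pos n)).prod μ)) :
    Continuous fun y : Pos n => lpShift y u := by
  let F : C(Pos n × (Pos n × α), Pos n × α) := ⟨fun z => shift z.1 z.2, by unfold shift; fun_prop⟩
  exact continuous_const.compMeasurePreservingLp F.curry.continuous
    (fun y => measurePreserving_shift μ y) (by simp)

end

variable {s : ℝ} {c ε : ℝ≥0}

namespace HSpace

/-- Translation in the position variable on `𝓗^s_ε`. -/
def translate (y : Pos n) : HSpace n s c ε →ₗ[ℝ] HSpace n s c ε where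
  toFun u := (⟨lpShift y u.toL2, by
    rw [mem_energySpace_iff, memLp_congr_ae (wincr_congr s c (coeFn_lpShift y u.toL2))]
    exact u.memLp_wincr.comp_measurePreserving (measurePreserving_shift _ y)⟩ : energySpace n s c)
  map_add' u v := toL2_injective (map_add (lpShift y) u.toL2 v.toL2)
  map_smul' a u := toL2_injective (map_smul (lpShift y) a u.toL2)

@[simp] lemma toL2_translate (y : Pos n) (u : HSpace n s c ε) :
    (translate y u).toL2 = lpShift y u.toL2 := rfl

lemma translate_zero (u : HSpace n s c ε) : translate 0 u = u := by
  apply ext_ae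
  filter_upwards [coeFn_lpShift 0 u.toL2] with q hq
  rw [toL2_translate, hq]
  simp [shift]

variable [Fact (0 < ε)]

lemma grad_translate (y : Pos n) (u : HSpace n s c ε) :
    grad n s c ε (translate y u) = lpShift y (grad n s c ε u) := by
  apply Lp.ext
  filter_upwards [coeFn_grad (translate y u), wincr_congr s c (coeFn_lpShift y u.toL2),
    coeFn_lpShift y (grad n s c ε u),
    (measurePreserving_shift _ y).quasiMeasurePreserving.ae (coeFn_grad u)] with q h1 h2 h3 h4
  rw [h1, h3, h4, toL2_translate, h2]
  rfl

lemma norm_translate (y : Pos n) (u : HSpace n s c ε) : ‖translate y u‖ = ‖u‖ := by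
  rw [← sq_eq_sq₀ (norm_nonneg _) (norm_nonneg _), norm_sq_eq_grad, norm_sq_eq_grad,
    grad_translate, toL2_translate, LinearIsometry.norm_map, LinearIsometry.norm_map]

lemma continuous_translate (u : HSpace n s c ε) : Continuous fun y : Pos n => translate y u := by
  rw [continuous_iff_continuousAt]
  intro y
  apply tendsto_of_tendsto_incl_grad
  · exact (continuous_lpShift u.toL2).continuousAt
  · simp only [grad_translate]
    exact (continuous_lpShift (grad n s c ε u)).continuousAt

lemma integrable_mul_translate {ρ : Pos n → ℝ} (hρ : Continuous ρ) (hρc : HasCompactSupport ρ)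
    (L : StrongDual ℝ (HSpace n s c ε)) (v : HSpace n s c ε) :
    Integrable fun y => ρ y * L (translate y v) :=
  (hρ.mul (L.continuous.comp (continuous_translate v))).integrable_of_hasCompactSupport
    hρc.mul_right

/-- The average of the translates of a functional with respect to a weight. -/
def average {ρ : Pos n → ℝ} (hρ : Continuous ρ) (hρc : HasCompactSupport ρ)
    (L : StrongDual ℝ (HSpace n s c ε)) : StrongDual ℝ (HSpace n s c ε) :=
  LinearMap.mkContinuous
    { toFun := fun v => ∫ y, ρ y * L (translate y v)
      map_add' := fun u v => by
        rw [← integral_add (integrable_mul_translate hρ hρc L u)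
          (integrable_mul_translate hρ hρc L v)]
        simp only [map_add, mul_add]
      map_smul' := fun a u => by
        rw [RingHom.id_apply, smul_eq_mul, ← integral_const_mul]
        simp only [map_smul, smul_eq_mul, mul_left_comm] }
    ((∫ y, ‖ρ y‖) * ‖L‖) fun v => by
      refine (norm_integral_le_integral_norm _).trans ?_
      rw [mul_assoc, ← integral_mul_const]
      refine integral_mono (integrable_mul_translate hρ hρc L v).norm
        ((hρ.integrable_of_hasCompactSupport hρc).norm.mul_const _) fun y => ?_
      simp only [norm_mul]
      gcongr
      exact (L.le_opNorm _).trans_eq (by rw [norm_translate])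

lemma average_apply {ρ : Pos n → ℝ} (hρ : Continuous ρ) (hρc : HasCompactSupport ρ)
    (L : StrongDual ℝ (HSpace n s c ε)) (v : HSpace n s c ε) :
    average hρ hρc L v = ∫ y, ρ y * L (translate y v) := rfl

end HSpace

/-! ### The energy identity for the transport derivative -/

/-- Bound the product by the sum of squares; the shear `(y, p) ↦ (y, shift y p)` preserves the
product measure. This justifies the exchange of integrals below. -/
lemma integrable_mul_shift {ρ : Pos n → ℝ} (hρ : Continuous ρ) (hρc : HasCompactSupport ρ)
    (u : L2 n) {g : Pos n × Dir n → ℝ} (hg : Continuous g) (hg2 : MemLp g 2 (phase n)) :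
    Integrable (fun q : Pos n × (Pos n × Dir n) => ρ q.1 * (u q.2 * g (shift q.1 q.2)))
      ((volume : Measure (Pos n)).prod (phase n)) := by
  have hsm : Continuous fun q : Pos n × (Pos n × Dir n) => shift q.1 q.2 := by
    unfold shift; fun_prop
  have hsp : MeasurePreserving (fun q : Pos n × (Pos n × Dir n) => (q.1, shift q.1 q.2))
      ((volume : Measure (Pos n)).prod (phase n)) ((volume : Measure (Pos n)).prod (phase n)) :=
    (MeasurePreserving.id volume).skew_product hsm.measurable
      (Eventually.of_forall fun y => (measurePreserving_shift (surf n) y).map_eq)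
  have hρi := (hρ.integrable_of_hasCompactSupport hρc).norm (μ := volume)
  have i1 := hρi.mul_prod (Lp.memLp u).integrable_sq
  have i2 := hsp.integrable_comp_of_integrable (hρi.mul_prod hg2.integrable_sq)
  refine (i1.add i2).mono' ?_ (Eventually.of_forall fun q => ?_)
  · refine (hρ.measurable.comp measurable_fst).aestronglyMeasurable.mul
      (Measurable.aestronglyMeasurable ?_)
    exact ((Lp.stronglyMeasurable u).measurable.comp measurable_snd).mul
      (hg.comp hsm).measurable
  · simp only [Pi.add_apply, Function.comp_apply, norm_mul, Real.norm_eq_abs]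
    rw [← mul_add]
    refine mul_le_mul_of_nonneg_left ?_ (abs_nonneg _)
    rw [← abs_mul, abs_le]
    constructor <;> nlinarith [sq_nonneg (u q.2 + g (shift q.1 q.2)),
      sq_nonneg (u q.2 - g (shift q.1 q.2)), sq_nonneg (u q.2), sq_nonneg (g (shift q.1 q.2))]

/-- The partial derivative `∂_i ρ`. -/
def pderiv (i : Fin (n + 1)) (ρ : Pos n → ℝ) (y : Pos n) : ℝ :=
  fderiv ℝ ρ y (EuclideanSpace.single i 1)

lemma continuous_pderiv (i : Fin (n + 1)) {ρ : Pos n → ℝ} (hρ : ContDiff ℝ ∞ ρ) :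
    Continuous (pderiv i ρ) :=
  (hρ.continuous_fderiv (by simp)).clm_apply continuous_const

lemma hasCompactSupport_pderiv (i : Fin (n + 1)) {ρ : Pos n → ℝ} (hρc : HasCompactSupport ρ) :
    HasCompactSupport (pderiv i ρ) := hρc.fderiv_apply (𝕜 := ℝ) _

lemma fderiv_apply_eq_sum (ρ : Pos n → ℝ) (y v : Pos n) :
    fderiv ℝ ρ y v = ∑ i, v i * pderiv i ρ y := by
  conv_lhs => rw [← (EuclideanSpace.basisFun (Fin (n + 1)) ℝ).sum_repr v]
  simp [pderiv]

lemma fderiv_comp_const_sub_apply {f : Pos n → ℝ} (hf : ContDiff ℝ ∞ f) (x y v : Pos n) :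
    fderiv ℝ (fun y => f (x - y)) y v = -fderiv ℝ f (x - y) v := by
  have h1 : HasFDerivAt f (fderiv ℝ f (x - y)) (x - y) :=
    (hf.differentiable (by simp) (x - y)).hasFDerivAt
  have h2 := h1.comp y ((hasFDerivAt_id y).const_sub x)
  have h3 : fderiv ℝ (fun y => f (x - y)) y = _ := h2.fderiv
  rw [h3]
  simp

lemma pderiv_neg_of_even (i : Fin (n + 1)) {ρ : Pos n → ℝ} (hρ : ContDiff ℝ ∞ ρ)
    (h : ∀ y, ρ (-y) = ρ y) (y : Pos n) : pderiv i ρ (-y) = -pderiv i ρ y := by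
  have h1 := fderiv_comp_const_sub_apply hρ 0 y (EuclideanSpace.single i 1)
  simp only [zero_sub, h] at h1
  rw [pderiv, pderiv, h1, neg_neg]

/-- The derivative of `φ(x - y, θ)` in `y` is minus that in `x`, and this sign cancels the one from
integrating by parts in `y`. The direction `θ` is split into coordinates so that each term is a
`y`-weight times a fixed multiplier in `θ`. -/
lemma IsTest.integral_mul_transport_shift {φ : Pos n × Dir n → ℝ} (hφ : IsTest φ) {ρ : Pos n → ℝ}
    (hρ : ContDiff ℝ ∞ ρ) (hρc : HasCompactSupport ρ) (p : Pos n × Dir n) :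
    ∫ y, ρ y * transport φ (shift y p) =
      ∑ i, ∫ y, pderiv i ρ y * ((p.2 : Pos n) i * φ (shift y p)) := by
  obtain ⟨x, θ⟩ := p
  have hg : ContDiff ℝ ∞ fun y : Pos n => φ (x - y, θ) :=
    (hφ.contDiff_slice θ).comp (contDiff_const.sub contDiff_id)
  have hd : ∀ y, fderiv ℝ (fun y : Pos n => φ (x - y, θ)) y θ = -transport φ (x - y, θ) := fun y =>
    fderiv_comp_const_sub_apply (hφ.contDiff_slice θ) x y θ
  have h := integral_mul_fderiv_eq_neg hρ hg hρc (θ : Pos n)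
  simp only [hd, mul_neg, integral_neg, neg_inj] at h
  refine h.trans ?_
  rw [← integral_finsetSum]
  · refine integral_congr_ae (Eventually.of_forall fun y => ?_)
    simp only [fderiv_apply_eq_sum, Finset.sum_mul, shift]
    exact Finset.sum_congr rfl fun i _ => by ring
  · intro i _
    exact ((continuous_pderiv i hρ).mul (continuous_const.mul
      hg.continuous)).integrable_of_hasCompactSupport
      (hasCompactSupport_pderiv i hρc).mul_right

lemma memLp_coord (i : Fin (n + 1)) :
    MemLp (fun p : Pos n × Dir n => (p.2 : Pos n) i) ∞ (phase n) :=
  memLp_top_of_bound (Continuous.aestronglyMeasurable (by fun_prop)) 1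
    (Eventually.of_forall fun p => (PiLp.norm_apply_le (p.2 : Pos n) i).trans_eq
      (norm_eq_of_mem_sphere p.2))

lemma IsTest.integral_transport_shift {φ : Pos n × Dir n → ℝ} (hφ : IsTest φ) (u : L2 n)
    {ρ : Pos n → ℝ} (hρ : ContDiff ℝ ∞ ρ) (hρc : HasCompactSupport ρ) :
    ∫ y, ρ y * ∫ p, u p * transport φ (shift y p) ∂(phase n) =
      ∑ i, ∫ y, pderiv i ρ y * ∫ p, u p * ((p.2 : Pos n) i * φ (shift y p)) ∂(phase n) := by
  have hi : ∀ i, Integrable (fun q : Pos n × (Pos n × Dir n) =>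
      pderiv i ρ q.1 * (u q.2 * ((q.2.2 : Pos n) i * φ (shift q.1 q.2))))
      ((volume : Measure (Pos n)).prod (phase n)) := fun i =>
    integrable_mul_shift (g := fun p => (p.2 : Pos n) i * φ p) (continuous_pderiv i hρ)
      (hasCompactSupport_pderiv i hρc) u
      (Continuous.mul (by fun_prop) hφ.continuous) ((hφ.memLp 2).mul' (memLp_coord i))
  simp only [← integral_const_mul]
  rw [integral_integral_swap (integrable_mul_shift hρ.continuous hρc u hφ.continuous_transport
    (hφ.memLp_transport 2))]
  rw [Finset.sum_congr rfl fun i _ => integral_integral_swap (hi i),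
    ← integral_finsetSum _ fun i _ => (hi i).integral_prod_right]
  refine integral_congr_ae (Eventually.of_forall fun p => ?_)
  simp only [mul_left_comm _ (u p), integral_const_mul, ← Finset.mul_sum]
  rw [hφ.integral_mul_transport_shift hρ hρc p]

/-- The functional `v ↦ ∬ θ_i u v dx dθ`. -/
def coordFunctional (u : HSpace n s c ε) (i : Fin (n + 1)) : StrongDual ℝ (HSpace n s c ε) :=
  (innerSL ℝ (bddMul (memLp_coord i) u.toL2)).comp (HSpace.incl n s c ε)

lemma coordFunctional_apply (u v : HSpace n s c ε) (i : Fin (n + 1)) :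
    coordFunctional u i v = inner ℝ (bddMul (memLp_coord i) u.toL2) v.toL2 := rfl

lemma eq_zero_of_integral_bump_mul {F : Pos n → ℝ} (hF : Continuous F)
    (h : ∀ b : ContDiffBump (0 : Pos n), ∫ y, b y * F y = 0) : F 0 = 0 := by
  let b : ℕ → ContDiffBump (0 : Pos n) := fun k =>
    ⟨1 / ((k : ℝ) + 1) / 2, 1 / ((k : ℝ) + 1), by positivity, half_lt_self (by positivity)⟩
  -- Convolution at the origin evaluates its second argument at `0 - y`, hence the composition with
  -- negation.
  have hb := ContDiffBump.convolution_tendsto_right_of_continuous (μ := volume) (φ := b)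
    tendsto_one_div_add_atTop_nhds_zero_nat (hF.comp continuous_neg) 0
  have hz : ∀ k, (MeasureTheory.convolution ((b k).normed volume) (F ∘ Neg.neg)
      (ContinuousLinearMap.lsmul ℝ ℝ) volume) 0 = 0 := fun k => by
    rw [convolution_lsmul]
    simp only [ContDiffBump.normed_def, zero_sub, Function.comp_apply, neg_neg, smul_eq_mul,
      div_mul_eq_mul_div]
    rw [integral_div, h, zero_div]
  simpa using tendsto_nhds_unique hb (tendsto_const_nhds.congr fun k => (hz k).symm)

/-- The multiplier `θ_i` is symmetric and commutes with translations in `x`, so `y ↦ ⟨θ_i u, τ_y u⟩`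
is even, while `∂_i ρ` is odd. -/
lemma average_coordFunctional_self [Fact (0 < ε)] (u : HSpace n s c ε) (i : Fin (n + 1)) {ρ : Pos n → ℝ}
    (hρ : ContDiff ℝ ∞ ρ) (hρc : HasCompactSupport ρ) (hρe : ∀ y, ρ (-y) = ρ y) :
    HSpace.average (continuous_pderiv i hρ) (hasCompactSupport_pderiv i hρc)
      (coordFunctional u i) u = 0 := by
  have hcomm : ∀ y, lpShift y (bddMul (memLp_coord i) u.toL2) =
      bddMul (memLp_coord i) (lpShift y u.toL2) := fun y => by
    apply Lp.ext
    filter_upwards [coeFn_lpShift y (bddMul (memLp_coord i) u.toL2),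
      (measurePreserving_shift (surf n) y).quasiMeasurePreserving.ae
        (coeFn_bddMul (memLp_coord i) u.toL2),
      coeFn_bddMul (memLp_coord i) (lpShift y u.toL2), coeFn_lpShift y u.toL2] with q h1 h2 h3 h4
    rw [h1, h2, h3, h4]
    rfl
  have heven : ∀ y, coordFunctional u i (u.translate (-y)) = coordFunctional u i (u.translate y) :=
    fun y => by
      rw [coordFunctional_apply, coordFunctional_apply, HSpace.toL2_translate,
        HSpace.toL2_translate, ← inner_lpShift, hcomm, inner_bddMul_comm, real_inner_comm]
  have h : ∫ y, pderiv i ρ y * coordFunctional u i (u.translate y) =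
      -∫ y, pderiv i ρ y * coordFunctional u i (u.translate y) := by
    rw [← integral_neg]
    conv_lhs => rw [← integral_neg_eq_self]
    refine integral_congr_ae (Eventually.of_forall fun y => ?_)
    simp only [heven, pderiv_neg_of_even i hρ hρe, neg_mul]
  rw [HSpace.average_apply]
  linarith

section

variable [Fact (1 ≤ n)] [Fact (s < 1)]

lemma translate_testToH (y : Pos n) (φ : testSpace n) :
    (testToH n s c ε φ).translate y = testToH n s c ε ⟨_, φ.2.translate y⟩ := by
  apply HSpace.ext_ae
  filter_upwards [coeFn_lpShift y (testToH n s c ε φ).toL2,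
    (measurePreserving_shift (surf n) y).quasiMeasurePreserving.ae
      (coeFn_testToH (s := s) (c := c) (ε := ε) φ),
    coeFn_testToH (s := s) (c := c) (ε := ε) ⟨_, φ.2.translate y⟩] with q h1 h2 h3
  rw [HSpace.toL2_translate, h1, h2, h3]
  rfl

variable [Fact (0 < ε)]

/-- Averaging over translations moves the derivative from the test function to `ρ`, so the right
side involves `u` only through `L²` pairings. Both sides are bounded on `𝓗^s_ε`, so by density
agreement on test functions is enough, and the identity may then be evaluated at `u`. -/
lemma average_eq {u : HSpace n s c ε} {ℓ : StrongDual ℝ (HSpace n s c ε)}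
    (h : IsWeakTransport u ℓ) {ρ : Pos n → ℝ} (hρ : ContDiff ℝ ∞ ρ) (hρc : HasCompactSupport ρ) :
    HSpace.average hρ.continuous hρc ℓ = -∑ i, HSpace.average (continuous_pderiv i hρ)
      (hasCompactSupport_pderiv i hρc) (coordFunctional u i) := by
  rw [isWeakTransport_iff] at h
  apply HSpace.dual_ext
  intro φ
  have h1 : ∀ y, ℓ ((testToH n s c ε φ).translate y) =
      -∫ p, u.toL2 p * transport (φ : Pos n × Dir n → ℝ) (shift y p) ∂(phase n) := fun y => by
    rw [translate_testToH, h, L2.inner_def]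
    congr 1
    refine integral_congr_ae ?_
    filter_upwards [coeFn_testTransport ⟨_, φ.2.translate y⟩] with p hp
    rw [hp]
    simp only [RCLike.inner_apply, conj_trivial, IsTest.transport_translate, mul_comm]
    rfl
  have h2 : ∀ i y, coordFunctional u i ((testToH n s c ε φ).translate y) =
      ∫ p, u.toL2 p * ((p.2 : Pos n) i * (φ : Pos n × Dir n → ℝ) (shift y p)) ∂(phase n) :=
    fun i y => by
      rw [translate_testToH, coordFunctional_apply, inner_bddMul]
      refine integral_congr_ae ?_
      filter_upwards [coeFn_testToH (s := s) (c := c) (ε := ε) ⟨_, φ.2.translate y⟩] with p hp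
      rw [hp]
      simp only [shift]
      ring
  rw [neg_apply, sum_apply]
  simp only [HSpace.average_apply, h1, h2, mul_neg, integral_neg]
  rw [φ.2.integral_transport_shift u.toL2 hρ hρc]

/-- `⟨T u, u⟩ = 0`. -/
lemma IsWeakTransport.apply_self {u : HSpace n s c ε} {ℓ : StrongDual ℝ (HSpace n s c ε)}
    (h : IsWeakTransport u ℓ) : ℓ u = 0 := by
  -- Every bump average of this continuous function about the origin vanishes, hence so does its
  -- value at `y = 0`.
  have hF : Continuous fun y : Pos n => ℓ (u.translate y) :=
    ℓ.continuous.comp (HSpace.continuous_translate u)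
  have hz : ∀ b : ContDiffBump (0 : Pos n), ∫ y, b y * ℓ (u.translate y) = 0 := fun b => by
    have h1 := congrArg (fun G => G u) (average_eq h b.contDiff b.hasCompactSupport)
    simp only [neg_apply, sum_apply] at h1
    rw [HSpace.average_apply] at h1
    rw [h1, Finset.sum_eq_zero fun i _ => average_coordFunctional_self u i b.contDiff
      b.hasCompactSupport b.neg, neg_zero]
  rw [← HSpace.translate_zero u]
  exact eq_zero_of_integral_bump_mul hF hz

end

end

section

open Filter Topology Set

variable {n : ℕ} {s : ℝ} {c ε : ℝ≥0} {σ lam : Pos n → ℝ}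

/-! ### The collision and absorption operator -/

lemma memLp_comp_fst {α : Type*} [MeasurableSpace α] (μ : Measure α) [SFinite μ] {a : Pos n → ℝ}
    (ha : Continuous a) {C : ℝ} (hC : ∀ x, |a x| ≤ C) :
    MemLp (fun q : Pos n × α => a q.1) ∞ ((volume : Measure (Pos n)).prod μ) :=
  memLp_top_of_bound (ha.measurable.comp measurable_fst).aestronglyMeasurable C
    (Eventually.of_forall fun q => hC q.1)

section

variable [Fact (0 < ε)]
  (hσ : MemLp (fun q : Pos n × (Dir n × Dir n) => σ q.1) ∞ (pairs n))
  (hlam : MemLp (fun p : Pos n × Dir n => lam p.1) ∞ (phase n))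

/-- The operator on `𝓗^s_ε` of the form `∬ λ u v dx dθ + ε^{2s} ∫ σ 𝓑(u, v) dx`. -/
def collisionOp (s : ℝ) (c ε : ℝ≥0) [Fact (0 < ε)] : HSpace n s c ε →L[ℝ] HSpace n s c ε :=
  (HSpace.incl n s c ε).adjoint ∘L bddMul hlam ∘L HSpace.incl n s c ε +
    ((ε : ℝ) ^ (2 * s) / 2) •
      ((HSpace.grad n s c ε).adjoint ∘L bddMul hσ ∘L HSpace.grad n s c ε)

lemma inner_collisionOp (u v : HSpace n s c ε) :
    inner ℝ (collisionOp hσ hlam s c ε u) v = inner ℝ (bddMul hlam u.toL2) v.toL2 +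
      (ε : ℝ) ^ (2 * s) / 2 *
        inner ℝ (bddMul hσ (HSpace.grad n s c ε u)) (HSpace.grad n s c ε v) := by
  simp only [collisionOp, add_apply, smul_apply, ContinuousLinearMap.comp_apply, inner_add_left,
    real_inner_smul_left, ContinuousLinearMap.adjoint_inner_left, HSpace.incl_apply]

lemma inner_collisionOp_comm (u v : HSpace n s c ε) :
    inner ℝ (collisionOp hσ hlam s c ε u) v = inner ℝ u (collisionOp hσ hlam s c ε v) := by
  rw [← real_inner_comm u, inner_collisionOp, inner_collisionOp, inner_bddMul_comm hlam u.toL2,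
    inner_bddMul_comm hσ (HSpace.grad n s c ε u), real_inner_comm u.toL2,
    real_inner_comm (HSpace.grad n s c ε u)]

lemma le_inner_collisionOp {σ₀ lam₀ : ℝ} (hσ₀ : ∀ x, σ₀ ≤ σ x) (hlam₀ : ∀ x, lam₀ ≤ lam x)
    (u : HSpace n s c ε) :
    lam₀ * ‖u.toL2‖ ^ 2 + σ₀ * ((ε : ℝ) ^ (2 * s) / 2 * ‖HSpace.grad n s c ε u‖ ^ 2) ≤
      inner ℝ (collisionOp hσ hlam s c ε u) u := by
  rw [inner_collisionOp, mul_left_comm σ₀]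
  have := HSpace.weight_nonneg ε s
  exact add_le_add (le_inner_bddMul hlam (fun p => hlam₀ p.1) _)
    (mul_le_mul_of_nonneg_left (le_inner_bddMul hσ (fun q => hσ₀ q.1) _) (by linarith))

lemma coercive_collisionOp {σ₀ lam₀ : ℝ} (hσ₀ : ∀ x, σ₀ ≤ σ x) (hlam₀ : ∀ x, lam₀ ≤ lam x)
    (hσp : 0 < σ₀) (hlamp : 0 < lam₀) :
    ∃ α > 0, ∀ u : HSpace n s c ε, α * ‖u‖ ^ 2 ≤ inner ℝ (collisionOp hσ hlam s c ε u) u := by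
  have he := HSpace.weight_nonneg ε s
  have he1 : 0 < 1 + (ε : ℝ) ^ (2 * s) := by linarith
  -- Absorption must pay for the full `L²` weight `1 + ε^{2s}` in the norm, while scattering pays
  -- for the increments.
  refine ⟨min (lam₀ / (1 + (ε : ℝ) ^ (2 * s))) σ₀, lt_min (div_pos hlamp he1) hσp, fun u => ?_⟩
  refine le_trans ?_ (le_inner_collisionOp hσ hlam hσ₀ hlam₀ u)
  rw [HSpace.norm_sq_eq_grad, mul_add]
  refine add_le_add ?_ ?_
  · rw [← mul_assoc]
    refine mul_le_mul_of_nonneg_right ?_ (sq_nonneg _)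
    rw [← le_div_iff₀ he1]
    exact min_le_left _ _
  · exact mul_le_mul_of_nonneg_right (min_le_right _ _) (by positivity)

/-- The factor `ε^{2s}/2` in the form is exactly the weight of the increments in the norm, so the
bound on the scattering term does not depend on `ε`. -/
lemma half_weight_mul_norm_grad_le (u v : HSpace n s c ε) :
    (ε : ℝ) ^ (2 * s) / 2 * (‖HSpace.grad n s c ε u‖ * ‖HSpace.grad n s c ε v‖) ≤ ‖u‖ * ‖v‖ := by
  have he := HSpace.weight_nonneg ε s
  have h : ∀ w : HSpace n s c ε,
      (ε : ℝ) ^ (2 * s) / 2 * ‖HSpace.grad n s c ε w‖ ^ 2 ≤ ‖w‖ ^ 2 := fun w => by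
    rw [HSpace.norm_sq_eq_grad]
    exact le_add_of_nonneg_left (by positivity)
  refine le_of_sq_le_sq ?_ (by positivity)
  calc ((ε : ℝ) ^ (2 * s) / 2 * (‖HSpace.grad n s c ε u‖ * ‖HSpace.grad n s c ε v‖)) ^ 2
      = ((ε : ℝ) ^ (2 * s) / 2 * ‖HSpace.grad n s c ε u‖ ^ 2) *
        ((ε : ℝ) ^ (2 * s) / 2 * ‖HSpace.grad n s c ε v‖ ^ 2) := by ring
    _ ≤ ‖u‖ ^ 2 * ‖v‖ ^ 2 := mul_le_mul (h u) (h v) (by positivity) (sq_nonneg _)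
    _ = (‖u‖ * ‖v‖) ^ 2 := by ring

lemma abs_inner_collisionOp_le {C C' : ℝ} (hC : ∀ x, |σ x| ≤ C) (hC' : ∀ x, |lam x| ≤ C')
    (u v : HSpace n s c ε) :
    |inner ℝ (collisionOp hσ hlam s c ε u) v| ≤ (C' + C) * (‖u‖ * ‖v‖) := by
  have he := HSpace.weight_nonneg ε s
  have hC0 : 0 ≤ C := (abs_nonneg _).trans (hC 0)
  have hC0' : 0 ≤ C' := (abs_nonneg _).trans (hC' 0)
  rw [inner_collisionOp, add_mul]
  refine (abs_add_le _ _).trans (add_le_add ?_ ?_)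
  · refine (abs_real_inner_le_norm _ _).trans ?_
    rw [← mul_assoc]
    exact mul_le_mul ((norm_bddMul_le hlam (fun p => hC' p.1) _).trans
      (mul_le_mul_of_nonneg_left (HSpace.norm_toL2_le u) hC0')) (HSpace.norm_toL2_le v)
      (norm_nonneg _) (by positivity)
  · rw [abs_mul, abs_of_nonneg (by positivity : 0 ≤ (ε : ℝ) ^ (2 * s) / 2)]
    calc (ε : ℝ) ^ (2 * s) / 2 *
          |inner ℝ (bddMul hσ (HSpace.grad n s c ε u)) (HSpace.grad n s c ε v)|
        ≤ (ε : ℝ) ^ (2 * s) / 2 * (C * ‖HSpace.grad n s c ε u‖ * ‖HSpace.grad n s c ε v‖) := by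
          refine mul_le_mul_of_nonneg_left ((abs_real_inner_le_norm _ _).trans ?_) (by positivity)
          exact mul_le_mul_of_nonneg_right (norm_bddMul_le hσ (fun q => hC q.1) _) (norm_nonneg _)
      _ = C * ((ε : ℝ) ^ (2 * s) / 2 *
          (‖HSpace.grad n s c ε u‖ * ‖HSpace.grad n s c ε v‖)) := by ring
      _ ≤ C * (‖u‖ * ‖v‖) :=
          mul_le_mul_of_nonneg_left (half_weight_mul_norm_grad_le u v) hC0

include hσ in
lemma integral_mul_formB (u v : HSpace n s c ε) {φ : Pos n × Dir n → ℝ}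
    (hv : v.toL2 =ᵐ[phase n] φ) :
    ∫ x, σ x * formB n s c (fun θ => u.toL2 (x, θ)) (fun θ => φ (x, θ)) =
      1 / 2 * inner ℝ (bddMul hσ (HSpace.grad n s c ε u)) (HSpace.grad n s c ε v) := by
  have hae : (fun q => inner ℝ (bddMul hσ (HSpace.grad n s c ε u) q) (HSpace.grad n s c ε v q))
      =ᵐ[pairs n] fun q => σ q.1 * (kernel n s c q.2.1 q.2.2 *
        (u.toL2 (q.1, q.2.1) - u.toL2 (q.1, q.2.2)) * (φ (q.1, q.2.1) - φ (q.1, q.2.2))) := by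
    filter_upwards [coeFn_bddMul hσ (HSpace.grad n s c ε u), HSpace.coeFn_grad u,
      HSpace.coeFn_grad v, wincr_congr s c hv] with q h1 h2 h3 h4
    rw [h1, h2, h3, h4, ← wincr_mul]
    simp only [RCLike.inner_apply, conj_trivial]
    ring
  have hi := (L2.integrable_inner (𝕜 := ℝ) (bddMul hσ (HSpace.grad n s c ε u))
    (HSpace.grad n s c ε v)).congr hae
  rw [L2.inner_def, integral_congr_ae hae, integral_prod _ hi, ← integral_const_mul]
  refine integral_congr_ae (Eventually.of_forall fun x => ?_)
  simp only [formB]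
  rw [integral_const_mul]
  ring

/-! ### The equation in the dual space: existence, uniqueness and the uniform bound -/

variable [Fact (1 ≤ n)] [Fact (s < 1)]

/-- Both sides of the weak formulation are continuous functionals evaluated at a test function.
Density turns the equation into an identity in the dual, which can then be tested with `u`. -/
lemma isWeakSolution_iff (f : L2 n) (u : YSpace n s c ε) :
    IsWeakSolution σ lam f u ↔ u.T + innerSL ℝ (collisionOp hσ hlam s c ε u.toH) =
      (innerSL ℝ f).comp (HSpace.incl n s c ε) := by
  have hT := isWeakTransport_iff.1 u.isWeakTransport
  have key : ∀ φ : testSpace n,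
      (∫ p, (-(u.toH.toL2 p * transport φ p) + lam p.1 * u.toH.toL2 p *
        (φ : Pos n × Dir n → ℝ) p) ∂(phase n)) + (ε : ℝ) ^ (2 * s) *
        ∫ x, σ x * formB n s c (fun θ => u.toH.toL2 (x, θ))
          (fun θ => (φ : Pos n × Dir n → ℝ) (x, θ)) =
      (u.T + innerSL ℝ (collisionOp hσ hlam s c ε u.toH)) (testToH n s c ε φ) := fun φ => by
    have e1 : (fun p => inner ℝ (u.toH.toL2 p) (testTransport n φ p)) =ᵐ[phase n]
        fun p => u.toH.toL2 p * transport (φ : Pos n × Dir n → ℝ) p := by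
      filter_upwards [coeFn_testTransport φ] with p hp
      rw [hp]
      simp only [RCLike.inner_apply, conj_trivial, mul_comm]
    have e2 : (fun p => inner ℝ (bddMul hlam u.toH.toL2 p) ((testToH n s c ε φ).toL2 p))
        =ᵐ[phase n] fun p => lam p.1 * u.toH.toL2 p * (φ : Pos n × Dir n → ℝ) p := by
      filter_upwards [coeFn_testToH (s := s) (c := c) (ε := ε) φ,
        coeFn_bddMul hlam u.toH.toL2] with p hp hp'
      rw [hp, hp']
      simp only [RCLike.inner_apply, conj_trivial, mul_comm]
    have i1 := (L2.integrable_inner (𝕜 := ℝ) u.toH.toL2 (testTransport n φ)).congr e1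
    have i2 := (L2.integrable_inner (𝕜 := ℝ) (bddMul hlam u.toH.toL2)
      (testToH n s c ε φ).toL2).congr e2
    have i1' : Integrable (fun p => -(u.toH.toL2 p * transport (φ : Pos n × Dir n → ℝ) p))
      (phase n) := i1.neg
    rw [integral_add i1' i2, integral_neg, integral_mul_formB hσ u.toH (testToH n s c ε φ)
      (coeFn_testToH φ), add_apply, hT, innerSL_apply_apply, inner_collisionOp,
      L2.inner_def u.toH.toL2, L2.inner_def (bddMul hlam _), integral_congr_ae e1, integral_congr_ae e2]
    ring
  have key' : ∀ φ : testSpace n, ∫ p, f p * (φ : Pos n × Dir n → ℝ) p ∂(phase n) =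
      ((innerSL ℝ f).comp (HSpace.incl n s c ε)) (testToH n s c ε φ) := fun φ => by
    rw [ContinuousLinearMap.comp_apply, innerSL_apply_apply, HSpace.incl_apply, L2.inner_def]
    refine integral_congr_ae ?_
    filter_upwards [coeFn_testToH (s := s) (c := c) (ε := ε) φ] with p hp
    rw [hp]
    simp only [RCLike.inner_apply, conj_trivial, mul_comm]
  constructor
  · intro h
    apply HSpace.dual_ext
    intro φ
    rw [← key, ← key']
    exact h φ φ.2
  · intro h φ hφ
    have h1 := key ⟨φ, hφ⟩
    rw [h, ← key'] at h1
    exact h1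

include hσ hlam in
lemma exists_isWeakSolution {σ₀ lam₀ : ℝ} (hσ₀ : ∀ x, σ₀ ≤ σ x) (hlam₀ : ∀ x, lam₀ ≤ lam x)
    (hσp : 0 < σ₀) (hlamp : 0 < lam₀) (f : L2 n) :
    ∃ u : YSpace n s c ε, IsWeakSolution σ lam f u := by
  obtain ⟨α, hα, hcoer⟩ := coercive_collisionOp (s := s) (c := c) (ε := ε) hσ hlam hσ₀ hlam₀
    hσp hlamp
  -- The operator is the formal adjoint of the equation on test functions, whence the minus sign
  -- before transport. The adjoint of the inclusion turns the `L²` function `θ·∇φ` into a vector of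
  -- `𝓗^s_ε`.
  obtain ⟨u, hu⟩ := exists_inner_eq_of_coercive (testToH n s c ε)
    ((collisionOp hσ hlam s c ε).toLinearMap ∘ₗ testToH n s c ε -
      (HSpace.incl n s c ε).adjoint.toLinearMap ∘ₗ testTransport n)
    ((innerSL ℝ f).comp (HSpace.incl n s c ε)) hα (fun φ => by
      have h0 := inner_testToH_testTransport (s := s) (c := c) (ε := ε) φ
      simp only [LinearMap.sub_apply, LinearMap.comp_apply, ContinuousLinearMap.coe_coe,
        inner_sub_left, ContinuousLinearMap.adjoint_inner_left, HSpace.incl_apply]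
      rw [← real_inner_comm (testTransport n φ), h0, sub_zero]
      exact hcoer _)
  -- The transport derivative is read off from the equation; that it lies in the dual is then
  -- automatic.
  let T := (innerSL ℝ f).comp (HSpace.incl n s c ε) - innerSL ℝ (collisionOp hσ hlam s c ε u)
  have hT : IsWeakTransport u T := by
    rw [isWeakTransport_iff]
    intro φ
    have h := hu φ
    simp only [LinearMap.sub_apply, LinearMap.comp_apply, ContinuousLinearMap.coe_coe,
      inner_sub_right, ContinuousLinearMap.adjoint_inner_right, HSpace.incl_apply] at h
    simp only [T, sub_apply, innerSL_apply_apply]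
    rw [← h, inner_collisionOp_comm]
    ring
  exact ⟨⟨u, T, hT⟩, (isWeakSolution_iff hσ hlam f _).2 (sub_add_cancel _ _)⟩

include hσ hlam in
lemma isWeakSolution_unique {σ₀ lam₀ : ℝ} (hσ₀ : ∀ x, σ₀ ≤ σ x) (hlam₀ : ∀ x, lam₀ ≤ lam x)
    (hσp : 0 < σ₀) (hlamp : 0 < lam₀) {f : L2 n} {u v : YSpace n s c ε}
    (hu : IsWeakSolution σ lam f u) (hv : IsWeakSolution σ lam f v) : u = v := by
  rw [isWeakSolution_iff hσ hlam] at hu hv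
  obtain ⟨α, hα, hcoer⟩ := coercive_collisionOp (s := s) (c := c) (ε := ε) hσ hlam hσ₀ hlam₀
    hσp hlamp
  have hw : IsWeakTransport (u.toH - v.toH) (u.T - v.T) := by
    rw [isWeakTransport_iff]
    intro φ
    have h1 := isWeakTransport_iff.1 u.isWeakTransport φ
    have h2 := isWeakTransport_iff.1 v.isWeakTransport φ
    have hsub : (u.toH - v.toH).toL2 = u.toH.toL2 - v.toH.toL2 := rfl
    rw [sub_apply, h1, h2, hsub, inner_sub_left]
    ring
  have hT : u.T - v.T = -innerSL ℝ (collisionOp hσ hlam s c ε (u.toH - v.toH)) := by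
    rw [eq_sub_of_add_eq hu, eq_sub_of_add_eq hv, map_sub, map_sub]
    abel
  have h0 := hw.apply_self
  rw [hT, neg_apply, innerSL_apply_apply, neg_eq_zero] at h0
  have h1 : ‖u.toH - v.toH‖ ^ 2 ≤ 0 := by
    have := hcoer (u.toH - v.toH)
    rw [h0] at this
    exact nonpos_of_mul_nonpos_right this hα
  have h2 : u.toH - v.toH = 0 := by
    rw [← norm_eq_zero]
    exact pow_eq_zero_iff two_ne_zero |>.1 (le_antisymm h1 (sq_nonneg _))
  -- An element of `YSpace` carries its transport derivative as data, so the two derivatives must be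
  -- identified as well; the equation does this.
  rw [h2, map_zero, map_zero, neg_zero, sub_eq_zero] at hT
  rw [sub_eq_zero] at h2
  cases u
  cases v
  simp_all

include hσ hlam in
-- Write `a` for the `L²` norm of `u` and `G` for the weighted increment energy. Testing with `u`
-- gives `λ₀ a² + σ₀ G ≤ ‖f‖ a`, hence `a ≤ ‖f‖ / λ₀` and `G ≤ ‖f‖² / (λ₀ σ₀)`. Since `‖u‖² = (1 +
-- ε^{2s}) a² + G`, only the upper bound `E` on `ε^{2s}` enters. The dual norm of `Tu` follows from
-- `Tu = f - Au`.
lemma norm_le_of_isWeakSolution {σ₀ lam₀ C C' E : ℝ} (hσ₀ : ∀ x, σ₀ ≤ σ x)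
    (hlam₀ : ∀ x, lam₀ ≤ lam x) (hσp : 0 < σ₀) (hlamp : 0 < lam₀) (hC : ∀ x, |σ x| ≤ C)
    (hC' : ∀ x, |lam x| ≤ C') (hE : (ε : ℝ) ^ (2 * s) ≤ E) {f : L2 n} {u : YSpace n s c ε}
    (hu : IsWeakSolution σ lam f u) :
    ‖u‖ ≤ (1 + (1 + (C' + C)) * √((1 + E) / lam₀ ^ 2 + 1 / (lam₀ * σ₀))) * ‖f‖ := by
  rw [isWeakSolution_iff hσ hlam] at hu
  have he := HSpace.weight_nonneg ε s
  have hE0 : 0 ≤ E := he.trans hE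
  have hC0 : 0 ≤ C := (abs_nonneg _).trans (hC 0)
  have hC0' : 0 ≤ C' := (abs_nonneg _).trans (hC' 0)
  have h1 := congrArg (fun G => G u.toH) hu
  simp only [add_apply, u.isWeakTransport.apply_self, zero_add, innerSL_apply_apply,
    ContinuousLinearMap.comp_apply, HSpace.incl_apply] at h1
  have h2 := le_inner_collisionOp hσ hlam hσ₀ hlam₀ u.toH
  rw [h1] at h2
  have h3 := h2.trans (real_inner_le_norm f u.toH.toL2)
  have h4 := HSpace.norm_sq_eq_grad u.toH
  set a := ‖u.toH.toL2‖
  set G := (ε : ℝ) ^ (2 * s) / 2 * ‖HSpace.grad n s c ε u.toH‖ ^ 2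
  have ha : 0 ≤ a := norm_nonneg _
  have hf : 0 ≤ ‖f‖ := norm_nonneg f
  have hG : 0 ≤ G := by positivity
  have ha' : a ≤ ‖f‖ / lam₀ := by
    rw [le_div_iff₀ hlamp]
    rcases ha.eq_or_lt with h | h
    · rw [← h]; linarith
    · have : lam₀ * a ^ 2 ≤ ‖f‖ * a := by nlinarith [mul_nonneg hσp.le hG]
      nlinarith
  have hG' : G ≤ ‖f‖ ^ 2 / (lam₀ * σ₀) := by
    rw [le_div_iff₀ (by positivity)]
    have h5 : σ₀ * G ≤ ‖f‖ * a := by nlinarith [mul_nonneg hlamp.le (sq_nonneg a)]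
    have h6 : a * lam₀ ≤ ‖f‖ := (le_div_iff₀ hlamp).1 ha'
    nlinarith [mul_le_mul_of_nonneg_left h6 hf, mul_le_mul_of_nonneg_right h5 hlamp.le]
  have hnorm : ‖u.toH‖ ≤ √((1 + E) / lam₀ ^ 2 + 1 / (lam₀ * σ₀)) * ‖f‖ := by
    rw [← Real.sqrt_sq hf, ← Real.sqrt_mul' _ (sq_nonneg _)]
    apply Real.le_sqrt_of_sq_le
    rw [h4]
    calc (1 + (ε : ℝ) ^ (2 * s)) * a ^ 2 + G
        ≤ (1 + E) * (‖f‖ / lam₀) ^ 2 + ‖f‖ ^ 2 / (lam₀ * σ₀) := by gcongr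
      _ = _ := by ring
  have hTn : ‖u.T‖ ≤ ‖f‖ + (C' + C) * ‖u.toH‖ := by
    refine ContinuousLinearMap.opNorm_le_bound _ (by positivity) fun v => ?_
    rw [eq_sub_of_add_eq hu, sub_apply, innerSL_apply_apply, ContinuousLinearMap.comp_apply,
      innerSL_apply_apply, HSpace.incl_apply, add_mul]
    refine (norm_sub_le _ _).trans (add_le_add ?_ ?_)
    · exact (norm_inner_le_norm _ _).trans
        (mul_le_mul_of_nonneg_left (HSpace.norm_toL2_le v) hf)
    · rw [mul_assoc]
      exact abs_inner_collisionOp_le hσ hlam hC hC' u.toH v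
  calc ‖u‖ = ‖u.toH‖ + ‖u.T‖ := rfl
    _ ≤ ‖f‖ + (1 + (C' + C)) * ‖u.toH‖ := by linarith
    _ ≤ ‖f‖ + (1 + (C' + C)) * (√((1 + E) / lam₀ ^ 2 + 1 / (lam₀ * σ₀)) * ‖f‖) := by gcongr
    _ = _ := by ring

end

end

end FokkerPlanck

end

theorem mainTheorem4 (n : ℕ) (hn : 1 ≤ n) (s : ℝ) (hs0 : 0 < s) (hs1 : s < 1)
    (c : ℝ≥0) (hc : 0 < c)
    (σ lam : FokkerPlanck.Pos n → ℝ)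
    (hσ : FokkerPlanck.IsAdmissibleCoeff σ) (hlam : FokkerPlanck.IsAdmissibleCoeff lam)
    (ε₀ : ℝ≥0) :
    ∃ C : ℝ, 0 < C ∧ ∀ ε : ℝ≥0, 0 < ε → ε ≤ ε₀ → ∀ f : FokkerPlanck.L2 n,
      (∃! u : FokkerPlanck.YSpace n s c ε, FokkerPlanck.IsWeakSolution σ lam f u) ∧
        ∀ u : FokkerPlanck.YSpace n s c ε,
          FokkerPlanck.IsWeakSolution σ lam f u → ‖u‖ ≤ C * ‖f‖ := by
  have : Fact (1 ≤ n) := ⟨hn⟩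
  have : Fact (s < 1) := ⟨hs1⟩
  obtain ⟨⟨_, hσL⟩, σ₀, hσp, hσb⟩ := hσ
  obtain ⟨⟨_, hlamL⟩, lam₀, hlamp, hlamb⟩ := hlam
  have hσC : ∀ x, |σ x| ≤ σ₀⁻¹ := fun x =>
    (abs_of_pos (hσp.trans_le (hσb x).1)).trans_le (hσb x).2
  have hlamC : ∀ x, |lam x| ≤ lam₀⁻¹ := fun x =>
    (abs_of_pos (hlamp.trans_le (hlamb x).1)).trans_le (hlamb x).2
  have hσm := FokkerPlanck.memLp_comp_fst ((FokkerPlanck.surf n).prod (FokkerPlanck.surf n))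
    hσL.continuous hσC
  have hlamm := FokkerPlanck.memLp_comp_fst (FokkerPlanck.surf n) hlamL.continuous hlamC
  -- The constant is fixed before `ε`: take `E = ε₀^{2s}`, which dominates `ε^{2s}` because `s > 0`.
  refine ⟨1 + (1 + (lam₀⁻¹ + σ₀⁻¹)) *
    √((1 + (ε₀ : ℝ) ^ (2 * s)) / lam₀ ^ 2 + 1 / (lam₀ * σ₀)), by positivity,
    fun ε hε hε₀ f => ?_⟩
  have : Fact (0 < ε) := ⟨hε⟩
  refine ⟨?_, fun u hu => ?_⟩
  · obtain ⟨u, hu⟩ := FokkerPlanck.exists_isWeakSolution (s := s) (c := c) (ε := ε) hσm hlamm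
      (fun x => (hσb x).1) (fun x => (hlamb x).1) hσp hlamp f
    exact ⟨u, hu, fun v hv => FokkerPlanck.isWeakSolution_unique hσm hlamm
      (fun x => (hσb x).1) (fun x => (hlamb x).1) hσp hlamp hv hu⟩
  · exact FokkerPlanck.norm_le_of_isWeakSolution hσm hlamm (fun x => (hσb x).1)
      (fun x => (hlamb x).1) hσp hlamp hσC hlamC
      (Real.rpow_le_rpow ε.2 (NNReal.coe_le_coe.2 hε₀) (by linarith)) hu
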